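/- **Theorem.** Setting. Let $d\ge1$, $n\ge2$, $\alpha\ge2$ be integers, $B,M>0$, and let $\mathcal X\subseteq[0,1]^d$ be a Borel set. Let $\rho$ be a Borel probability measure on $\mathcal X\times[-M,M]$ with marginal $\rho_X$ on $\mathcal X$ and conditional mean $f_\rho(x)=\int y\,d\rho(y|x)$. Assume that the identity maps $J_\rho:L^1(\mathcal X)\to L^1_{\rho_X}(\mathcal X)$ and $\bar J_\rho:L^1_{\rho_X}(\mathcal X)\to L^1(\mathcal X)$ (Lebesgue measure on $\mathcal X$ on one side) are well defined and bounded, and that $f_\rho$ agrees ($\rho_X$-a.e.) with a function in $W^\alpha_\infty([0,1]^d)$ of norm $\le B$, where $W^\alpha_\infty([0,1]^d)$ consists of the $(\alpha-1)$-times differentiable functions whose partial derivatives of order $\alpha-1$ are Lipschitz, with the norm $\sum_{|k|<\alpha-1}\|D^kf\|_\infty+\sum_{|k|=\alpha-1}\big(\|D^kf\|_\infty+\sup_{x\ne y}|D^kf(x)-D^kf(y)|/\|x-y\|_2\big)$. For $\delta>0$ let $B_{\delta,\infty}(x)=\{x'\in\mathcal X:\|x'-x\|_\infty\le\delta\}$,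 let $$\mathcal E^\delta(f)=\int\sup_{x'\in B_{\delta,\infty}(x)}(f(x')-y)^2\,d\rho(x,y),\qquad \mathcal E^\delta_*=\inf_{f\ \mathrm{measurable}}\mathcal E^\delta(f),$$ and, for a sample $D=((x_i,y_i))_{i\le n}$, let $\widehat{\mathcal E}^\delta_D(f)=\frac1n\sum_{i=1}^n\sup_{x'\in B_{\delta,\infty}(x_i)}(f(x')-y_i)^2$ and $q_X=\frac12\min_{i\ne j}\|x_i-x_j\|_\infty$. A ReLU network of depth $L$ and widths $d_1,\dots,d_L$ is a function $x\mapsto c\cdot\sigma\circ A_L\circ\cdots\circ\sigma\circ A_1(x)$ with $\sigma(t)=\max\{t,0\}$ applied coordinatewise, affine maps $A_\ell:\mathbb R^{d_{\ell-1}}\to\mathbb R^{d_\ell}$, $d_0=d$, and $c\in\mathbb R^{d_L}$. Let $\Delta_{\delta,\vec d,L}(D)$ be the set of minimizers of $\widehat{\mathcal E}^\delta_D$ over all networks of depth $L$ and widths $\vec d=(d_1,\dots,d_L)$. Put $S=\delta^{-d/(2\alpha-2)}\log(1/\delta)$. Claim. There are a constant $C_3$ depending only on $\|J_\rho\|,B,M$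 (in particular not on $d$, $n$, $\delta$) and a constant $K$ depending only on $d,\alpha,B$ such that, whenever $0<\delta<\frac13n^{-1/d}$ and $C_0\in(0,1]$, there are a depth $1\le L\le K\log(1/\delta)$, widths $d_1,d_2\le K(S+n)$ and $d_3,\dots,d_L\le KS$, and infinitely many estimators $D\mapsto\widehat f_D$ with the following properties. For every sample $D\in(\mathcal X\times[-M,M])^n$ with $\delta<q_X/3$, each $\widehat f_D$ lies in $\Delta_{\delta,\vec d,L}(D)$ and is computed by such a network with at most $K(S+n)$ non-zero parameters, and the $\widehat f_D$ of different estimators are different functions on $[0,1]^d$. For each of these estimators, with $\mathbb E$ the expectation over an i.i.d. sample $D\sim\rho^n$ conditioned on $\delta<q_X/3$ (the claim being void if this event has probability zero), $$\mathbb E\big[\mathcal E^\delta(\widehat f_D)-\mathcal E^\delta_*\big]\le C_3\sqrt d\,\max\{\delta,\ ((4+2C_0)\delta)^dn\},$$ and if moreover $d\ge2$ and $n^{-1/(d-1)}\le\delta$, then $$\mathbb E\big[\mathcal E^\delta(\widehat f_D)-\mathcal E^\delta_*\big]\le C_3\sqrt d\,((4+2C_0)\delta)^dn.$$ -/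

import Mathlib

open MeasureTheory

noncomputable section

namespace AdvTrain

/-! ### The unit cube, the separation distance, perturbation balls

Points live in `Fin d → ℝ`, whose norm is the sup norm. -/

/-- The cube `[0,1]^d`. -/
def cube (d : ℕ) : Set (Fin d → ℝ) := Set.Icc 0 1

/-- The perturbation ball `B_{δ,∞}(x) = {x' ∈ 𝒳 : ‖x' - x‖_∞ ≤ δ}`. -/
def advBall {d : ℕ} (𝒳 : Set (Fin d → ℝ)) (δ : ℝ) (x : Fin d → ℝ) : Set (Fin d → ℝ) :=
  {x' | x' ∈ 𝒳 ∧ ‖x' - x‖ ≤ δ}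

/-- A sample of `n` pairs `(x_i, y_i)`. -/
abbrev Sample (d n : ℕ) : Type := Fin n → (Fin d → ℝ) × ℝ

/-- `q_X = (1/2) min_{i ≠ j} ‖x_i - x_j‖_∞`, meaningful for `n ≥ 2`. -/
def sepDist {d n : ℕ} (D : Sample d n) : ℝ :=
  (1 / 2) * ⨅ p : {p : Fin n × Fin n // p.1 ≠ p.2}, ‖(D p.1.1).1 - (D p.1.2).1‖

/-! ### The space `W^α_∞([0,1]^d)` for an integer `α ≥ 2` -/

/-- Partial derivative in the `i`-th variable on the cube (one-sided on the faces). -/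
def pderivCube {d : ℕ} (i : Fin d) (f : (Fin d → ℝ) → ℝ) : (Fin d → ℝ) → ℝ :=
  fun x => derivWithin (fun t => f (Function.update x i t)) (Set.Icc 0 1) (x i)

/-- The mixed partial derivative `D^k f` on the cube for a multi-index `k`. -/
def mixedDeriv {d : ℕ} (k : Fin d → ℕ) (f : (Fin d → ℝ) → ℝ) : (Fin d → ℝ) → ℝ :=
  (List.finRange d).foldr (fun i g => (pderivCube i)^[k i] g) f

/-- `sup_{x ∈ [0,1]^d} |g x|`. -/
def supNormCube {d : ℕ} (g : (Fin d → ℝ) → ℝ) : ENNReal :=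
  ⨆ x ∈ cube d, ENNReal.ofReal |g x|

/-- `sup_{x ≠ y} |g x - g y| / ‖x - y‖_2` over the cube. -/
def lipSemiCube {d : ℕ} (g : (Fin d → ℝ) → ℝ) : ENNReal :=
  ⨆ x ∈ cube d, ⨆ y ∈ cube d, ⨆ _ : x ≠ y,
    ENNReal.ofReal (|g x - g y| / Real.sqrt (∑ i, (x i - y i) ^ 2))

/-- The norm of `W^α_∞([0,1]^d)` for an integer `α ≥ 1` (write `α = s + 1` with `s = α - 1`):
sup norms of the partial derivatives of order `< s`, and Lipschitz norms of those of order `s`. -/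
def holderNorm {d : ℕ} (α : ℕ) (f : (Fin d → ℝ) → ℝ) : ENNReal :=
  (∑ m ∈ Finset.range (α - 1), ∑ k ∈ Finset.piAntidiag (Finset.univ : Finset (Fin d)) m,
      supNormCube (mixedDeriv k f)) +
    ∑ k ∈ Finset.piAntidiag (Finset.univ : Finset (Fin d)) (α - 1),
      (supNormCube (mixedDeriv k f) + lipSemiCube (mixedDeriv k f))

/-- `f ∈ W^α_∞([0,1]^d)` with norm at most `B`. -/
def InHolderBall {d : ℕ} (α : ℕ) (B : ℝ) (f : (Fin d → ℝ) → ℝ) : Prop :=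
  ContDiffOn ℝ ((α - 1 : ℕ) : ℕ∞) f (cube d) ∧ holderNorm α f ≤ ENNReal.ofReal B

/-! ### The distribution -/

/-- The operator norm of the identity `L¹(μ) → L¹(ν)`; it is `∞` if this map is unbounded or
not well defined. -/
def idL1Norm {E : Type*} [MeasurableSpace E] (μ ν : Measure E) : ENNReal :=
  sInf {c | ∀ g : E → ℝ, Measurable g → Integrable g μ →
    ∫⁻ x, ‖g x‖ₑ ∂ν ≤ c * ∫⁻ x, ‖g x‖ₑ ∂μ}

/-- `‖J_ρ‖`, for `J_ρ : L¹(𝒳) → L¹_{ρ_X}(𝒳)` the identity. -/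
def normJ {d : ℕ} (𝒳 : Set (Fin d → ℝ)) (ρ : Measure ((Fin d → ℝ) × ℝ)) : ENNReal :=
  idL1Norm (volume.restrict 𝒳) ρ.fst

/-- `‖J̄_ρ‖`, for `J̄_ρ : L¹_{ρ_X}(𝒳) → L¹(𝒳)` the identity. -/
def normJbar {d : ℕ} (𝒳 : Set (Fin d → ℝ)) (ρ : Measure ((Fin d → ℝ) × ℝ)) : ENNReal :=
  idL1Norm ρ.fst (volume.restrict 𝒳)

/-- The conditional mean `f_ρ(x) = ∫ y dρ(y|x)`. -/
def condMean {d : ℕ} (ρ : Measure ((Fin d → ℝ) × ℝ)) [IsFiniteMeasure ρ] (x : Fin d → ℝ) : ℝ :=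
  ∫ y, y ∂(ρ.condKernel x)

/-! ### Adversarial risks -/

/-- The adversarial loss `sup_{x' ∈ B_{δ,∞}(x)} (f(x') - y)²`. -/
def advLoss {d : ℕ} (𝒳 : Set (Fin d → ℝ)) (δ : ℝ) (f : (Fin d → ℝ) → ℝ)
    (z : (Fin d → ℝ) × ℝ) : ENNReal :=
  ⨆ x' ∈ advBall 𝒳 δ z.1, ENNReal.ofReal ((f x' - z.2) ^ 2)

/-- The adversarial generalization error `ℰ^δ(f)`. -/
def advRisk {d : ℕ} (𝒳 : Set (Fin d → ℝ)) (δ : ℝ) (ρ : Measure ((Fin d → ℝ) × ℝ))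
    (f : (Fin d → ℝ) → ℝ) : ENNReal :=
  ∫⁻ z, advLoss 𝒳 δ f z ∂ρ

/-- The optimal adversarial generalization error, over all measurable functions; it equals
`ℰ^δ(f_ρ^δ)` for any minimizer `f_ρ^δ`. -/
def optAdvRisk {d : ℕ} (𝒳 : Set (Fin d → ℝ)) (δ : ℝ) (ρ : Measure ((Fin d → ℝ) × ℝ)) :
    ENNReal :=
  ⨅ (g : (Fin d → ℝ) → ℝ) (_ : Measurable g), advRisk 𝒳 δ ρ g

/-- The excess adversarial generalization error `ℰ^δ(f) - ℰ^δ(f_ρ^δ)`. For measurable `f` it is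
never truncated, and it is `∞` if `ℰ^δ(f) = ∞` while the optimal value is finite. -/
def excessAdvRisk {d : ℕ} (𝒳 : Set (Fin d → ℝ)) (δ : ℝ) (ρ : Measure ((Fin d → ℝ) × ℝ))
    (f : (Fin d → ℝ) → ℝ) : ENNReal :=
  advRisk 𝒳 δ ρ f - optAdvRisk 𝒳 δ ρ

/-- The empirical adversarial generalization error. -/
def empAdvRisk {d n : ℕ} (𝒳 : Set (Fin d → ℝ)) (δ : ℝ) (D : Sample d n)
    (f : (Fin d → ℝ) → ℝ) : ENNReal :=
  (n : ENNReal)⁻¹ * ∑ i, advLoss 𝒳 δ f (D i)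

/-- The law of an i.i.d. sample of size `n` from `ρ`, conditioned on `δ < q_X / 3`. -/
def sampleLaw {d : ℕ} (n : ℕ) (ρ : Measure ((Fin d → ℝ) × ℝ)) [IsProbabilityMeasure ρ]
    (δ : ℝ) : Measure (Sample d n) :=
  ProbabilityTheory.cond (Measure.pi fun _ : Fin n => ρ) {D | δ < sepDist D / 3}

/-! ### Fully connected ReLU networks -/

/-- Dimensions `d_0 = d`, `d_{ℓ+1} = w ℓ` of the layers of an architecture. So `w 0, …, w (L-1)`
are the widths `d_1, …, d_L` of the `L` hidden layers. -/
def layerDim (d : ℕ) (w : ℕ → ℕ) : ℕ → ℕ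
  | 0 => d
  | ℓ + 1 => w ℓ

/-- Parameters of a network of depth `L`: the coefficient vector, the weight matrices
`W_{ℓ+1}` and the bias vectors `b_{ℓ+1}`, `ℓ < L`. -/
structure NetParams (d L : ℕ) (w : ℕ → ℕ) where
  /-- The coefficient vector. -/
  coef : Fin (layerDim d w L) → ℝ
  /-- The weight matrices. -/
  weight : (ℓ : Fin L) → Matrix (Fin (layerDim d w (ℓ + 1))) (Fin (layerDim d w ℓ)) ℝ
  /-- The bias vectors. -/
  bias : (ℓ : Fin L) → Fin (layerDim d w (ℓ + 1)) → ℝ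

namespace NetParams

variable {d L : ℕ} {w : ℕ → ℕ}

/-- The output `σ ∘ A_ℓ ∘ ⋯ ∘ σ ∘ A_1 (x)` of the `ℓ`-th hidden layer, `σ(t) = max(t, 0)`. -/
def hidden (θ : NetParams d L w) (x : Fin d → ℝ) :
    (ℓ : ℕ) → ℓ ≤ L → Fin (layerDim d w ℓ) → ℝ
  | 0, _ => x
  | ℓ + 1, h => fun i =>
      max ((θ.weight ⟨ℓ, h⟩).mulVec (θ.hidden x ℓ (Nat.le_of_succ_le h)) i + θ.bias ⟨ℓ, h⟩ i) 0

/-- The function `x ↦ c · σ ∘ A_L ∘ ⋯ ∘ σ ∘ A_1 (x)` computed by the network. -/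
def toFun (θ : NetParams d L w) (x : Fin d → ℝ) : ℝ :=
  ∑ i, θ.coef i * θ.hidden x L le_rfl i

/-- The number of non-zero parameters. -/
def nnz (θ : NetParams d L w) : ℕ :=
  (Finset.univ.filter fun i => θ.coef i ≠ 0).card +
    ∑ ℓ : Fin L,
      ((Finset.univ.filter fun p : Fin (layerDim d w (ℓ + 1)) × Fin (layerDim d w ℓ) =>
          θ.weight ℓ p.1 p.2 ≠ 0).card +
        (Finset.univ.filter fun i => θ.bias ℓ i ≠ 0).card)

end NetParams

/-- The hypothesis space of all functions computed by networks of depth `L` and widths `w`. -/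
def netClass (d L : ℕ) (w : ℕ → ℕ) : Set ((Fin d → ℝ) → ℝ) :=
  Set.range (NetParams.toFun : NetParams d L w → (Fin d → ℝ) → ℝ)

/-- The global minima of adversarial training over the hypothesis space. -/
def advMinima {d n : ℕ} (𝒳 : Set (Fin d → ℝ)) (δ : ℝ) (D : Sample d n) (L : ℕ) (w : ℕ → ℕ) :
    Set ((Fin d → ℝ) → ℝ) :=
  {f | f ∈ netClass d L w ∧ ∀ g ∈ netClass d L w, empAdvRisk 𝒳 δ D f ≤ empAdvRisk 𝒳 δ D g}

/-- The complexity `δ^{-d/(2α-2)} log(1/δ)`. -/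
def complexity (d α : ℕ) (δ : ℝ) : ℝ :=
  δ ^ (-(d : ℝ) / (2 * (α : ℝ) - 2)) * Real.log (1 / δ)

end AdvTrain

end

/-!
The estimators interpolate the sample on the perturbation balls and are a good approximation of the
regression function elsewhere.

*Construction.* Let `g` be a ReLU network, independent of the sample, with `|g - f_ρ| ≤ 2√δ` on the
cube and with oscillation `O(δ)` over distances `≤ δ` (`exists_approximator`). Let `β` be the sum of
the bumps around the sample points; each bump is computed by a network with two hidden layers, is
`1` on the ball of radius `δ` and `0` outside of the ball of radius `(1 + C₀)δ`. The balls are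
disjoint since `δ < q_X / 3`. With a bound `b ≥ |g|`, the function
`∑ yᵢ βᵢ + σ(g - bβ) - σ(-g - bβ)` is `yᵢ` on the ball of radius `δ` around `xᵢ` and `g` away from
the sample points, so its empirical adversarial risk is `0`. Adding `a(σ(β) - 2σ(β - 1/2))`, which
vanishes where `β ∈ {0, 1}`, changes neither property and gives a different function for each `a`.

*Approximation.* The network `g` is obtained by blending, with a piecewise linear partition of unity
on a grid of mesh `≈ δ^{1/(2α-2)}`, the Taylor polynomials of `f_ρ` of degree `α - 1` at the nodes.
The blend is exactly a polynomial of bounded degree in the coordinates and in finitely many sums of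
hat functions, and these sums are computed exactly by networks of bounded depth and width
`O(δ^{-d/(2α-2)})`; deep networks of constant width then evaluate the polynomial up to an error `δ`
with depth `O(log (1/δ))`, by the sawtooth expansion of the square. Only `√δ`-accuracy is
required: the error enters the risk quadratically. The oscillation bound comes from the remainder estimates of the
Taylor polynomials, since the differences of the hat functions at two points add up to zero.

*Risk.* The adversarial loss at `x` is at least the loss at `x` itself, so the optimal risk is at
least the mean conditional variance of the label (`noise_le_optAdvRisk`). Outside of the balls of
radius `(2 + C₀)δ` around the sample points the estimator agrees with `g` on the whole perturbation
ball, and the loss exceeds that of `g` at `x` by `O(δ)`; the decomposition into variance and squared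
bias then bounds the excess risk by `O(δ)` plus a constant times the `ρ_X`-measure of these balls
(`excessAdvRisk_le`), which is at most `‖J_ρ‖ ((4 + 2C₀)δ)^d n`. This holds for every admissible
sample, hence in the mean. If `n^{-1/(d-1)} ≤ δ`, then the second term dominates.

*Measurability of the risk in the sample.* The points at distance exactly `δ` from a given set are
a Lebesgue null set, by the density theorem. So for almost every `x` the supremum over the closed
perturbation ball is a supremum over countably many points of the open ball (`measurable_advRisk`).
-/

noncomputable section

namespace AdvTrain

/-! ### A calculus of sparse ReLU networks -/

section Calculus

variable {α ι κ τ : Type} [Fintype α] [Fintype ι] [Fintype κ] [Fintype τ]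

/-- The number of non-zero entries of the affine map `x ↦ A x + b`. -/
def affineNnz (A : Matrix κ ι ℝ) (b : κ → ℝ) : ℕ :=
  (Finset.univ.filter fun p : κ × ι => A p.1 p.2 ≠ 0).card +
    (Finset.univ.filter fun i => b i ≠ 0).card

/-- The layer `x ↦ σ(A x + b)`. -/
def reluLayer (A : Matrix κ ι ℝ) (b : κ → ℝ) (x : ι → ℝ) : κ → ℝ :=
  fun i => max (A.mulVec x i + b i) 0

/-- `HasHidden α w L P κ H` says that `H` is the output of the hidden layer number `L` (counted
from `0`) of a ReLU network with inputs indexed by `α`, in which layer `ℓ` has at most `w ℓ`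
neurons and the layers `0, …, L` have at most `P` non-zero parameters. Neurons are indexed by
arbitrary finite types, so that networks can be put in parallel by taking sums of index types. -/
def HasHidden (α : Type) [Fintype α] (w : ℕ → ℕ) :
    ℕ → ℕ → ∀ (κ : Type) [Fintype κ], ((α → ℝ) → κ → ℝ) → Prop
  | 0, P, κ, _, H => ∃ (A : Matrix κ α ℝ) (b : κ → ℝ),
      Fintype.card κ ≤ w 0 ∧ affineNnz A b ≤ P ∧ ∀ x, H x = reluLayer A b x
  | L + 1, P, κ, _, H => ∃ (ι : Type) (_ : Fintype ι) (G : (α → ℝ) → ι → ℝ) (P' : ℕ)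
      (A : Matrix κ ι ℝ) (b : κ → ℝ), HasHidden α w L P' ι G ∧ Fintype.card κ ≤ w (L + 1) ∧
        P' + affineNnz A b ≤ P ∧ ∀ x, H x = reluLayer A b (G x)

/-- `Computes w L P F` says that `F` is a linear combination of the neurons in layer `L` of a
network as in `HasHidden`. The output coefficients are not counted in `P`. -/
def Computes (w : ℕ → ℕ) (L P : ℕ) (F : (α → ℝ) → ℝ) : Prop :=
  ∃ (κ : Type) (_ : Fintype κ) (H : (α → ℝ) → κ → ℝ) (c : κ → ℝ),
    HasHidden α w L P κ H ∧ ∀ x, F x = ∑ i, c i * H x i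

lemma affineNnz_le (A : Matrix κ ι ℝ) (b : κ → ℝ) :
    affineNnz A b ≤ Fintype.card κ * (Fintype.card ι + 1) := by
  have h1 := Finset.card_filter_le (Finset.univ : Finset (κ × ι)) (fun p => A p.1 p.2 ≠ 0)
  have h2 := Finset.card_filter_le (Finset.univ : Finset κ) (fun i => b i ≠ 0)
  simp only [Finset.card_univ, Fintype.card_prod] at h1 h2
  unfold affineNnz
  linarith [mul_add_one (Fintype.card κ) (Fintype.card ι)]

lemma HasHidden.card_le {w : ℕ → ℕ} {L P : ℕ} {H : (α → ℝ) → κ → ℝ}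
    (h : HasHidden α w L P κ H) : Fintype.card κ ≤ w L := by
  cases L with
  | zero => obtain ⟨_, _, h, _⟩ := h; exact h
  | succ L => obtain ⟨_, _, _, _, _, _, _, h, _⟩ := h; exact h

lemma HasHidden.mono {w w' : ℕ → ℕ} {L P P' : ℕ} {H : (α → ℝ) → κ → ℝ}
    (h : HasHidden α w L P κ H) (hw : ∀ ℓ ≤ L, w ℓ ≤ w' ℓ) (hP : P ≤ P') :
    HasHidden α w' L P' κ H := by
  induction L generalizing κ P P' with
  | zero =>
    obtain ⟨A, b, h1, h2, h3⟩ := h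
    exact ⟨A, b, h1.trans (hw 0 le_rfl), h2.trans hP, h3⟩
  | succ L ih =>
    obtain ⟨ι, _, G, Q, A, b, h0, h1, h2, h3⟩ := h
    exact ⟨ι, _, G, Q, A, b, ih h0 (fun ℓ hℓ => hw ℓ (by omega)) le_rfl,
      h1.trans (hw _ le_rfl), h2.trans hP, h3⟩

/-- The number of parameters, zero or not, of the first `L + 1` layers of a network with `a`
inputs. -/
def fullCount (a : ℕ) (w : ℕ → ℕ) : ℕ → ℕ
  | 0 => w 0 * (a + 1)
  | L + 1 => fullCount a w L + w (L + 1) * (w L + 1)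

lemma HasHidden.fullCount {w : ℕ → ℕ} {L P : ℕ} {H : (α → ℝ) → κ → ℝ}
    (h : HasHidden α w L P κ H) : HasHidden α w L (fullCount (Fintype.card α) w L) κ H := by
  induction L generalizing κ P with
  | zero =>
    obtain ⟨A, b, h1, h2, h3⟩ := h
    exact ⟨A, b, h1, (affineNnz_le A b).trans (Nat.mul_le_mul_right _ h1), h3⟩
  | succ L ih =>
    obtain ⟨ι, _, G, Q, A, b, h0, h1, h2, h3⟩ := h
    exact ⟨ι, _, G, _, A, b, ih h0, h1, Nat.add_le_add_left ((affineNnz_le A b).trans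
      (Nat.mul_le_mul h1 (Nat.succ_le_succ h0.card_le))) _, h3⟩

lemma fullCount_const_le (a W L : ℕ) :
    fullCount a (fun _ => W) L ≤ W * (a + W + 1) * (L + 1) := by
  induction L with
  | zero => simp only [fullCount]; nlinarith
  | succ L ih => simp only [fullCount]; nlinarith [Nat.zero_le (W * a)]

lemma continuous_reluLayer {υ : Type} (A : Matrix υ ι ℝ) (b : υ → ℝ) :
    Continuous (reluLayer A b) := by
  unfold reluLayer Matrix.mulVec dotProduct
  fun_prop

lemma HasHidden.continuous {w : ℕ → ℕ} {L P : ℕ} {H : (α → ℝ) → κ → ℝ}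
    (h : HasHidden α w L P κ H) : Continuous H := by
  induction L generalizing κ P with
  | zero =>
    obtain ⟨A, b, -, -, h3⟩ := h
    rw [show H = reluLayer A b from funext h3]
    exact continuous_reluLayer A b
  | succ L ih =>
    obtain ⟨ι, _, G, Q, A, b, h0, -, -, h3⟩ := h
    rw [show H = fun x => reluLayer A b (G x) from funext h3]
    exact (continuous_reluLayer A b).comp (ih h0)

lemma Computes.continuous {w : ℕ → ℕ} {L P : ℕ} {F : (α → ℝ) → ℝ} (h : Computes w L P F) :
    Continuous F := by
  obtain ⟨κ, _, H, c, hH, hF⟩ := h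
  have := hH.continuous
  rw [show F = fun x => ∑ i, c i * H x i from funext hF]
  fun_prop

lemma Computes.mono {w w' : ℕ → ℕ} {L P P' : ℕ} {F : (α → ℝ) → ℝ} (h : Computes w L P F)
    (hw : ∀ ℓ ≤ L, w ℓ ≤ w' ℓ) (hP : P ≤ P') : Computes w' L P' F := by
  obtain ⟨κ, _, H, c, hH, hF⟩ := h
  exact ⟨κ, _, H, c, hH.mono hw hP, hF⟩

lemma Computes.fullCount {w : ℕ → ℕ} {L P : ℕ} {F : (α → ℝ) → ℝ} (h : Computes w L P F) :
    Computes w L (fullCount (Fintype.card α) w L) F := by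
  obtain ⟨κ, _, H, c, hH, hF⟩ := h
  exact ⟨κ, _, H, c, hH.fullCount, hF⟩

/-- Precomposition with an affine map does not change the architecture. -/
lemma HasHidden.precomp {w : ℕ → ℕ} {L P : ℕ} {H : (α → ℝ) → κ → ℝ}
    (h : HasHidden α w L P κ H) (T : Matrix α τ ℝ) (t : α → ℝ) :
    ∃ Q, HasHidden τ w L Q κ (fun x => H (T.mulVec x + t)) := by
  induction L generalizing κ P with
  | zero =>
    obtain ⟨A, b, h1, h2, h3⟩ := h
    refine ⟨_, A * T, A.mulVec t + b, h1, le_rfl, fun x => ?_⟩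
    refine (h3 _).trans ?_
    funext i
    simp only [reluLayer, Matrix.mulVec_add, Pi.add_apply, Matrix.mulVec_mulVec, add_assoc]
  | succ L ih =>
    obtain ⟨ι, _, G, Q, A, b, h0, h1, h2, h3⟩ := h
    obtain ⟨Q', hQ'⟩ := ih h0
    exact ⟨_, ι, _, _, Q', A, b, hQ', h1, le_rfl, fun x => h3 _⟩

lemma Computes.precomp {w : ℕ → ℕ} {L P : ℕ} {F : (α → ℝ) → ℝ}
    (h : Computes w L P F) (T : Matrix α τ ℝ) (t : α → ℝ) :
    Computes w L (AdvTrain.fullCount (Fintype.card τ) w L) (fun x => F (T.mulVec x + t)) := by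
  obtain ⟨κ, _, H, c, hH, hF⟩ := h
  obtain ⟨Q, hQ⟩ := hH.precomp T t
  exact ⟨κ, _, _, c, hQ.fullCount, fun x => hF _⟩

/-! ### Networks in parallel and in sequence -/

lemma affineNnz_blockDiagonal {T : Type} [Fintype T] [DecidableEq T] {κ ι : T → Type}
    [∀ t, Fintype (κ t)] [∀ t, Fintype (ι t)] (A : ∀ t, Matrix (κ t) (ι t) ℝ)
    (b : ∀ t, κ t → ℝ) :
    affineNnz (Matrix.blockDiagonal' A) (fun p : Σ t, κ t => b p.1 p.2) ≤
      ∑ t, affineNnz (A t) (b t) := by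
  classical
  unfold affineNnz
  rw [Finset.sum_add_distrib]
  refine Nat.add_le_add ?_ ?_
  · rw [← Finset.card_sigma]
    refine Finset.card_le_card_of_surjOn
      (fun q : Σ t, κ t × ι t => ((⟨q.1, q.2.1⟩, ⟨q.1, q.2.2⟩) : (Σ t, κ t) × Σ t, ι t)) ?_
    rintro ⟨⟨t, i⟩, ⟨t', j⟩⟩ h
    simp only [Finset.coe_filter, Finset.mem_univ, true_and, Set.mem_ofPred_eq] at h
    have htt : t = t' := by
      by_contra hne
      exact h (Matrix.blockDiagonal'_apply_ne A i j hne)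
    subst htt
    rw [Matrix.blockDiagonal'_apply_eq] at h
    exact ⟨⟨t, i, j⟩, by simpa using h, rfl⟩
  · rw [← Finset.card_sigma]
    refine Finset.card_le_card_of_surjOn id ?_
    rintro ⟨t, i⟩ h
    simpa using h

lemma reluLayer_blockDiagonal {T : Type} [Fintype T] [DecidableEq T] {κ ι : T → Type}
    [∀ t, Fintype (κ t)] [∀ t, Fintype (ι t)] (A : ∀ t, Matrix (κ t) (ι t) ℝ)
    (b : ∀ t, κ t → ℝ) (x : ∀ t, ι t → ℝ) (p : Σ t, κ t) :
    reluLayer (Matrix.blockDiagonal' A) (fun p : Σ t, κ t => b p.1 p.2)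
      (fun q : Σ t, ι t => x q.1 q.2) p = reluLayer (A p.1) (b p.1) (x p.1) p.2 := by
  obtain ⟨t, i⟩ := p
  simp only [reluLayer, Matrix.mulVec, dotProduct, Fintype.sum_sigma]
  rw [Finset.sum_eq_single t]
  · simp only [Matrix.blockDiagonal'_apply_eq]
  · intro t' _ hne
    exact Finset.sum_eq_zero fun j _ => by
      rw [Matrix.blockDiagonal'_apply_ne A i j hne.symm, zero_mul]
  · simp

/-- Networks of the same depth in parallel. -/
lemma HasHidden.sigma {T : Type} [Fintype T] {κ : T → Type} [∀ t, Fintype (κ t)]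
    {w : T → ℕ → ℕ} {L : ℕ} {P : T → ℕ} {H : ∀ t, (α → ℝ) → κ t → ℝ}
    (h : ∀ t, HasHidden α (w t) L (P t) (κ t) (H t)) :
    HasHidden α (fun ℓ => ∑ t, w t ℓ) L (∑ t, P t) (Σ t, κ t) (fun x p => H p.1 x p.2) := by
  classical
  induction L generalizing κ P with
  | zero =>
    choose A b h1 h2 h3 using h
    refine ⟨Matrix.of fun p j => A p.1 p.2 j, fun p => b p.1 p.2, ?_, ?_, fun x => ?_⟩
    · rw [Fintype.card_sigma]
      exact Finset.sum_le_sum fun t _ => h1 t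
    · refine le_trans ?_ (Finset.sum_le_sum fun t _ => h2 t)
      unfold affineNnz
      rw [Finset.sum_add_distrib]
      refine Nat.add_le_add ?_ ?_
      · rw [← Finset.card_sigma]
        refine Finset.card_le_card_of_surjOn
          (fun q : Σ t, κ t × α => ((⟨q.1, q.2.1⟩, q.2.2) : (Σ t, κ t) × α)) ?_
        rintro ⟨⟨t, i⟩, j⟩ hp
        exact ⟨⟨t, i, j⟩, by simpa using (Finset.mem_filter.1 hp).2, rfl⟩
      · rw [← Finset.card_sigma]
        refine Finset.card_le_card_of_surjOn id ?_
        rintro ⟨t, i⟩ hp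
        simpa using hp
    · funext p
      exact congrFun (h3 p.1 x) p.2
  | succ L ih =>
    choose ι hι G Q A b h0 h1 h2 h3 using h
    refine ⟨Σ t, ι t, inferInstance, fun x p => G p.1 x p.2, ∑ t, Q t, Matrix.blockDiagonal' A,
      fun p => b p.1 p.2, ih h0, ?_, ?_, fun x => ?_⟩
    · rw [Fintype.card_sigma]
      exact Finset.sum_le_sum fun t _ => h1 t
    · refine (Nat.add_le_add_left (affineNnz_blockDiagonal A b) _).trans ?_
      rw [← Finset.sum_add_distrib]
      exact Finset.sum_le_sum fun t _ => h2 t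
    · funext p
      rw [reluLayer_blockDiagonal A b (fun t => G t x)]
      exact congrFun (h3 p.1 x) p.2

/-- The widths of a network with layers `0, …, L` of widths `w`, followed by a network of
widths `w'`. -/
def glueWidth (L : ℕ) (w w' : ℕ → ℕ) (ℓ : ℕ) : ℕ :=
  if ℓ ≤ L then w ℓ else w' (ℓ - (L + 1))

/-- Two networks in sequence, with a linear map in between. -/
lemma HasHidden.comp {w w' : ℕ → ℕ} {L L' P P' : ℕ} {H : (α → ℝ) → ι → ℝ}
    {G : (τ → ℝ) → κ → ℝ} (hH : HasHidden α w L P ι H) (C : Matrix τ ι ℝ)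
    (hG : HasHidden τ w' L' P' κ G) :
    HasHidden α (glueWidth L w w') (L + 1 + L') (P + w' 0 * (w L + 1) + P') κ
      (fun x => G (C.mulVec (H x))) := by
  induction L' generalizing κ P' with
  | zero =>
    obtain ⟨A, b, h1, h2, h3⟩ := hG
    refine ⟨ι, _, H, P, A * C, b, hH.mono (fun ℓ hℓ => ?_) le_rfl, ?_, ?_, fun x => ?_⟩
    · simp only [glueWidth]
      rw [if_pos (by omega)]
    · simpa [glueWidth] using h1
    · have := (affineNnz_le (A * C) b).trans
        (Nat.mul_le_mul h1 (Nat.add_le_add_right hH.card_le 1))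
      omega
    · refine (h3 _).trans (funext fun i => ?_)
      change max (A.mulVec (C.mulVec (H x)) i + b i) 0 = max ((A * C).mulVec (H x) i + b i) 0
      rw [Matrix.mulVec_mulVec]
  | succ L' ih =>
    obtain ⟨υ, _, G', Q, A, b, h0, h1, h2, h3⟩ := hG
    refine ⟨υ, _, _, _, A, b, ih h0, ?_, ?_, fun x => h3 _⟩
    · simp only [glueWidth]
      rw [if_neg (by simp only [Nat.add_eq]; omega)]
      convert h1 using 2
      simp only [Nat.add_eq]
      omega
    · omega

/-- Linear combinations. -/
lemma Computes.sum {w : τ → ℕ → ℕ} {L : ℕ} {P : τ → ℕ} {F : τ → (α → ℝ) → ℝ}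
    (h : ∀ t, Computes (w t) L (P t) (F t)) (a : τ → ℝ) :
    Computes (fun ℓ => ∑ t, w t ℓ) L (∑ t, P t) (fun x => ∑ t, a t * F t x) := by
  choose κ hκ H c hH hF using h
  refine ⟨_, _, _, fun p => a p.1 * c p.1 p.2, HasHidden.sigma hH, fun x => ?_⟩
  rw [Fintype.sum_sigma]
  refine Finset.sum_congr rfl fun t _ => ?_
  rw [hF, Finset.mul_sum]
  exact Finset.sum_congr rfl fun i _ => by ring

/-- Composition of networks. -/
lemma Computes.comp {w : τ → ℕ → ℕ} {w' : ℕ → ℕ} {L L' P' : ℕ} {P : τ → ℕ}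
    {F : τ → (α → ℝ) → ℝ} {G : (τ → ℝ) → ℝ} (hF : ∀ t, Computes (w t) L (P t) (F t))
    (hG : Computes w' L' P' G) :
    Computes (glueWidth L (fun ℓ => ∑ t, w t ℓ) w') (L + 1 + L')
      (∑ t, P t + w' 0 * (∑ t, w t L + 1) + P') (fun x => G fun t => F t x) := by
  classical
  choose κ hκ H c hH hF using hF
  obtain ⟨υ, _, K, e, hK, hG⟩ := hG
  refine ⟨_, _, _, e, (HasHidden.sigma hH).comp
    (Matrix.of fun t p => if p.1 = t then c p.1 p.2 else 0) hK, fun x => ?_⟩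
  refine (hG _).trans ?_
  have : (fun t => F t x) = Matrix.mulVec
      (Matrix.of fun t (p : Σ t, κ t) => if p.1 = t then c p.1 p.2 else 0)
      (fun p => H p.1 x p.2) := by
    funext t
    simp only [Matrix.mulVec, dotProduct, Fintype.sum_sigma, hF, Matrix.of_apply]
    rw [Finset.sum_eq_single t]
    · simp
    · intro t' _ hne
      simp [hne]
    · simp
  rw [this]

/-- A single layer. -/
lemma Computes.layer (A : Matrix κ α ℝ) (b c : κ → ℝ) :
    Computes (fun _ => Fintype.card κ) 0 (Fintype.card κ * (Fintype.card α + 1))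
      (fun x => ∑ i, c i * reluLayer A b x i) :=
  ⟨κ, _, _, c, ⟨A, b, le_rfl, affineNnz_le A b, fun _ => rfl⟩, fun _ => rfl⟩

end Calculus

/-! ### Fully connected networks from sparse ones -/

section Conversion

variable {ι κ ι' κ' : Type}

/-- The matrix `A` as a block of a larger matrix that vanishes outside of this block. -/
def extendMatrix (e' : κ ↪ κ') (e : ι ↪ ι') (A : Matrix κ ι ℝ) : Matrix κ' ι' ℝ :=
  Matrix.of (Function.extend e' (fun i => Function.extend e (A i) 0) 0)

lemma sum_extend_mul [Fintype ι] [Fintype ι'] (e : ι ↪ ι') (g : ι → ℝ) (h : ι' → ℝ) :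
    ∑ j, Function.extend e g 0 j * h j = ∑ j, g j * h (e j) := by
  classical
  rw [← Finset.sum_subset (Finset.subset_univ (Finset.univ.map e)), Finset.sum_map]
  · exact Finset.sum_congr rfl fun j _ => by rw [e.injective.extend_apply]
  · intro j _ hj
    rw [Function.extend_apply' _ _ _ (by simpa using hj)]
    simp

lemma reluLayer_extendMatrix [Fintype ι] [Fintype ι'] (e' : κ ↪ κ') (e : ι ↪ ι')
    (A : Matrix κ ι ℝ) (b : κ → ℝ)
    (x : ι' → ℝ) (i : κ) :
    reluLayer (extendMatrix e' e A) (Function.extend e' b 0) x (e' i) =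
      reluLayer A b (fun j => x (e j)) i := by
  simp only [reluLayer, extendMatrix, Matrix.mulVec, dotProduct, Matrix.of_apply,
    e'.injective.extend_apply, sum_extend_mul]

lemma exists_of_extend_ne_zero (e : ι ↪ ι') {g : ι → ℝ} {j : ι'}
    (h : Function.extend e g 0 j ≠ 0) : ∃ i, e i = j ∧ g i ≠ 0 := by
  by_cases hj : ∃ i, e i = j
  · obtain ⟨i, rfl⟩ := hj
    rw [e.injective.extend_apply] at h
    exact ⟨i, rfl, h⟩
  · rw [Function.extend_apply' _ _ _ hj] at h
    simp at h

lemma affineNnz_extendMatrix [Fintype ι] [Fintype κ] [Fintype ι'] [Fintype κ'] (e' : κ ↪ κ')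
    (e : ι ↪ ι') (A : Matrix κ ι ℝ) (b : κ → ℝ) :
    affineNnz (extendMatrix e' e A) (Function.extend e' b 0) ≤ affineNnz A b := by
  classical
  refine Nat.add_le_add (Finset.card_le_card_of_surjOn (Prod.map e' e) ?_)
    (Finset.card_le_card_of_surjOn e' ?_)
  · rintro ⟨i, j⟩ h
    replace h : Function.extend e' (fun i => Function.extend e (A i) 0) 0 i j ≠ 0 := by
      simpa [extendMatrix] using (Finset.mem_filter.1 h).2
    by_cases hi : ∃ i', e' i' = i
    · obtain ⟨i, rfl⟩ := hi
      rw [e'.injective.extend_apply] at h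
      obtain ⟨j, rfl, hA⟩ := exists_of_extend_ne_zero e h
      exact ⟨(i, j), Finset.mem_filter.2 ⟨Finset.mem_univ _, hA⟩, rfl⟩
    · rw [Function.extend_apply' _ _ _ hi] at h
      simp at h
  · intro j h
    obtain ⟨i, rfl, hb⟩ := exists_of_extend_ne_zero e' (Finset.mem_filter.1 h).2
    exact ⟨i, Finset.mem_filter.2 ⟨Finset.mem_univ _, hb⟩, rfl⟩

variable {d : ℕ} {w : ℕ → ℕ}

/-- Weight matrices for infinitely many layers of the given dimensions. -/
abbrev Weights (d : ℕ) (w : ℕ → ℕ) : Type :=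
  ∀ ℓ, Matrix (Fin (layerDim d w (ℓ + 1))) (Fin (layerDim d w ℓ)) ℝ

/-- Bias vectors for infinitely many layers of the given dimensions. -/
abbrev Biases (d : ℕ) (w : ℕ → ℕ) : Type := ∀ ℓ, Fin (layerDim d w (ℓ + 1)) → ℝ

/-- The output of the first `ℓ` layers for given weights and biases. -/
def layerOutput (W : Weights d w) (b : Biases d w) (x : Fin d → ℝ) :
    ∀ ℓ, Fin (layerDim d w ℓ) → ℝ
  | 0 => x
  | ℓ + 1 => reluLayer (W ℓ) (b ℓ) (layerOutput W b x ℓ)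

lemma layerOutput_congr {W W' : Weights d w} {b b' : Biases d w} {L : ℕ}
    (hW : ∀ ℓ < L, W ℓ = W' ℓ) (hb : ∀ ℓ < L, b ℓ = b' ℓ) (x : Fin d → ℝ) :
    layerOutput W b x L = layerOutput W' b' x L := by
  induction L with
  | zero => rfl
  | succ L ih =>
    simp only [layerOutput]
    rw [ih (fun ℓ h => hW ℓ (by omega)) (fun ℓ h => hb ℓ (by omega)), hW L (by omega),
      hb L (by omega)]

lemma HasHidden.exists_weights [Fintype κ] {L P : ℕ} {H : (Fin d → ℝ) → κ → ℝ}
    (h : HasHidden (Fin d) w L P κ H) :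
    ∃ (W : Weights d w) (b : Biases d w) (e : κ ↪ Fin (layerDim d w (L + 1))),
      (∀ x i, layerOutput W b x (L + 1) (e i) = H x i) ∧
        ∑ ℓ ∈ Finset.range (L + 1), affineNnz (W ℓ) (b ℓ) ≤ P := by
  induction L generalizing κ P with
  | zero =>
    obtain ⟨A, b, h1, h2, h3⟩ := h
    obtain ⟨e⟩ : Nonempty (κ ↪ Fin (layerDim d w 1)) :=
      Function.Embedding.nonempty_of_card_le (by rw [Fintype.card_fin]; exact h1)
    refine ⟨Function.update 0 0 (extendMatrix e (Function.Embedding.refl _) A),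
      Function.update 0 0 (Function.extend e b 0), e, fun x i => ?_, ?_⟩
    · simp only [layerOutput, Function.update_self]
      exact (reluLayer_extendMatrix e (Function.Embedding.refl (Fin d)) A b x i).trans
        (congrFun (h3 x) i).symm
    · simp only [zero_add, Finset.range_one, Finset.sum_singleton, Function.update_self]
      exact (affineNnz_extendMatrix _ _ A b).trans h2
  | succ L ih =>
    obtain ⟨ι, _, G, Q, A, b, h0, h1, h2, h3⟩ := h
    obtain ⟨W₀, b₀, e₀, hG, hQ⟩ := ih h0
    obtain ⟨e⟩ : Nonempty (κ ↪ Fin (layerDim d w (L + 2))) :=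
      Function.Embedding.nonempty_of_card_le (by rw [Fintype.card_fin]; exact h1)
    refine ⟨Function.update W₀ (L + 1) (extendMatrix e e₀ A),
      Function.update b₀ (L + 1) (Function.extend e b 0), e, fun x i => ?_, ?_⟩
    · rw [layerOutput, Function.update_self, Function.update_self, reluLayer_extendMatrix, h3,
        layerOutput_congr (W' := W₀) (b' := b₀)
          (fun ℓ hℓ => Function.update_of_ne (by omega) _ _)
          (fun ℓ hℓ => Function.update_of_ne (by omega) _ _)]
      simp only [hG]
    · rw [Finset.sum_range_succ, Function.update_self, Function.update_self]
      refine le_trans (Nat.add_le_add ?_ (affineNnz_extendMatrix _ _ A b)) h2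
      refine le_trans (Finset.sum_le_sum fun ℓ hℓ => ?_) hQ
      have : ℓ ≠ L + 1 := by simp at hℓ; omega
      rw [Function.update_of_ne this, Function.update_of_ne this]

/-- A function computed by a sparse network is computed by a fully connected network of the same
architecture. -/
lemma Computes.exists_netParams {L P : ℕ} {F : (Fin d → ℝ) → ℝ} (h : Computes w L P F) :
    ∃ θ : NetParams d (L + 1) w, θ.toFun = F ∧ θ.nnz ≤ P + w L := by
  obtain ⟨κ, _, H, c, hH, hF⟩ := h
  obtain ⟨W, b, e, hW, hP⟩ := hH.exists_weights
  let θ : NetParams d (L + 1) w :=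
    ⟨Function.extend e c 0, fun ℓ => W ℓ, fun ℓ => b ℓ⟩
  have hθ : ∀ x ℓ (hℓ : ℓ ≤ L + 1), θ.hidden x ℓ hℓ = layerOutput W b x ℓ := by
    intro x ℓ
    induction ℓ with
    | zero => intro _; rfl
    | succ ℓ ih =>
      intro hℓ
      simp only [NetParams.hidden, ih, layerOutput]
      rfl
  refine ⟨θ, funext fun x => ?_, ?_⟩
  · simp only [NetParams.toFun, hθ]
    rw [hF]
    refine (sum_extend_mul e c _).trans ?_
    simp only [hW]
  · unfold NetParams.nnz
    rw [add_comm]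
    refine Nat.add_le_add ?_ ?_
    · rw [Finset.sum_range] at hP
      exact hP
    · exact (Finset.card_filter_le _ _).trans (Finset.card_fin _).le

end Conversion

section Carry

variable {α : Type} [Fintype α]

/-- The identity, as `t = σ(t) - σ(-t)` in each layer. -/
lemma computes_id (L : ℕ) :
    Computes (fun _ => 2) L (6 * (L + 1)) (fun x : Unit → ℝ => x ()) := by
  have key : ∀ t : ℝ, max t 0 - max (-t) 0 = t := fun t => by
    rcases le_total t 0 with h | h
    · rw [max_eq_right h, max_eq_left (by linarith)]; ring
    · rw [max_eq_left h, max_eq_right (by linarith)]; ring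
  suffices h : HasHidden Unit (fun _ => 2) L (6 * (L + 1)) (Fin 2)
      (fun x => ![max (x ()) 0, max (-x ()) 0]) from
    ⟨_, _, _, ![1, -1], h, fun x => by simp [Fin.sum_univ_two, ← sub_eq_add_neg, key]⟩
  induction L with
  | zero =>
    refine ⟨Matrix.of ![fun _ => 1, fun _ => -1], 0, by simp,
      (affineNnz_le _ _).trans (by simp), fun x => ?_⟩
    funext i
    fin_cases i <;> simp [reluLayer, Matrix.mulVec, dotProduct]
  | succ L ih =>
    refine ⟨Fin 2, inferInstance, _, _, !![1, -1; -1, 1], 0, ih, by simp, ?_, fun x => ?_⟩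
    · have := affineNnz_le (!![1, -1; -1, 1] : Matrix (Fin 2) (Fin 2) ℝ) 0
      simp only [Fintype.card_fin] at this
      omega
    · funext i
      have h := key (x ())
      have h' : -max (x ()) 0 + max (-x ()) 0 = -x () := by linarith
      fin_cases i <;>
        simp [reluLayer, Matrix.mulVec, dotProduct, Fin.sum_univ_two, ← sub_eq_add_neg, h, h']

/-- The widths of a network with layers `0, …, L` of widths `w`, followed by layers of two neurons
that carry one number. -/
def padWidth (L : ℕ) (w : ℕ → ℕ) : ℕ → ℕ := fun ℓ => if ℓ ≤ L then w ℓ else 2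

/-- A scalar output can be carried through further layers. -/
lemma Computes.pad {w : ℕ → ℕ} {L P L' : ℕ} {F : (α → ℝ) → ℝ} (h : Computes w L P F)
    (hL : L ≤ L') : Computes (padWidth L w) L' (P + 2 * (w L + 1) + 6 * L') F := by
  rcases hL.eq_or_lt with rfl | hlt
  · exact h.mono (fun ℓ hℓ => by simp [padWidth, hℓ]) (by omega)
  · obtain ⟨k, rfl⟩ : ∃ k, L' = L + 1 + k := ⟨L' - (L + 1), by omega⟩
    refine (Computes.comp (τ := Unit) (fun _ => h) (computes_id k)).mono (fun ℓ _ => ?_) ?_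
    · simp [glueWidth, padWidth]
    · simp only [Finset.univ_unique, Finset.sum_singleton]
      omega

end Carry

/-! ### Deep narrow networks approximate polynomials -/

section Deep

variable {τ T : Type} [Fintype τ] [Fintype T]

/-- On the set `Y`, the bounded function `f` is approximated up to `O(2⁻ᵐ)` by networks of bounded
width and depth `O(m)`. -/
def DeepApprox (Y : Set (τ → ℝ)) (f : (τ → ℝ) → ℝ) : Prop :=
  ∃ (W K : ℕ) (C : ℝ), 0 ≤ C ∧ (∀ y ∈ Y, |f y| ≤ C) ∧ ∀ m : ℕ, ∃ L ≤ K * (m + 1),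
    ∃ (g : (τ → ℝ) → ℝ) (P : ℕ), Computes (fun _ => W) L P g ∧ ∀ y ∈ Y, |g y - f y| ≤ C / 2 ^ m

lemma DeepApprox.congr {Y : Set (τ → ℝ)} {f f' : (τ → ℝ) → ℝ} (h : DeepApprox Y f)
    (hf : ∀ y ∈ Y, f y = f' y) : DeepApprox Y f' := by
  obtain ⟨W, K, C, hC, hb, h⟩ := h
  refine ⟨W, K, C, hC, fun y hy => hf y hy ▸ hb y hy, fun m => ?_⟩
  obtain ⟨L, hL, g, P, hg, happ⟩ := h m
  exact ⟨L, hL, g, P, hg, fun y hy => hf y hy ▸ happ y hy⟩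

lemma deepApprox_const (Y : Set (τ → ℝ)) (a : ℝ) : DeepApprox Y (fun _ => a) := by
  refine ⟨1, 0, |a|, abs_nonneg a, fun y _ => le_rfl, fun m => ⟨0, Nat.zero_le _, fun _ => a, _,
    (by simpa [reluLayer] using Computes.layer (0 : Matrix Unit τ ℝ) (fun _ => 1) (fun _ => a)),
    fun y _ => ?_⟩⟩
  simp only [sub_self, abs_zero]
  positivity

lemma deepApprox_coord {Y : Set (τ → ℝ)} (i : τ) {R : ℝ} (hY : ∀ y ∈ Y, |y i| ≤ R) :
    DeepApprox Y (fun y => y i) := by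
  classical
  have h := (computes_id 0).precomp
    (Matrix.of fun _ : Unit => Pi.single (M := fun _ : τ => ℝ) i 1) 0
  refine ⟨2, 0, |R|, abs_nonneg R, fun y hy => (hY y hy).trans (le_abs_self R),
    fun m => ⟨0, Nat.zero_le _, fun y => y i, _, by simpa [Matrix.mulVec] using h, fun y _ => ?_⟩⟩
  simp only [sub_self, abs_zero]
  positivity

lemma DeepApprox.sum {Y : Set (τ → ℝ)} {f : T → (τ → ℝ) → ℝ} (h : ∀ t, DeepApprox Y (f t))
    (a : T → ℝ) : DeepApprox Y (fun y => ∑ t, a t * f t y) := by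
  choose W K C hC hb h using h
  refine ⟨∑ t, (W t + 2), ∑ t, K t, ∑ t, |a t| * C t,
    Finset.sum_nonneg fun t _ => mul_nonneg (abs_nonneg _) (hC t), fun y hy => ?_, fun m => ?_⟩
  · refine (Finset.abs_sum_le_sum_abs _ _).trans (Finset.sum_le_sum fun t _ => ?_)
    rw [abs_mul]
    exact mul_le_mul_of_nonneg_left (hb t y hy) (abs_nonneg _)
  · choose L hL g P hg happ using fun t => h t m
    have hL' : ∀ t, L t ≤ (∑ t, K t) * (m + 1) := fun t => (hL t).trans
      (Nat.mul_le_mul_right _ (Finset.single_le_sum (fun t _ => Nat.zero_le (K t))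
        (Finset.mem_univ t)))
    refine ⟨_, le_rfl, _, _, (Computes.sum (fun t => (hg t).pad (hL' t)) a).mono
      (fun ℓ _ => Finset.sum_le_sum fun t _ => ?_) le_rfl, fun y hy => ?_⟩
    · simp only [padWidth]
      split_ifs <;> omega
    · rw [← Finset.sum_sub_distrib, Finset.sum_div]
      refine (Finset.abs_sum_le_sum_abs _ _).trans (Finset.sum_le_sum fun t _ => ?_)
      rw [← mul_sub, abs_mul, mul_div_assoc]
      exact mul_le_mul_of_nonneg_left (happ t y hy) (abs_nonneg _)

/-- The layers of a network computing squares on `[0,1]`. Let `T` be the tent map. Then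
`t - t² = (T t + (T t - (T t)²)) / 4`, so that `t² = t - T t / 4 - T² t / 4² - ⋯`. The first two
neurons of layer `ℓ` determine `T^{ℓ+1} t`, the third one is the partial sum. -/
def squareLayers : ℕ → ℝ → Fin 3 → ℝ
  | 0, t => ![max t 0, max (t - 1 / 2) 0, max t 0]
  | ℓ + 1, t =>
      let s := squareLayers ℓ t
      ![max (2 * s 0 - 4 * s 1) 0, max (2 * s 0 - 4 * s 1 - 1 / 2) 0,
        max (s 2 - (2 * s 0 - 4 * s 1) / 4 ^ (ℓ + 1)) 0]

lemma hasHidden_squareLayers (ℓ : ℕ) :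
    ∃ P, HasHidden Unit (fun _ => 3) ℓ P (Fin 3) (fun x => squareLayers ℓ (x ())) := by
  induction ℓ with
  | zero =>
    refine ⟨_, Matrix.of fun _ _ => 1, ![0, -1 / 2, 0], by simp, le_rfl, fun x => ?_⟩
    funext i
    fin_cases i <;> simp [reluLayer, Matrix.mulVec, dotProduct, squareLayers]
    ring_nf
  | succ ℓ ih =>
    obtain ⟨P, hP⟩ := ih
    refine ⟨_, Fin 3, inferInstance, _, P,
      !![2, -4, 0; 2, -4, 0; -(2 / 4 ^ (ℓ + 1)), 4 / 4 ^ (ℓ + 1), 1], ![0, -1 / 2, 0], hP, by simp,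
      le_rfl, fun x => ?_⟩
    funext i
    fin_cases i <;>
      simp [reluLayer, Matrix.mulVec, dotProduct, squareLayers, Fin.sum_univ_three] <;> ring_nf

lemma squareLayers_spec {t : ℝ} (ht : t ∈ Set.Icc (0 : ℝ) 1) (ℓ : ℕ) :
    ∃ u ∈ Set.Icc (0 : ℝ) 1, squareLayers ℓ t 0 = u ∧ squareLayers ℓ t 1 = max (u - 1 / 2) 0 ∧
      squareLayers ℓ t 2 = t ^ 2 + (u - u ^ 2) / 4 ^ ℓ := by
  induction ℓ with
  | zero =>
    refine ⟨t, ht, ?_, ?_, ?_⟩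
    · simp [squareLayers, ht.1]
    · simp [squareLayers]
    · simp [squareLayers, ht.1]
  | succ ℓ ih =>
    obtain ⟨u, hu, h0, h1, h2⟩ := ih
    have hv : 2 * u - 4 * max (u - 1 / 2) 0 ∈ Set.Icc (0 : ℝ) 1 ∧
        4 * (u - u ^ 2) = (2 * u - 4 * max (u - 1 / 2) 0) + ((2 * u - 4 * max (u - 1 / 2) 0) -
          (2 * u - 4 * max (u - 1 / 2) 0) ^ 2) := by
      obtain ⟨hu0, hu1⟩ := hu
      rcases le_total u (1 / 2) with h | h
      · rw [max_eq_right (by linarith)]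
        exact ⟨⟨by linarith, by linarith⟩, by ring⟩
      · rw [max_eq_left (by linarith)]
        exact ⟨⟨by linarith, by linarith⟩, by ring⟩
    set v := 2 * u - 4 * max (u - 1 / 2) 0
    have h3 : squareLayers ℓ t 2 - v / 4 ^ (ℓ + 1) = t ^ 2 + (v - v ^ 2) / 4 ^ (ℓ + 1) := by
      rw [h2, show u - u ^ 2 = (v + (v - v ^ 2)) / 4 by linarith [hv.2]]
      field_simp
      ring
    refine ⟨v, hv.1, ?_, ?_, ?_⟩
    · change max (2 * squareLayers ℓ t 0 - 4 * squareLayers ℓ t 1) 0 = v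
      rw [h0, h1]
      exact max_eq_left hv.1.1
    · change max (2 * squareLayers ℓ t 0 - 4 * squareLayers ℓ t 1 - 1 / 2) 0 = _
      rw [h0, h1]
    · change max (squareLayers ℓ t 2 - (2 * squareLayers ℓ t 0 - 4 * squareLayers ℓ t 1) /
        4 ^ (ℓ + 1)) 0 = _
      rw [h0, h1, h3]
      refine max_eq_left (add_nonneg (sq_nonneg t) (div_nonneg ?_ (by positivity)))
      nlinarith [hv.1.1, hv.1.2]

lemma abs_squareLayers_sub_le {t : ℝ} (ht : t ∈ Set.Icc (0 : ℝ) 1) (m : ℕ) :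
    |squareLayers m t 2 - t ^ 2| ≤ 1 / 2 ^ m := by
  obtain ⟨u, hu, -, -, h⟩ := squareLayers_spec ht m
  have h0 : 0 ≤ u - u ^ 2 := by nlinarith [hu.1, hu.2]
  have h1 : u - u ^ 2 ≤ 1 := by nlinarith [hu.1, hu.2]
  rw [h, add_sub_cancel_left, abs_of_nonneg (by positivity)]
  refine div_le_div₀ zero_le_one h1 (by positivity) ?_
  exact pow_le_pow_left₀ (by norm_num) (by norm_num) m

lemma deepApprox_sq (R : ℝ) :
    DeepApprox {y : Unit → ℝ | |y ()| ≤ R} (fun y => y () ^ 2) := by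
  rcases le_or_gt R 0 with hR | hR
  · refine (deepApprox_const _ 0).congr fun y hy => ?_
    have : |y ()| ≤ R := hy
    have : y () = 0 := abs_eq_zero.1 (le_antisymm (this.trans hR) (abs_nonneg _))
    simp [this]
  have key : DeepApprox {y : Unit → ℝ | |y ()| ≤ R} (fun y => ((y () + R) / (2 * R)) ^ 2) := by
    have hmem : ∀ y : Unit → ℝ, |y ()| ≤ R → (y () + R) / (2 * R) ∈ Set.Icc (0 : ℝ) 1 := by
      intro y hy
      obtain ⟨h1, h2⟩ := abs_le.1 hy
      exact ⟨div_nonneg (by linarith) (by linarith), (div_le_one (by linarith)).2 (by linarith)⟩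
    refine ⟨3, 1, 1, zero_le_one, fun y hy => ?_, fun m => ⟨m, by omega, ?_⟩⟩
    · obtain ⟨h1, h2⟩ := hmem y hy
      rw [abs_of_nonneg (by positivity)]
      exact pow_le_one₀ h1 h2
    · obtain ⟨P, hP⟩ := hasHidden_squareLayers m
      have h : Computes (fun _ => 3) m P (fun x : Unit → ℝ => squareLayers m (x ()) 2) :=
        ⟨_, _, _, ![0, 0, 1], hP, fun x => by simp [Fin.sum_univ_three]⟩
      refine ⟨_, _, h.precomp (Matrix.of fun _ _ : Unit => 1 / (2 * R)) (fun _ => 1 / 2),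
        fun y hy => ?_⟩
      have := abs_squareLayers_sub_le (hmem y hy) m
      have he : (Matrix.of fun _ _ : Unit => 1 / (2 * R)).mulVec y () + 1 / 2 =
          (y () + R) / (2 * R) := by
        simp [Matrix.mulVec, dotProduct]
        field_simp
      rwa [Pi.add_apply, he]
  refine (DeepApprox.sum (T := Fin 3) (f := ![fun y => ((y () + R) / (2 * R)) ^ 2, fun y => y (),
    fun _ => 1]) (fun t => ?_) ![4 * R ^ 2, -(2 * R), -R ^ 2]).congr fun y _ => ?_
  · fin_cases t
    · exact key
    · exact deepApprox_coord () (R := R) fun y hy => hy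
    · exact deepApprox_const _ 1
  · simp [Fin.sum_univ_three]
    field_simp
    ring

/-- The network for `f` is followed by a network that squares on an interval twice as long as the
range of `f`, since the approximations of `f` may leave that range. -/
lemma DeepApprox.sq {Y : Set (τ → ℝ)} {f : (τ → ℝ) → ℝ} (h : DeepApprox Y f) :
    DeepApprox Y (fun y => f y ^ 2) := by
  obtain ⟨W, K, C, hC, hb, h⟩ := h
  obtain ⟨W', K', C', hC', -, h'⟩ := deepApprox_sq (2 * C)
  refine ⟨W + W', K + 1 + K', C' + 3 * C ^ 2, by positivity, fun y hy => ?_, fun m => ?_⟩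
  · have := hb y hy
    rw [abs_pow]
    nlinarith [pow_le_pow_left₀ (abs_nonneg _) this 2]
  obtain ⟨L, hL, g, P, hg, happ⟩ := h m
  obtain ⟨L', hL', g', P', hg', happ'⟩ := h' m
  refine ⟨L + 1 + L', ?_, _, _, (Computes.comp (τ := Unit) (fun _ => hg) hg').mono
    (w' := fun _ => W + W') (fun ℓ _ => ?_) le_rfl, fun y hy => ?_⟩
  · nlinarith
  · simp only [glueWidth, Finset.univ_unique, Finset.sum_singleton]
    split_ifs <;> omega
  · have h2 : (1 : ℝ) ≤ 2 ^ m := one_le_pow₀ (by norm_num)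
    have h1 := happ y hy
    have h3 : |g y - f y| ≤ C := h1.trans (div_le_self hC h2)
    have h4 := hb y hy
    have h5 : |g y + f y| ≤ 3 * C := by
      have := abs_add_le (g y - f y) (2 * f y)
      rw [show g y - f y + 2 * f y = g y + f y by ring, abs_mul, abs_two] at this
      linarith
    have h6 : |g y| ≤ 2 * C := by
      have := abs_add_le (g y - f y) (f y)
      rw [sub_add_cancel] at this
      linarith
    have h7 := happ' (fun _ => g y) h6
    have h8 : |g y ^ 2 - f y ^ 2| ≤ 3 * C ^ 2 / 2 ^ m := by
      rw [sq_sub_sq, abs_mul]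
      calc |g y + f y| * |g y - f y| ≤ (3 * C) * (C / 2 ^ m) :=
            mul_le_mul h5 h1 (abs_nonneg _) (by positivity)
        _ = 3 * C ^ 2 / 2 ^ m := by ring
    rw [add_div]
    exact (abs_sub_le _ (g y ^ 2) _).trans (add_le_add h7 h8)

lemma DeepApprox.add {Y : Set (τ → ℝ)} {f g : (τ → ℝ) → ℝ} (hf : DeepApprox Y f)
    (hg : DeepApprox Y g) : DeepApprox Y (fun y => f y + g y) := by
  refine (DeepApprox.sum (T := Fin 2) (f := ![f, g]) (fun t => ?_) ![1, 1]).congr fun y _ => ?_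
  · fin_cases t
    · exact hf
    · exact hg
  · simp [Fin.sum_univ_two]

/-- By polarization, `f g = ((f + g)² - f² - g²) / 2`. -/
lemma DeepApprox.mul {Y : Set (τ → ℝ)} {f g : (τ → ℝ) → ℝ} (hf : DeepApprox Y f)
    (hg : DeepApprox Y g) : DeepApprox Y (fun y => f y * g y) := by
  refine (DeepApprox.sum (T := Fin 3)
    (f := ![fun y => (f y + g y) ^ 2, fun y => f y ^ 2, fun y => g y ^ 2]) (fun t => ?_)
    ![1 / 2, -1 / 2, -1 / 2]).congr fun y _ => ?_
  · fin_cases t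
    · exact (hf.add hg).sq
    · exact hf.sq
    · exact hg.sq
  · simp [Fin.sum_univ_three]
    ring

lemma DeepApprox.pow {Y : Set (τ → ℝ)} {f : (τ → ℝ) → ℝ} (hf : DeepApprox Y f) (k : ℕ) :
    DeepApprox Y (fun y => f y ^ k) := by
  induction k with
  | zero => simpa using deepApprox_const Y 1
  | succ k ih => simpa [pow_succ] using ih.mul hf

lemma DeepApprox.prod {Y : Set (τ → ℝ)} {f : T → (τ → ℝ) → ℝ} (h : ∀ t, DeepApprox Y (f t)) :
    DeepApprox Y (fun y => ∏ t, f t y) := by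
  classical
  suffices H : ∀ s : Finset T, DeepApprox Y (fun y => ∏ t ∈ s, f t y) from H Finset.univ
  intro s
  induction s using Finset.induction_on with
  | empty => simpa using deepApprox_const Y 1
  | insert t s ht ih => simpa [Finset.prod_insert ht] using (h t).mul ih

end Deep

/-! ### A piecewise linear partition of unity -/

section Hats

variable {ι : Type} [Fintype ι]

/-- The largest of `0` and the `v i`. -/
def maxZero (v : ι → ℝ) : ℝ :=
  Finset.univ.sup' Finset.univ_nonempty fun o : Option ι => o.elim 0 v

/-- The smallest of `0` and the `v i`. -/
def minZero (v : ι → ℝ) : ℝ :=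
  Finset.univ.inf' Finset.univ_nonempty fun o : Option ι => o.elim 0 v

/-- The nodal function of the Kuhn triangulation of `ℝ^ι` at the origin. It is also the length of
the set of all `s ∈ [0,1)` with `⌈v i - s⌉ = 0` for all `i`. -/
def kuhnHat (v : ι → ℝ) : ℝ := max (minZero v + 1 - maxZero v) 0

lemma le_maxZero (v : ι → ℝ) (i : ι) : v i ≤ maxZero v :=
  Finset.le_sup' (fun o : Option ι => o.elim 0 v) (Finset.mem_univ (some i))

lemma maxZero_nonneg (v : ι → ℝ) : 0 ≤ maxZero v :=
  Finset.le_sup' (fun o : Option ι => o.elim 0 v) (Finset.mem_univ none)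

lemma minZero_le (v : ι → ℝ) (i : ι) : minZero v ≤ v i :=
  Finset.inf'_le (fun o : Option ι => o.elim 0 v) (Finset.mem_univ (some i))

lemma minZero_nonpos (v : ι → ℝ) : minZero v ≤ 0 :=
  Finset.inf'_le (fun o : Option ι => o.elim 0 v) (Finset.mem_univ none)

lemma maxZero_le_iff (v : ι → ℝ) (s : ℝ) : maxZero v ≤ s ↔ 0 ≤ s ∧ ∀ i, v i ≤ s := by
  simp [maxZero, Finset.sup'_le_iff, Option.forall]

lemma lt_minZero_iff (v : ι → ℝ) (s : ℝ) : s < minZero v ↔ s < 0 ∧ ∀ i, s < v i := by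
  simp [minZero, Finset.lt_inf'_iff, Option.forall]

lemma le_minZero_iff (v : ι → ℝ) (s : ℝ) : s ≤ minZero v ↔ s ≤ 0 ∧ ∀ i, s ≤ v i := by
  simp [minZero, Finset.le_inf'_iff, Option.forall]

lemma kuhnHat_nonneg (v : ι → ℝ) : 0 ≤ kuhnHat v := le_max_right _ _

lemma abs_lt_one_of_kuhnHat_ne_zero {v : ι → ℝ} (h : kuhnHat v ≠ 0) (i : ι) : |v i| < 1 := by
  have h' : 0 < minZero v + 1 - maxZero v := by
    by_contra hn
    exact h (max_eq_right (not_lt.1 hn))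
  have := minZero_le v i
  have := le_maxZero v i
  have := minZero_nonpos v
  have := maxZero_nonneg v
  rw [abs_lt]
  constructor <;> linarith

lemma abs_kuhnHat_sub_le {v v' : ι → ℝ} {r : ℝ} (hr : 0 ≤ r) (h : ∀ i, |v i - v' i| ≤ r) :
    |kuhnHat v - kuhnHat v'| ≤ 2 * r := by
  have key : ∀ v v' : ι → ℝ, (∀ i, |v i - v' i| ≤ r) →
      maxZero v ≤ maxZero v' + r ∧ minZero v' - r ≤ minZero v := by
    intro v v' h
    rw [maxZero_le_iff, le_minZero_iff]
    refine ⟨⟨by linarith [maxZero_nonneg v'], fun i => ?_⟩,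
      ⟨by linarith [minZero_nonpos v'], fun i => ?_⟩⟩
    · linarith [le_maxZero v' i, (abs_le.1 (h i)).2]
    · linarith [minZero_le v' i, (abs_le.1 (h i)).1]
  obtain ⟨h1, h2⟩ := key v v' h
  obtain ⟨h3, h4⟩ := key v' v fun i => by rw [abs_sub_comm]; exact h i
  refine (abs_max_sub_max_le_abs _ _ _).trans ?_
  rw [abs_le]
  constructor <;> linarith

/-- The node `m`, as a point of `ℝ^ι`. -/
def gridPoint {N : ℕ} (m : ι → Fin (N + 1)) : ι → ℝ := fun i => ((m i : ℕ) : ℝ)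

/-- The interval whose length is the value at `u` of the hat function of the node `m`, as a fiber of
the map `s ↦ (⌈u i - s⌉)ᵢ` on `[0, 1)`. -/
lemma mem_Ico_iff_ceil {N : ℕ} (u : ι → ℝ) (m : ι → Fin (N + 1)) (s : ℝ) :
    s ∈ Set.Ico (maxZero (u - gridPoint m)) (minZero (u - gridPoint m) + 1) ↔
      s ∈ Set.Ico (0 : ℝ) 1 ∧ ∀ i, ⌈u i - s⌉ = ((m i : ℕ) : ℤ) := by
  have h1 : ∀ i, ⌈u i - s⌉ = ((m i : ℕ) : ℤ) ↔
      (u - gridPoint m) i ≤ s ∧ s - 1 < (u - gridPoint m) i := by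
    intro i
    rw [Int.ceil_eq_iff]
    simp only [Pi.sub_apply, gridPoint, Int.cast_natCast]
    constructor <;> rintro ⟨h1, h2⟩ <;> constructor <;> linarith
  rw [Set.mem_Ico, Set.mem_Ico, ← sub_lt_iff_lt_add, maxZero_le_iff, lt_minZero_iff]
  simp only [h1, forall_and, sub_neg]
  tauto

/-- The hat functions of the nodes of a grid form a partition of unity: their values are the lengths
of the intervals of a partition of `[0, 1)`. -/
lemma sum_kuhnHat [DecidableEq ι] {N : ℕ} {u : ι → ℝ} (h0 : ∀ i, 0 ≤ u i) (hN : ∀ i, u i ≤ N) :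
    ∑ m : ι → Fin (N + 1), kuhnHat (u - gridPoint m) = 1 := by
  classical
  set I : (ι → Fin (N + 1)) → Set ℝ := fun m =>
    Set.Ico (maxZero (u - gridPoint m)) (minZero (u - gridPoint m) + 1) with hI
  have hdisj : Set.PairwiseDisjoint (↑(Finset.univ : Finset (ι → Fin (N + 1)))) I := by
    intro m _ m' _ hne
    refine Set.disjoint_left.2 fun s hs hs' => hne (funext fun i => Fin.ext ?_)
    have := (((mem_Ico_iff_ceil u m s).1 hs).2 i).symm.trans
      (((mem_Ico_iff_ceil u m' s).1 hs').2 i)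
    exact_mod_cast this
  have hunion : ⋃ m ∈ (Finset.univ : Finset (ι → Fin (N + 1))), I m = Set.Ico 0 1 := by
    ext s
    simp only [Finset.mem_univ, Set.iUnion_true, Set.mem_iUnion, hI, mem_Ico_iff_ceil]
    refine ⟨fun ⟨m, h, _⟩ => h, fun hs => ?_⟩
    have hlow : ∀ i, 0 ≤ ⌈u i - s⌉ := fun i =>
      Int.ceil_nonneg_of_neg_one_lt (by linarith [h0 i, hs.2])
    have hup : ∀ i, ⌈u i - s⌉ ≤ N := fun i => Int.ceil_le.2 (by
      have := hN i; push_cast; linarith [hs.1])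
    exact ⟨fun i => ⟨⌈u i - s⌉.toNat, by have := hlow i; have := hup i; omega⟩, hs,
      fun i => (Int.toNat_of_nonneg (hlow i)).symm⟩
  have hmeas := measureReal_biUnion_finset (μ := volume) hdisj
    (fun m _ => measurableSet_Ico) (fun m _ => by simp [hI])
  rw [hunion] at hmeas
  simp only [hI, Real.volume_real_Ico] at hmeas
  simp only [kuhnHat]
  rw [← hmeas]
  norm_num

/-- At each point, at most `2 ^ d` hat functions do not vanish. -/
lemma card_near_le [DecidableEq ι] (N : ℕ) (u : ι → ℝ) :
    (Finset.univ.filter fun m : ι → Fin (N + 1) =>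
      kuhnHat (u - gridPoint m) ≠ 0).card ≤ 2 ^ Fintype.card ι := by
  classical
  have h1 : ∀ t : ℝ,
      (Finset.univ.filter fun j : Fin (N + 1) => |t - ((j : ℕ) : ℝ)| < 1).card ≤ 2 := by
    intro t
    have h2 : (Finset.Icc ⌊t⌋ (⌊t⌋ + 1)).card = 2 := by
      rw [Int.card_Icc]; omega
    rw [← h2]
    refine Finset.card_le_card_of_injOn (fun j => ((j : ℕ) : ℤ)) (fun j hj => ?_)
      (fun j _ j' _ h => Fin.ext (Int.ofNat.inj h))
    obtain ⟨h3, h4⟩ := abs_lt.1 (Finset.mem_filter.1 hj).2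
    have h5 : ⌊t⌋ ≤ (j : ℕ) := Int.lt_add_one_iff.1 (Int.floor_lt.2 (by push_cast; linarith))
    have h6 : ((j : ℕ) : ℤ) - 1 ≤ ⌊t⌋ := Int.le_floor.2 (by push_cast; linarith)
    simp only [Finset.coe_Icc, Set.mem_Icc]
    exact ⟨h5, by linarith⟩
  calc _ ≤ (Fintype.piFinset fun i : ι => Finset.univ.filter
        fun j : Fin (N + 1) => |u i - ((j : ℕ) : ℝ)| < 1).card := by
        refine Finset.card_le_card fun m hm => Fintype.mem_piFinset.2 fun i => ?_
        exact Finset.mem_filter.2 ⟨Finset.mem_univ _,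
          abs_lt_one_of_kuhnHat_ne_zero (Finset.mem_filter.1 hm).2 i⟩
    _ ≤ ∏ _i : ι, 2 := by
        rw [Fintype.card_piFinset]
        exact Finset.prod_le_prod' fun i _ => h1 (u i)
    _ = _ := by simp

lemma sum_abs_kuhnHat_sub_le [DecidableEq ι] (N : ℕ) {u u' : ι → ℝ} {r : ℝ} (hr : 0 ≤ r)
    (h : ∀ i, |u i - u' i| ≤ r) :
    ∑ m : ι → Fin (N + 1), |kuhnHat (u - gridPoint m) - kuhnHat (u' - gridPoint m)| ≤
      2 ^ Fintype.card ι * (4 * r) := by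
  classical
  set S : (ι → ℝ) → Finset (ι → Fin (N + 1)) := fun u =>
    Finset.univ.filter fun m => kuhnHat (u - gridPoint m) ≠ 0
  rw [← Finset.sum_subset (Finset.subset_univ (S u ∪ S u'))]
  · calc _ ≤ ∑ m ∈ S u ∪ S u', 2 * r := Finset.sum_le_sum fun m _ =>
          abs_kuhnHat_sub_le hr fun i => by simpa using h i
      _ = (S u ∪ S u').card * (2 * r) := by rw [Finset.sum_const, nsmul_eq_mul]
      _ ≤ (2 ^ Fintype.card ι + 2 ^ Fintype.card ι : ℕ) * (2 * r) := by
          refine mul_le_mul_of_nonneg_right ?_ (by linarith)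
          exact_mod_cast (Finset.card_union_le _ _).trans
            (Nat.add_le_add (card_near_le N u) (card_near_le N u'))
      _ = _ := by push_cast; ring
  · intro m _ hm
    simp only [S, Finset.mem_union, Finset.mem_filter, Finset.mem_univ, true_and, not_or,
      not_not] at hm
    rw [hm.1, hm.2]
    simp

/-! ### Hat functions as networks -/

/-- `F` is computed by some ReLU network. -/
def IsNet (F : (ι → ℝ) → ℝ) : Prop := ∃ w L P, Computes w L P F

lemma IsNet.sum {T : Type} [Fintype T] {F : T → (ι → ℝ) → ℝ} (h : ∀ t, IsNet (F t))
    (a : T → ℝ) : IsNet (fun x => ∑ t, a t * F t x) := by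
  choose w L P h using h
  exact ⟨_, _, _, Computes.sum (fun t => (h t).pad
    (Finset.single_le_sum (fun t _ => Nat.zero_le (L t)) (Finset.mem_univ t))) a⟩

lemma IsNet.sub {F G : (ι → ℝ) → ℝ} (hF : IsNet F) (hG : IsNet G) :
    IsNet (fun x => F x - G x) := by
  have := IsNet.sum (T := Fin 2) (F := ![F, G])
    (fun t => by fin_cases t; exacts [hF, hG]) ![1, -1]
  simpa [Fin.sum_univ_two, ← sub_eq_add_neg] using this

lemma IsNet.add {F G : (ι → ℝ) → ℝ} (hF : IsNet F) (hG : IsNet G) :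
    IsNet (fun x => F x + G x) := by
  have := IsNet.sum (T := Fin 2) (F := ![F, G])
    (fun t => by fin_cases t; exacts [hF, hG]) ![1, 1]
  simpa [Fin.sum_univ_two] using this

lemma IsNet.relu {F : (ι → ℝ) → ℝ} (hF : IsNet F) : IsNet (fun x => max (F x) 0) := by
  obtain ⟨w, L, P, h⟩ := hF
  have := Computes.comp (τ := Unit) (fun _ => h)
    (Computes.layer (Matrix.of fun _ _ : Unit => (1 : ℝ)) (fun _ => 0) (fun _ => 1))
  exact ⟨_, _, _, by simpa [reluLayer, Matrix.mulVec, dotProduct] using this⟩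

lemma IsNet.sup {F G : (ι → ℝ) → ℝ} (hF : IsNet F) (hG : IsNet G) : IsNet (F ⊔ G) := by
  convert (hF.sub hG).relu.add hG using 2 with x
  rcases le_total (F x) (G x) with h | h
  · simp [h]
  · simp [h]

lemma IsNet.inf {F G : (ι → ℝ) → ℝ} (hF : IsNet F) (hG : IsNet G) : IsNet (F ⊓ G) := by
  convert hF.sub (hF.sub hG).relu using 2 with x
  rcases le_total (F x) (G x) with h | h
  · simp [h]
  · simp [h]

lemma isNet_const (a : ℝ) : IsNet (fun _ : ι → ℝ => a) :=
  ⟨_, _, _, by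
    simpa [reluLayer] using Computes.layer (0 : Matrix Unit ι ℝ) (fun _ => 1) (fun _ => a)⟩

lemma isNet_coord (i : ι) : IsNet (fun x : ι → ℝ => x i) := by
  classical
  exact ⟨_, _, _, by
    simpa [Matrix.mulVec] using (computes_id 0).precomp
      (Matrix.of fun _ : Unit => Pi.single (M := fun _ : ι => ℝ) i 1) 0⟩

lemma isNet_kuhnHat : IsNet (kuhnHat : (ι → ℝ) → ℝ) := by
  have ho : ∀ o : Option ι, IsNet (fun v : ι → ℝ => o.elim 0 v) := by
    rintro (_ | i)
    · exact isNet_const 0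
    · exact isNet_coord i
  have hmax : IsNet (maxZero : (ι → ℝ) → ℝ) := by
    have := Finset.sup'_induction (s := (Finset.univ : Finset (Option ι)))
      Finset.univ_nonempty (fun o (v : ι → ℝ) => o.elim 0 v)
      (p := IsNet) (fun _ h _ h' => h.sup h') (fun o _ => ho o)
    convert this using 1
    funext v
    rw [Finset.sup'_apply]
    rfl
  have hmin : IsNet (minZero : (ι → ℝ) → ℝ) := by
    have := Finset.inf'_induction (s := (Finset.univ : Finset (Option ι)))
      Finset.univ_nonempty (fun o (v : ι → ℝ) => o.elim 0 v)
      (p := IsNet) (fun _ h _ h' => h.inf h') (fun o _ => ho o)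
    convert this using 1
    funext v
    rw [Finset.inf'_apply]
    rfl
  exact ((hmin.add (isNet_const 1)).sub hmax).relu

end Hats

/-! ### Mixed partial derivatives on the cube -/

section Derivatives

variable {d : ℕ}

lemma cube_eq_pi (d : ℕ) : cube d = Set.pi Set.univ fun _ => Set.Icc (0 : ℝ) 1 := by
  ext x
  exact ⟨fun h i _ => ⟨h.1 i, h.2 i⟩, fun h => ⟨fun i => (h i trivial).1, fun i => (h i trivial).2⟩⟩

lemma mem_cube_iff {x : Fin d → ℝ} : x ∈ cube d ↔ ∀ i, x i ∈ Set.Icc (0 : ℝ) 1 := by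
  exact ⟨fun h i => ⟨h.1 i, h.2 i⟩, fun h => ⟨fun i => (h i).1, fun i => (h i).2⟩⟩

lemma convex_cube (d : ℕ) : Convex ℝ (cube d) := convex_Icc 0 1

lemma uniqueDiffOn_cube (d : ℕ) : UniqueDiffOn ℝ (cube d) := by
  rw [cube_eq_pi]
  exact UniqueDiffOn.univ_pi fun _ => uniqueDiffOn_Icc zero_lt_one

lemma cube_subset_closure_interior (d : ℕ) : cube d ⊆ closure (interior (cube d)) := by
  rw [cube_eq_pi, interior_pi_set Set.finite_univ, closure_pi_set]
  intro x hx i _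
  rw [interior_Icc, closure_Ioo zero_ne_one]
  exact hx i trivial

lemma update_mem_cube {x : Fin d → ℝ} (hx : x ∈ cube d) (i : Fin d) {t : ℝ}
    (ht : t ∈ Set.Icc (0 : ℝ) 1) : Function.update x i t ∈ cube d := by
  rw [mem_cube_iff] at hx ⊢
  intro j
  by_cases h : j = i
  · subst h; simpa using ht
  · simpa [h] using hx j

lemma pderivCube_congr {g g' : (Fin d → ℝ) → ℝ} (h : Set.EqOn g g' (cube d)) (i : Fin d) :
    Set.EqOn (pderivCube i g) (pderivCube i g') (cube d) := by
  intro x hx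
  refine derivWithin_congr (fun t ht => h (update_mem_cube hx i ht)) ?_
  exact h (update_mem_cube hx i (mem_cube_iff.1 hx i))

lemma iterate_pderivCube_congr {g g' : (Fin d → ℝ) → ℝ} (h : Set.EqOn g g' (cube d)) (i : Fin d)
    (m : ℕ) : Set.EqOn ((pderivCube i)^[m] g) ((pderivCube i)^[m] g') (cube d) := by
  induction m with
  | zero => exact h
  | succ m ih =>
    rw [Function.iterate_succ_apply', Function.iterate_succ_apply']
    exact pderivCube_congr ih i

lemma pderivCube_eq_of_hasFDerivWithinAt {g : (Fin d → ℝ) → ℝ} {g' : (Fin d → ℝ) →L[ℝ] ℝ}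
    {x : Fin d → ℝ} (hx : x ∈ cube d) (h : HasFDerivWithinAt g g' (cube d) x) (i : Fin d) :
    pderivCube i g x = g' (Pi.single i 1) := by
  have hxi := mem_cube_iff.1 hx i
  have h1 : HasDerivWithinAt (Function.update x i) (Pi.single i (1 : ℝ)) (Set.Icc 0 1) (x i) :=
    (hasDerivAt_update x i (x i)).hasDerivWithinAt
  have h2 : HasFDerivWithinAt g g' (cube d) (Function.update x i (x i)) := by
    rwa [Function.update_eq_self]
  exact (h2.comp_hasDerivWithinAt (x i) h1 fun t ht => update_mem_cube hx i ht).derivWithin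
    (uniqueDiffOn_Icc zero_lt_one _ hxi)

lemma pderivCube_eqOn {g : (Fin d → ℝ) → ℝ} (hg : DifferentiableOn ℝ g (cube d)) (i : Fin d) :
    Set.EqOn (pderivCube i g) (fun x => fderivWithin ℝ g (cube d) x (Pi.single i 1)) (cube d) :=
  fun x hx => pderivCube_eq_of_hasFDerivWithinAt hx (hg x hx).hasFDerivWithinAt i

lemma contDiffOn_pderivCube {g : (Fin d → ℝ) → ℝ} {n : ℕ}
    (hg : ContDiffOn ℝ (n + 1 : ℕ) g (cube d)) (i : Fin d) :
    ContDiffOn ℝ n (pderivCube i g) (cube d) := by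
  refine ContDiffOn.congr ?_ (pderivCube_eqOn (hg.differentiableOn (by simp)) i)
  exact (hg.fderivWithin (uniqueDiffOn_cube d) (by push_cast; rfl)).clm_apply contDiffOn_const

lemma contDiffOn_iterate_pderivCube {g : (Fin d → ℝ) → ℝ} {n : ℕ} (m : ℕ)
    (hg : ContDiffOn ℝ (n + m : ℕ) g (cube d)) (i : Fin d) :
    ContDiffOn ℝ n ((pderivCube i)^[m] g) (cube d) := by
  induction m generalizing g with
  | zero => exact hg
  | succ m ih => exact ih (contDiffOn_pderivCube hg i)

lemma pderivCube_comm {g : (Fin d → ℝ) → ℝ} (hg : ContDiffOn ℝ (2 : ℕ) g (cube d))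
    (i j : Fin d) :
    Set.EqOn (pderivCube i (pderivCube j g)) (pderivCube j (pderivCube i g)) (cube d) := by
  have key : ∀ i j : Fin d, ∀ x ∈ cube d, pderivCube i (pderivCube j g) x =
      fderivWithin ℝ (fderivWithin ℝ g (cube d)) (cube d) x (Pi.single i 1) (Pi.single j 1) := by
    intro i j x hx
    have h1 := (hg.fderivWithin (uniqueDiffOn_cube d) (m := 1) (by norm_num)).differentiableOn
      (by simp) x hx
    rw [pderivCube_congr (pderivCube_eqOn (hg.differentiableOn (by simp)) j) i hx]
    exact pderivCube_eq_of_hasFDerivWithinAt hx (h1.hasFDerivWithinAt.clm_apply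
      (hasFDerivWithinAt_const _ _ _)) i |>.trans (by simp)
  intro x hx
  rw [key i j x hx, key j i x hx]
  have h := (hg x hx).isSymmSndFDerivWithinAt (by simp) (uniqueDiffOn_cube d)
    (cube_subset_closure_interior d hx) hx
  exact h _ _

lemma pderivCube_iterate_comm {g : (Fin d → ℝ) → ℝ} (m : ℕ)
    (hg : ContDiffOn ℝ (m + 1 : ℕ) g (cube d)) (i j : Fin d) :
    Set.EqOn (pderivCube i ((pderivCube j)^[m] g)) ((pderivCube j)^[m] (pderivCube i g))
      (cube d) := by
  induction m with
  | zero => exact fun x _ => rfl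
  | succ m ih =>
    rw [Function.iterate_succ_apply', Function.iterate_succ_apply']
    have h2 : ContDiffOn ℝ (2 : ℕ) ((pderivCube j)^[m] g) (cube d) :=
      contDiffOn_iterate_pderivCube m (by convert hg using 2; omega) j
    exact (pderivCube_comm h2 i j).trans
      (pderivCube_congr (ih (hg.of_le (by norm_cast; omega))) j)

/-- The partial derivatives of `mixedDeriv`, for the variables in the list `l` only. -/
def listDeriv (l : List (Fin d)) (k : Fin d → ℕ) (f : (Fin d → ℝ) → ℝ) : (Fin d → ℝ) → ℝ :=
  l.foldr (fun i g => (pderivCube i)^[k i] g) f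

lemma contDiffOn_listDeriv (l : List (Fin d)) (k : Fin d → ℕ) {f : (Fin d → ℝ) → ℝ} {n : ℕ}
    (hf : ContDiffOn ℝ (n + (l.map k).sum : ℕ) f (cube d)) :
    ContDiffOn ℝ n (listDeriv l k f) (cube d) := by
  induction l generalizing n with
  | nil => simpa [listDeriv] using hf
  | cons j l ih =>
    refine contDiffOn_iterate_pderivCube (k j) (ih ?_) j
    convert hf using 2
    simp [add_assoc]

lemma listDeriv_congr_index {l : List (Fin d)} {k k' : Fin d → ℕ} (h : ∀ i ∈ l, k i = k' i)
    (f : (Fin d → ℝ) → ℝ) : listDeriv l k f = listDeriv l k' f := by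
  induction l with
  | nil => rfl
  | cons j l ih =>
    simp only [listDeriv, List.foldr_cons] at ih ⊢
    rw [ih fun i hi => h i (List.mem_cons_of_mem _ hi), h j List.mem_cons_self]

lemma pderivCube_listDeriv {l : List (Fin d)} (hl : l.Nodup) {i : Fin d} (hi : i ∈ l)
    (k : Fin d → ℕ) {f : (Fin d → ℝ) → ℝ}
    (hf : ContDiffOn ℝ ((l.map k).sum + 1 : ℕ) f (cube d)) :
    Set.EqOn (pderivCube i (listDeriv l k f)) (listDeriv l (k + Pi.single i 1) f) (cube d) := by
  induction l with
  | nil => simp at hi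
  | cons j l ih =>
    rw [List.nodup_cons] at hl
    by_cases hij : i = j
    · subst hij
      have h1 : listDeriv l (k + Pi.single i 1) f = listDeriv l k f := by
        refine listDeriv_congr_index (fun j hj => ?_) f
        have : j ≠ i := fun h => hl.1 (h ▸ hj)
        simp [this]
      have h2 : listDeriv (i :: l) (k + Pi.single i 1) f =
          pderivCube i (listDeriv (i :: l) k f) := by
        change (pderivCube i)^[(k + Pi.single i 1 : Fin d → ℕ) i]
            (listDeriv l (k + Pi.single i 1) f) =
          pderivCube i ((pderivCube i)^[k i] (listDeriv l k f))
        have h3 : (k + Pi.single i 1 : Fin d → ℕ) i = k i + 1 := by simp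
        rw [h1, h3, Function.iterate_succ_apply']
      rw [h2]
      exact fun _ _ => rfl
    · have hil : i ∈ l := by simpa [hij] using hi
      have h1 : ContDiffOn ℝ (k j + 1 : ℕ) (listDeriv l k f) (cube d) := by
        refine contDiffOn_listDeriv l k ?_
        convert hf using 2
        simp
        ring
      have h2 := ih hl.2 hil (hf.of_le (Nat.cast_le.2 (by simp)))
      have h3 := pderivCube_iterate_comm (k j) h1 i j
      have h4 := iterate_pderivCube_congr h2 j (k j)
      have h5 : (k + Pi.single i 1 : Fin d → ℕ) j = k j := by
        have : j ≠ i := fun h => hij h.symm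
        simp [this]
      change Set.EqOn (pderivCube i ((pderivCube j)^[k j] (listDeriv l k f)))
        ((pderivCube j)^[(k + Pi.single i 1 : Fin d → ℕ) j]
          (listDeriv l (k + Pi.single i 1) f)) (cube d)
      rw [h5]
      exact h3.trans h4

/-- The total derivative of `g` with partial derivatives `p i`. -/
def gradMap (p : Fin d → ℝ) : (Fin d → ℝ) →L[ℝ] ℝ :=
  ∑ i, p i • ContinuousLinearMap.proj (R := ℝ) (φ := fun _ : Fin d => ℝ) i

lemma gradMap_apply (p v : Fin d → ℝ) : gradMap p v = ∑ i, p i * v i := by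
  simp [gradMap]

lemma norm_gradMap_le (p : Fin d → ℝ) : ‖gradMap p‖ ≤ ∑ i, |p i| := by
  refine ContinuousLinearMap.opNorm_le_bound _ (Finset.sum_nonneg fun i _ => abs_nonneg _)
    fun v => ?_
  rw [gradMap_apply, Finset.sum_mul]
  refine (Finset.abs_sum_le_sum_abs _ _).trans (Finset.sum_le_sum fun i _ => ?_)
  rw [abs_mul]
  exact mul_le_mul_of_nonneg_left (norm_le_pi_norm v i) (abs_nonneg _)

lemma sum_map_finRange (k : Fin d → ℕ) : ((List.finRange d).map k).sum = ∑ i, k i := by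
  rw [Fin.sum_univ_def]

/-- The partial derivatives of order `≤ s` of a `C^s` function are the components of the total
derivatives of those of order `< s`. -/
lemma hasFDerivWithinAt_mixedDeriv {s : ℕ} {f : (Fin d → ℝ) → ℝ}
    (hf : ContDiffOn ℝ (s : ℕ) f (cube d)) {k : Fin d → ℕ} (hk : ∑ i, k i < s)
    {x : Fin d → ℝ} (hx : x ∈ cube d) :
    HasFDerivWithinAt (mixedDeriv k f)
      (gradMap fun i => mixedDeriv (k + Pi.single i 1) f x) (cube d) x := by
  have h1 : ContDiffOn ℝ (1 : ℕ) (mixedDeriv k f) (cube d) := by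
    refine contDiffOn_listDeriv (List.finRange d) k (hf.of_le ?_)
    rw [sum_map_finRange]
    norm_cast
    omega
  have h2 := (h1.differentiableOn (by simp) x hx).hasFDerivWithinAt
  have h3 : ∀ i, mixedDeriv (k + Pi.single i 1) f x =
      fderivWithin ℝ (mixedDeriv k f) (cube d) x (Pi.single i 1) := fun i => by
    rw [← pderivCube_eq_of_hasFDerivWithinAt hx h2 i]
    exact (pderivCube_listDeriv (List.nodup_finRange d) (List.mem_finRange i) k
      (hf.of_le (by rw [sum_map_finRange]; norm_cast)) hx).symm
  have h4 : gradMap (fun i => mixedDeriv (k + Pi.single i 1) f x) =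
      fderivWithin ℝ (mixedDeriv k f) (cube d) x := by
    ext v
    conv_rhs => rw [← Finset.univ_sum_single v, map_sum]
    rw [gradMap_apply]
    refine Finset.sum_congr rfl fun i _ => ?_
    rw [h3, show Pi.single i (v i) = v i • (Pi.single i 1 : Fin d → ℝ) by
      rw [← Pi.single_smul]; simp, map_smul, smul_eq_mul, mul_comm]
  rwa [h4]

end Derivatives

/-! ### Taylor expansion on the cube -/

section Taylor

variable {d : ℕ}

/-- A family `F k`, indexed by multi-indices `k`, that behaves like the partial derivatives up to
order `s` of a function on the cube whose derivatives of order `s` are Lipschitz. The factor `d` in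
the Lipschitz constant allows for the passage from the Euclidean norm to the sup norm. -/
structure IsJet (s : ℕ) (B : ℝ) (F : (Fin d → ℕ) → (Fin d → ℝ) → ℝ) : Prop where
  hasFDeriv : ∀ k, ∑ i, k i < s → ∀ x ∈ cube d,
    HasFDerivWithinAt (F k) (gradMap fun i => F (k + Pi.single i 1) x) (cube d) x
  lipschitz : ∀ k, ∑ i, k i = s → ∀ x ∈ cube d, ∀ y ∈ cube d, |F k x - F k y| ≤ B * d * ‖x - y‖

/-- The normalized monomial `y^k / k!`. -/
def normMonomial (k : Fin d → ℕ) (y : Fin d → ℝ) : ℝ := ∏ i, y i ^ k i / (k i).factorial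

/-- The multi-indices of order at most `s`. -/
def multiIndices (d s : ℕ) : Finset (Fin d → ℕ) :=
  (Fintype.piFinset fun _ => Finset.range (s + 1)).filter fun k => ∑ i, k i ≤ s

/-- The Taylor polynomial of degree `s` at `a`. -/
def taylorPoly (s : ℕ) (F : (Fin d → ℕ) → (Fin d → ℝ) → ℝ) (a x : Fin d → ℝ) : ℝ :=
  ∑ k ∈ multiIndices d s, F k a * normMonomial k (x - a)

lemma mem_multiIndices {s : ℕ} {k : Fin d → ℕ} : k ∈ multiIndices d s ↔ ∑ i, k i ≤ s := by
  simp only [multiIndices, Finset.mem_filter, Fintype.mem_piFinset, Finset.mem_range,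
    Nat.lt_succ_iff, and_iff_right_iff_imp]
  exact fun h i => (Finset.single_le_sum (fun i _ => Nat.zero_le (k i)) (Finset.mem_univ i)).trans h

lemma hasDerivAt_pow_div_factorial (m : ℕ) (t : ℝ) :
    HasDerivAt (fun t : ℝ => t ^ m / m.factorial)
      (if m = 0 then 0 else t ^ (m - 1) / (m - 1).factorial) t := by
  rcases m with _ | m
  · simpa using hasDerivAt_const t (1 : ℝ)
  · have := (hasDerivAt_pow (m + 1) t).div_const ((m + 1).factorial : ℝ)
    refine this.congr_deriv ?_
    rw [if_neg (Nat.succ_ne_zero m), Nat.factorial_succ]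
    push_cast
    have : (m.factorial : ℝ) ≠ 0 := by positivity
    field_simp

lemma hasFDerivAt_normMonomial (k : Fin d → ℕ) (y : Fin d → ℝ) :
    HasFDerivAt (normMonomial k)
      (gradMap fun i => if k i = 0 then 0 else normMonomial (k - Pi.single i 1) y) y := by
  have h1 : ∀ i ∈ (Finset.univ : Finset (Fin d)), HasFDerivAt
      (fun y : Fin d → ℝ => y i ^ k i / (k i).factorial)
      ((if k i = 0 then 0 else y i ^ (k i - 1) / (k i - 1).factorial) •
        ContinuousLinearMap.proj (R := ℝ) (φ := fun _ : Fin d => ℝ) i) y := fun i _ =>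
    (hasDerivAt_pow_div_factorial (k i) (y i)).comp_hasFDerivAt (f := fun y : Fin d → ℝ => y i) y
      (ContinuousLinearMap.proj (R := ℝ) (φ := fun _ : Fin d => ℝ) i).hasFDerivAt
  refine HasFDerivAt.congr_fderiv (f := fun y : Fin d → ℝ => ∏ i, y i ^ k i / (k i).factorial)
    (HasFDerivAt.finsetProd h1) ?_
  unfold gradMap
  refine Finset.sum_congr rfl fun i _ => ?_
  rw [smul_smul]
  congr 1
  dsimp only
  split_ifs with hi
  · simp
  · unfold normMonomial
    rw [← Finset.prod_erase_mul _ _ (Finset.mem_univ i)]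
    congr 1
    · refine Finset.prod_congr rfl fun j hj => ?_
      have hji : j ≠ i := (Finset.mem_erase.1 hj).1
      simp [hji]
    · simp

/-- The partial derivatives of a Taylor polynomial are the Taylor polynomials of the shifted
jets. -/
lemma hasFDerivAt_taylorPoly (s : ℕ) (F : (Fin d → ℕ) → (Fin d → ℝ) → ℝ) (a x : Fin d → ℝ) :
    HasFDerivAt (taylorPoly (s + 1) F a)
      (gradMap fun i => taylorPoly s (fun k => F (k + Pi.single i 1)) a x) x := by
  have h1 : HasFDerivAt (taylorPoly (s + 1) F a) (∑ k ∈ multiIndices d (s + 1), F k a •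
      gradMap fun i => if k i = 0 then 0 else normMonomial (k - Pi.single i 1) (x - a)) x := by
    refine HasFDerivAt.fun_sum fun k _ => HasFDerivAt.const_mul ?_ _
    exact (hasFDerivAt_normMonomial k (x - a)).comp x ((hasFDerivAt_id x).sub_const a)
  refine h1.congr_fderiv ?_
  ext v
  simp only [sum_apply, smul_apply, gradMap_apply,
    smul_eq_mul, Finset.mul_sum]
  rw [Finset.sum_comm]
  refine Finset.sum_congr rfl fun i _ => ?_
  unfold taylorPoly
  rw [Finset.sum_mul]
  symm
  refine Finset.sum_of_injOn (fun k => k + Pi.single i 1) (fun k _ k' _ h => add_right_cancel h)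
    (fun k hk => ?_) (fun k hk hk' => ?_) (fun k hk => ?_)
  · simp only [Finset.mem_coe, mem_multiIndices] at hk ⊢
    simpa [Finset.sum_add_distrib] using hk
  · rw [if_pos]
    · simp
    · by_contra h0
      refine hk' ⟨k - Pi.single i 1, ?_, ?_⟩
      · have hk2 : k - Pi.single i 1 + Pi.single i 1 = k := by
          funext j
          by_cases hj : j = i
          · subst hj; simp; omega
          · simp [hj]
        have h3 : ∑ j, (k - Pi.single i 1 + Pi.single i 1 : Fin d → ℕ) j ≤ s + 1 := by
          rw [hk2]; exact mem_multiIndices.1 hk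
        simp only [Finset.mem_coe, mem_multiIndices]
        simpa [Finset.sum_add_distrib] using h3
      · funext j
        by_cases hj : j = i
        · subst hj; simp; omega
        · simp [hj]
  · rw [if_neg (by simp)]
    simp only [add_tsub_cancel_right]
    ring

lemma taylorPoly_self (s : ℕ) (F : (Fin d → ℕ) → (Fin d → ℝ) → ℝ) (a : Fin d → ℝ) :
    taylorPoly s F a a = F 0 a := by
  unfold taylorPoly
  rw [Finset.sum_eq_single 0]
  · simp [normMonomial]
  · intro k _ hk
    obtain ⟨i, hi⟩ := Function.ne_iff.1 hk
    rw [normMonomial, Finset.prod_eq_zero (Finset.mem_univ i), mul_zero]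
    simp at hi
    simp [hi]
  · intro h
    exact absurd (mem_multiIndices.2 (by simp)) h

lemma IsJet.shift {s : ℕ} {B : ℝ} {F : (Fin d → ℕ) → (Fin d → ℝ) → ℝ} (h : IsJet (s + 1) B F)
    (i : Fin d) : IsJet s B (fun k => F (k + Pi.single i 1)) := by
  have hsum : ∀ k : Fin d → ℕ, ∑ j, (k + Pi.single i 1 : Fin d → ℕ) j = ∑ j, k j + 1 := by
    intro k
    simp [Finset.sum_add_distrib]
  refine ⟨fun k hk x hx => ?_, fun k hk => h.lipschitz _ (by rw [hsum, hk])⟩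
  have := h.hasFDeriv (k + Pi.single i 1) (by rw [hsum]; omega) x hx
  simpa only [add_right_comm] using this

/-- The remainder of the Taylor expansion has a small Lipschitz constant near `a`. -/
lemma IsJet.abs_remainder_sub_le {s : ℕ} {B : ℝ} (hB : 0 ≤ B)
    {F : (Fin d → ℕ) → (Fin d → ℝ) → ℝ} (h : IsJet s B F) {a : Fin d → ℝ} (ha : a ∈ cube d)
    {r : ℝ} (hr : 0 ≤ r) {x y : Fin d → ℝ} (hx : x ∈ cube d) (hy : y ∈ cube d)
    (hxa : ‖x - a‖ ≤ r) (hya : ‖y - a‖ ≤ r) :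
    |(F 0 x - taylorPoly s F a x) - (F 0 y - taylorPoly s F a y)| ≤
      B * d ^ (s + 1) * r ^ s * ‖x - y‖ := by
  induction s generalizing F x y with
  | zero =>
    have hc : ∀ z, taylorPoly 0 F a z = F 0 a := by
      intro z
      unfold taylorPoly
      rw [show multiIndices d 0 = {0} by
        ext k; simp [mem_multiIndices, funext_iff]]
      simp [normMonomial]
    have := h.lipschitz 0 (by simp) x hx y hy
    simpa [hc] using this
  | succ s ih =>
    -- the partial derivatives of the remainder are the remainders of the shifted jets
    set S : Set (Fin d → ℝ) := cube d ∩ Metric.closedBall a r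
    have hS : Convex ℝ S := (convex_cube d).inter (convex_closedBall a r)
    have hder : ∀ z ∈ S, HasFDerivWithinAt (fun z => F 0 z - taylorPoly (s + 1) F a z)
        (gradMap (fun i => F (0 + Pi.single i 1) z) -
          gradMap fun i => taylorPoly s (fun k => F (k + Pi.single i 1)) a z) S z := fun z hz =>
      ((h.hasFDeriv 0 (by simp) z hz.1).mono Set.inter_subset_left).sub
        (hasFDerivAt_taylorPoly s F a z).hasFDerivWithinAt
    have hbound : ∀ z ∈ S, ‖gradMap (fun i => F (0 + Pi.single i 1) z) -
          gradMap fun i => taylorPoly s (fun k => F (k + Pi.single i 1)) a z‖ ≤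
        B * d ^ (s + 2) * r ^ (s + 1) := by
      intro z hz
      have hza : ‖z - a‖ ≤ r := by simpa [dist_eq_norm] using hz.2
      have h1 : gradMap (fun i => F (0 + Pi.single i 1) z) -
          gradMap (fun i => taylorPoly s (fun k => F (k + Pi.single i 1)) a z) =
          gradMap fun i => F (0 + Pi.single i 1) z -
            taylorPoly s (fun k => F (k + Pi.single i 1)) a z := by
        ext v
        simp [gradMap_apply, ← Finset.sum_sub_distrib, sub_mul]
      rw [h1]
      refine (norm_gradMap_le _).trans ?_
      have h2 : ∀ i ∈ (Finset.univ : Finset (Fin d)), |F (0 + Pi.single i 1) z -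
          taylorPoly s (fun k => F (k + Pi.single i 1)) a z| ≤
          B * d ^ (s + 1) * r ^ (s + 1) := by
        intro i _
        have := ih (h.shift i) hz.1 ha hza (by simp [hr])
        rw [taylorPoly_self, sub_self, sub_zero] at this
        refine this.trans ?_
        rw [pow_succ r s, ← mul_assoc]
        exact mul_le_mul_of_nonneg_left hza (by positivity)
      refine (Finset.sum_le_sum h2).trans (le_of_eq ?_)
      simp
      ring
    have := hS.norm_image_sub_le_of_norm_hasFDerivWithin_le hder hbound
      (x := y) (y := x) ⟨hy, by simpa [dist_eq_norm] using hya⟩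
      ⟨hx, by simpa [dist_eq_norm] using hxa⟩
    exact this

lemma IsJet.abs_remainder_le {s : ℕ} {B : ℝ} (hB : 0 ≤ B)
    {F : (Fin d → ℕ) → (Fin d → ℝ) → ℝ} (h : IsJet s B F) {a : Fin d → ℝ} (ha : a ∈ cube d)
    {r : ℝ} (hr : 0 ≤ r) {x : Fin d → ℝ} (hx : x ∈ cube d) (hxa : ‖x - a‖ ≤ r) :
    |F 0 x - taylorPoly s F a x| ≤ B * d ^ (s + 1) * r ^ (s + 1) := by
  have := h.abs_remainder_sub_le hB ha hr hx ha hxa (by simp [hr])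
  rw [taylorPoly_self, sub_self, sub_zero] at this
  refine this.trans ?_
  rw [pow_succ r s, ← mul_assoc]
  exact mul_le_mul_of_nonneg_left hxa (by positivity)

/-! ### Consequences of a bound on the norm of `W^α_∞` -/

lemma mixedDeriv_zero (f : (Fin d → ℝ) → ℝ) : mixedDeriv 0 f = f := by
  unfold mixedDeriv
  induction List.finRange d with
  | nil => rfl
  | cons i l ih => simp

lemma abs_le_of_supNormCube_le {g : (Fin d → ℝ) → ℝ} {B : ℝ} (hB : 0 ≤ B)
    (h : supNormCube g ≤ ENNReal.ofReal B) {x : Fin d → ℝ} (hx : x ∈ cube d) : |g x| ≤ B :=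
  (ENNReal.ofReal_le_ofReal_iff hB).1 ((le_iSup₂ (f := fun x (_ : x ∈ cube d) =>
    ENNReal.ofReal |g x|) x hx).trans h)

lemma sqrt_sum_sq_le (v : Fin d → ℝ) : Real.sqrt (∑ i, v i ^ 2) ≤ d * ‖v‖ := by
  refine Real.sqrt_le_iff.2 ⟨by positivity, ?_⟩
  have h1 : ∑ i, v i ^ 2 ≤ ∑ _i : Fin d, ‖v‖ ^ 2 := Finset.sum_le_sum fun i _ => by
    rw [← sq_abs]
    exact pow_le_pow_left₀ (abs_nonneg _) (norm_le_pi_norm v i) 2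
  refine h1.trans ?_
  simp only [Finset.sum_const, Finset.card_univ, Fintype.card_fin, nsmul_eq_mul, mul_pow]
  have h2 : (d : ℝ) ≤ (d : ℝ) ^ 2 := by exact_mod_cast Nat.le_self_pow two_ne_zero d
  exact mul_le_mul_of_nonneg_right h2 (by positivity)

variable {α : ℕ} {B : ℝ} {f : (Fin d → ℝ) → ℝ}

lemma supNormCube_mixedDeriv_le {k : Fin d → ℕ} (hk : ∑ i, k i ≤ α - 1) :
    supNormCube (mixedDeriv k f) ≤ holderNorm α f := by
  have hmem : k ∈ Finset.piAntidiag Finset.univ (∑ i, k i) := by simp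
  rcases hk.lt_or_eq with h | h
  · refine le_trans ?_ (le_self_add)
    refine le_trans ?_ (Finset.single_le_sum (f := fun m =>
      ∑ k ∈ Finset.piAntidiag (Finset.univ : Finset (Fin d)) m, supNormCube (mixedDeriv k f))
      (fun _ _ => zero_le) (Finset.mem_range.2 h))
    exact Finset.single_le_sum (f := fun k => supNormCube (mixedDeriv k f))
      (fun _ _ => zero_le) hmem
  · rw [h] at hmem
    refine le_trans ?_ (le_add_self)
    refine le_trans (le_self_add) (Finset.single_le_sum (f := fun k =>
      supNormCube (mixedDeriv k f) + lipSemiCube (mixedDeriv k f)) (fun _ _ => zero_le) hmem)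

lemma lipSemiCube_mixedDeriv_le {k : Fin d → ℕ} (hk : ∑ i, k i = α - 1) :
    lipSemiCube (mixedDeriv k f) ≤ holderNorm α f := by
  have hmem : k ∈ Finset.piAntidiag Finset.univ (α - 1) := by simp [hk]
  refine le_trans ?_ (le_add_self)
  exact le_trans (le_add_self) (Finset.single_le_sum (f := fun k =>
    supNormCube (mixedDeriv k f) + lipSemiCube (mixedDeriv k f)) (fun _ _ => zero_le) hmem)

lemma InHolderBall.abs_mixedDeriv_le (hB : 0 ≤ B) (h : InHolderBall α B f) {k : Fin d → ℕ}
    (hk : ∑ i, k i ≤ α - 1) {x : Fin d → ℝ} (hx : x ∈ cube d) : |mixedDeriv k f x| ≤ B :=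
  abs_le_of_supNormCube_le hB ((supNormCube_mixedDeriv_le hk).trans h.2) hx

lemma InHolderBall.isJet (hB : 0 ≤ B) (h : InHolderBall α B f) :
    IsJet (α - 1) B (fun k => mixedDeriv k f) := by
  refine ⟨fun k hk x hx => hasFDerivWithinAt_mixedDeriv (by exact_mod_cast h.1) hk hx,
    fun k hk x hx y hy => ?_⟩
  by_cases hxy : x = y
  · subst hxy; simp
  have h1 : ENNReal.ofReal (|mixedDeriv k f x - mixedDeriv k f y| /
      Real.sqrt (∑ i, (x i - y i) ^ 2)) ≤ ENNReal.ofReal B := by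
    refine le_trans ?_ ((lipSemiCube_mixedDeriv_le hk).trans h.2)
    unfold lipSemiCube
    exact le_iSup₂_of_le x hx (le_iSup₂_of_le y hy (le_iSup_of_le hxy le_rfl))
  have h2 := (ENNReal.ofReal_le_ofReal_iff hB).1 h1
  have h3 : 0 < Real.sqrt (∑ i, (x i - y i) ^ 2) := by
    refine Real.sqrt_pos.2 ?_
    obtain ⟨i, hi⟩ := Function.ne_iff.1 hxy
    exact Finset.sum_pos' (fun i _ => sq_nonneg _)
      ⟨i, Finset.mem_univ i, by have := sub_ne_zero.2 hi; positivity⟩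
  rw [div_le_iff₀ h3] at h2
  refine h2.trans ?_
  rw [mul_assoc]
  exact mul_le_mul_of_nonneg_left (sqrt_sum_sq_le (x - y)) hB

/-- The first order derivatives alone show that `f` is `B`-Lipschitz for the sup norm. -/
lemma InHolderBall.abs_sub_le (hα : 2 ≤ α) (hB : 0 ≤ B) (h : InHolderBall α B f)
    {x y : Fin d → ℝ} (hx : x ∈ cube d) (hy : y ∈ cube d) : |f x - f y| ≤ B * ‖x - y‖ := by
  have hsum : ∑ i : Fin d, supNormCube (mixedDeriv (Pi.single i 1) f) ≤ holderNorm α f := by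
    have h1 : ∑ i : Fin d, supNormCube (mixedDeriv (Pi.single i 1) f) ≤
        ∑ k ∈ Finset.piAntidiag (Finset.univ : Finset (Fin d)) 1,
          supNormCube (mixedDeriv k f) := by
      rw [← Finset.sum_image (s := Finset.univ) (g := fun i : Fin d => (Pi.single i 1 : Fin d → ℕ))
        (f := fun k => supNormCube (mixedDeriv k f))
        (fun i _ j _ hij => by
          by_contra hne
          have := congrFun hij i
          simp [hne] at this)]
      refine Finset.sum_le_sum_of_subset fun k hk => ?_
      obtain ⟨i, -, rfl⟩ := Finset.mem_image.1 hk
      simp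
    refine h1.trans ?_
    rcases Nat.lt_or_ge 1 (α - 1) with h2 | h2
    · refine le_trans ?_ (le_self_add)
      exact Finset.single_le_sum (f := fun m =>
        ∑ k ∈ Finset.piAntidiag (Finset.univ : Finset (Fin d)) m, supNormCube (mixedDeriv k f))
        (fun _ _ => zero_le) (Finset.mem_range.2 h2)
    · have h3 : α - 1 = 1 := by omega
      refine le_trans ?_ (le_add_self)
      rw [h3]
      exact Finset.sum_le_sum fun k _ => le_self_add
  have hder : ∀ z ∈ cube d, HasFDerivWithinAt f
      (gradMap fun i => mixedDeriv (Pi.single i 1) f z) (cube d) z := by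
    intro z hz
    have := (h.isJet hB).hasFDeriv 0 (by simp; omega) z hz
    simpa [mixedDeriv_zero] using this
  have hbound : ∀ z ∈ cube d, ‖gradMap fun i => mixedDeriv (Pi.single i 1) f z‖ ≤ B := by
    intro z hz
    refine (norm_gradMap_le _).trans ?_
    rw [← ENNReal.ofReal_le_ofReal_iff hB, ENNReal.ofReal_sum_of_nonneg fun i _ => abs_nonneg _]
    refine le_trans (Finset.sum_le_sum fun i _ => ?_) (hsum.trans h.2)
    exact le_iSup₂ (f := fun x (_ : x ∈ cube d) =>
      ENNReal.ofReal |mixedDeriv (Pi.single i 1) f x|) z hz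
  exact (convex_cube d).norm_image_sub_le_of_norm_hasFDerivWithin_le hder hbound hy hx

end Taylor

/-! ### Blending Taylor polynomials -/

section Blend

variable {d : ℕ}

/-- The coefficient of `x^j` in the Taylor polynomial of degree `s` at `a`. -/
def taylorCoeff (s : ℕ) (F : (Fin d → ℕ) → (Fin d → ℝ) → ℝ) (a : Fin d → ℝ)
    (j : Fin d → Fin (s + 1)) : ℝ :=
  ∑ k ∈ multiIndices d s, F k a *
    ∏ i, ((k i).choose (j i) : ℝ) * (-a i) ^ (k i - (j i : ℕ)) / (k i).factorial

lemma taylorPoly_eq_sum_taylorCoeff (s : ℕ) (F : (Fin d → ℕ) → (Fin d → ℝ) → ℝ)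
    (a x : Fin d → ℝ) :
    taylorPoly s F a x = ∑ j : Fin d → Fin (s + 1), taylorCoeff s F a j * ∏ i, x i ^ (j i : ℕ) := by
  have h1 : ∀ n ≤ s, ∀ t b : ℝ, (t - b) ^ n / n.factorial =
      ∑ j : Fin (s + 1), ((n.choose j : ℝ) * (-b) ^ (n - (j : ℕ)) / n.factorial) * t ^ (j : ℕ) := by
    intro n hn t b
    rw [Fin.sum_univ_eq_sum_range (fun j =>
      ((n.choose j : ℝ) * (-b) ^ (n - j) / n.factorial) * t ^ j), sub_eq_add_neg, add_pow,
      Finset.sum_div]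
    refine (Finset.sum_subset (Finset.range_mono (by omega)) fun j _ hj => ?_).trans
      (Finset.sum_congr rfl fun j _ => by ring)
    rw [Nat.choose_eq_zero_of_lt (by simpa using hj)]
    simp
  have h2 : ∀ k ∈ multiIndices d s, F k a * normMonomial k (x - a) =
      ∑ j : Fin d → Fin (s + 1), F k a * ((∏ i, ((k i).choose (j i) : ℝ) *
        (-a i) ^ (k i - (j i : ℕ)) / (k i).factorial) * ∏ i, x i ^ (j i : ℕ)) := by
    intro k hk
    rw [← Finset.mul_sum]
    congr 1
    unfold normMonomial
    simp only [← Finset.prod_mul_distrib]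
    rw [← Fintype.piFinset_univ]
    refine Eq.trans (Finset.prod_congr rfl fun i _ => h1 (k i) ?_ _ _) (Finset.prod_univ_sum
      (fun _ => Finset.univ) fun i (j : Fin (s + 1)) => ((k i).choose j : ℝ) *
        (-a i) ^ (k i - (j : ℕ)) / (k i).factorial * x i ^ (j : ℕ))
    exact (Finset.single_le_sum (fun i _ => Nat.zero_le (k i)) (Finset.mem_univ i)).trans
      (mem_multiIndices.1 hk)
  unfold taylorPoly taylorCoeff
  rw [Finset.sum_congr rfl h2, Finset.sum_comm]
  refine Finset.sum_congr rfl fun j _ => ?_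
  rw [Finset.sum_mul]
  exact Finset.sum_congr rfl fun k _ => by ring

lemma abs_taylorCoeff_le {s : ℕ} {F : (Fin d → ℕ) → (Fin d → ℝ) → ℝ} {a : Fin d → ℝ} {B : ℝ}
    (ha : a ∈ cube d) (hF : ∀ k, ∑ i, k i ≤ s → |F k a| ≤ B) (j : Fin d → Fin (s + 1)) :
    |taylorCoeff s F a j| ≤ (multiIndices d s).card * B := by
  unfold taylorCoeff
  rw [← nsmul_eq_mul]
  refine (Finset.abs_sum_le_sum_abs _ _).trans (Finset.sum_le_card_nsmul _ _ _ fun k hk => ?_)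
  rw [abs_mul, Finset.abs_prod]
  have hFk := hF k (mem_multiIndices.1 hk)
  refine (mul_le_of_le_one_right (abs_nonneg _) ?_).trans hFk
  refine Finset.prod_le_one (fun i _ => abs_nonneg _) fun i _ => ?_
  have hai := mem_cube_iff.1 ha i
  have h1 : |(-a i) ^ (k i - (j i : ℕ))| ≤ 1 := by
    rw [abs_pow, abs_neg, abs_of_nonneg hai.1]
    exact pow_le_one₀ hai.1 hai.2
  have h2 : ((k i).choose (j i) : ℝ) ≤ (k i).factorial := by
    rcases le_or_gt (j i : ℕ) (k i) with h | h
    · rw [← Nat.choose_mul_factorial_mul_factorial h, mul_assoc]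
      exact_mod_cast Nat.le_mul_of_pos_right _ (by positivity)
    · rw [Nat.choose_eq_zero_of_lt h]
      exact_mod_cast Nat.zero_le _
  rw [abs_div, abs_mul, Nat.abs_cast, Nat.abs_cast, div_le_one (by positivity)]
  calc ((k i).choose (j i) : ℝ) * |(-a i) ^ (k i - (j i : ℕ))| ≤ (k i).factorial * 1 :=
        mul_le_mul h2 h1 (abs_nonneg _) (by positivity)
    _ = _ := mul_one _

/-- The nodal function of the grid of mesh size `1 / N` at the node `m / N`. -/
def gridHat (N : ℕ) (m : Fin d → Fin (N + 1)) (x : Fin d → ℝ) : ℝ :=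
  kuhnHat ((N : ℝ) • x - gridPoint m)

/-- The node `m / N`. -/
def gridNode (N : ℕ) (m : Fin d → Fin (N + 1)) : Fin d → ℝ := (N : ℝ)⁻¹ • gridPoint m

/-- The Taylor polynomials at the nodes of a grid, glued by a partition of unity. -/
def blend (s N : ℕ) (F : (Fin d → ℕ) → (Fin d → ℝ) → ℝ) (x : Fin d → ℝ) : ℝ :=
  ∑ m : Fin d → Fin (N + 1), gridHat N m x * taylorPoly s F (gridNode N m) x

variable {N : ℕ}

lemma gridNode_mem_cube (hN : 0 < N) (m : Fin d → Fin (N + 1)) : gridNode N m ∈ cube d := by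
  rw [mem_cube_iff]
  intro i
  have hN' : (0 : ℝ) < N := by exact_mod_cast hN
  have h : ((m i : ℕ) : ℝ) ≤ N := by exact_mod_cast Nat.lt_succ_iff.1 (m i).2
  simp only [gridNode, gridPoint, Pi.smul_apply, smul_eq_mul, Set.mem_Icc]
  refine ⟨by positivity, ?_⟩
  rw [inv_mul_eq_div]
  exact (div_le_one hN').2 h

lemma sum_gridHat {x : Fin d → ℝ} (hx : x ∈ cube d) :
    ∑ m : Fin d → Fin (N + 1), gridHat N m x = 1 := by
  refine sum_kuhnHat (fun i => ?_) fun i => ?_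
  · exact mul_nonneg (Nat.cast_nonneg N) (mem_cube_iff.1 hx i).1
  · exact mul_le_of_le_one_right (Nat.cast_nonneg N) (mem_cube_iff.1 hx i).2

lemma gridHat_nonneg (m : Fin d → Fin (N + 1)) (x : Fin d → ℝ) : 0 ≤ gridHat N m x :=
  kuhnHat_nonneg _

lemma norm_sub_gridNode_le (hN : 0 < N) {m : Fin d → Fin (N + 1)} {x : Fin d → ℝ}
    (h : gridHat N m x ≠ 0) : ‖x - gridNode N m‖ ≤ (N : ℝ)⁻¹ := by
  have hN' : (0 : ℝ) < N := by exact_mod_cast hN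
  refine (pi_norm_le_iff_of_nonneg (by positivity)).2 fun i => ?_
  have h1 := (abs_lt_one_of_kuhnHat_ne_zero h i).le
  have h2 : (x - gridNode N m) i = (N : ℝ)⁻¹ * ((N : ℝ) • x - gridPoint m) i := by
    simp [gridNode, mul_sub, inv_mul_cancel_left₀ hN'.ne']
  rw [h2, Real.norm_eq_abs, abs_mul, abs_of_pos (inv_pos.2 hN')]
  exact mul_le_of_le_one_right (by positivity) h1

lemma sum_abs_gridHat_sub_le {x y : Fin d → ℝ} {r : ℝ} (h : ‖x - y‖ ≤ r) :
    ∑ m : Fin d → Fin (N + 1), |gridHat N m x - gridHat N m y| ≤ 2 ^ d * (4 * (N * r)) := by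
  have hr : 0 ≤ r := (norm_nonneg _).trans h
  have := sum_abs_kuhnHat_sub_le N (u := (N : ℝ) • x) (u' := (N : ℝ) • y)
    (r := N * r) (by positivity) fun i => by
      simp only [Pi.smul_apply, smul_eq_mul, ← mul_sub, abs_mul, Nat.abs_cast]
      exact mul_le_mul_of_nonneg_left ((norm_le_pi_norm (x - y) i).trans h) (by positivity)
  simpa [gridHat] using this

variable {s : ℕ} {B : ℝ} {F : (Fin d → ℕ) → (Fin d → ℝ) → ℝ}

/-- As the hat functions add up to `1`, the error of `blend` is the average of the remainders. -/
lemma blend_eq {x : Fin d → ℝ} (hx : x ∈ cube d) :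
    blend s N F x = F 0 x - ∑ m : Fin d → Fin (N + 1),
      gridHat N m x * (F 0 x - taylorPoly s F (gridNode N m) x) := by
  simp only [mul_sub, Finset.sum_sub_distrib, ← Finset.sum_mul, sum_gridHat hx, one_mul, blend]
  ring

lemma abs_blend_sub_le (hB : 0 ≤ B) (hF : IsJet s B F) (hN : 0 < N) {x : Fin d → ℝ}
    (hx : x ∈ cube d) :
    |blend s N F x - F 0 x| ≤ B * d ^ (s + 1) * (N : ℝ)⁻¹ ^ (s + 1) := by
  rw [blend_eq hx, sub_sub_cancel_left, abs_neg]
  refine (Finset.abs_sum_le_sum_abs _ _).trans ?_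
  calc _ ≤ ∑ m : Fin d → Fin (N + 1),
        gridHat N m x * (B * d ^ (s + 1) * (N : ℝ)⁻¹ ^ (s + 1)) := by
        refine Finset.sum_le_sum fun m _ => ?_
        rw [abs_mul, abs_of_nonneg (gridHat_nonneg m x)]
        by_cases h : gridHat N m x = 0
        · simp [h]
        · exact mul_le_mul_of_nonneg_left (hF.abs_remainder_le hB (gridNode_mem_cube hN m)
            (by positivity) hx (norm_sub_gridNode_le hN h)) (gridHat_nonneg m x)
    _ = _ := by rw [← Finset.sum_mul, sum_gridHat hx, one_mul]

/-- The blend of Taylor polynomials is nearly as continuous as the function itself, at any scale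
`r`: below the mesh size, the remainders are Lipschitz with a small constant; above it, they are
small compared with `r`. -/
lemma abs_blend_sub_blend_le (hB : 0 ≤ B) (hF : IsJet s B F) (hN : 0 < N) {x y : Fin d → ℝ}
    (hx : x ∈ cube d) (hy : y ∈ cube d) {r : ℝ} (hxy : ‖x - y‖ ≤ r) :
    |blend s N F x - blend s N F y| ≤
      |F 0 x - F 0 y| + B * d ^ (s + 1) * 2 ^ (d + s + 4) * (N : ℝ)⁻¹ ^ s * r := by
  have hN' : (0 : ℝ) < N := by exact_mod_cast hN
  have hr : 0 ≤ r := (norm_nonneg _).trans hxy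
  set A := B * (d : ℝ) ^ (s + 1) with hA
  have hA0 : 0 ≤ A := by positivity
  set h := (N : ℝ)⁻¹ with hh
  have h0 : 0 < h := inv_pos.2 hN'
  rcases le_total r h with hrh | hrh
  · -- the increments of the hat functions meet small remainders, and the increments of the
    -- remainders are small by themselves
    have hsplit : blend s N F x - blend s N F y = (F 0 x - F 0 y) -
        (∑ m : Fin d → Fin (N + 1), (gridHat N m x - gridHat N m y) *
          (F 0 y - taylorPoly s F (gridNode N m) y)) -
        ∑ m : Fin d → Fin (N + 1), gridHat N m x *
          ((F 0 x - taylorPoly s F (gridNode N m) x) -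
            (F 0 y - taylorPoly s F (gridNode N m) y)) := by
      rw [blend_eq hx, blend_eq hy]
      simp only [mul_sub, sub_mul, Finset.sum_sub_distrib]
      ring
    have h1 : |∑ m : Fin d → Fin (N + 1), (gridHat N m x - gridHat N m y) *
        (F 0 y - taylorPoly s F (gridNode N m) y)| ≤
        A * 2 ^ (d + s + 3) * h ^ s * r := by
      refine (Finset.abs_sum_le_sum_abs _ _).trans ?_
      calc _ ≤ ∑ m : Fin d → Fin (N + 1), |gridHat N m x - gridHat N m y| *
            (A * (2 * h) ^ (s + 1)) := by
            refine Finset.sum_le_sum fun m _ => ?_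
            rw [abs_mul]
            -- if one of the two points is within the mesh size of the node, then both are within
            -- twice the mesh size
            by_cases hm : gridHat N m x = 0 ∧ gridHat N m y = 0
            · simp [hm.1, hm.2]
            · refine mul_le_mul_of_nonneg_left ?_ (abs_nonneg _)
              refine hF.abs_remainder_le hB (gridNode_mem_cube hN m) (by positivity) hy ?_
              by_cases hm' : gridHat N m y = 0
              · have hmx := norm_sub_gridNode_le hN (fun hx0 => hm ⟨hx0, hm'⟩)
                have := norm_sub_le_norm_sub_add_norm_sub y x (gridNode N m)
                rw [norm_sub_rev y x] at this
                linarith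
              · linarith [norm_sub_gridNode_le hN hm']
        _ ≤ (2 ^ d * (4 * (N * r))) * (A * (2 * h) ^ (s + 1)) := by
            rw [← Finset.sum_mul]
            exact mul_le_mul_of_nonneg_right (sum_abs_gridHat_sub_le hxy) (by positivity)
        _ = (N * h) * (A * 2 ^ (d + s + 3) * h ^ s * r) := by
            rw [mul_pow]
            ring
        _ = _ := by rw [hh, mul_inv_cancel₀ hN'.ne', one_mul]
    have h2 : |∑ m : Fin d → Fin (N + 1), gridHat N m x *
          ((F 0 x - taylorPoly s F (gridNode N m) x) -
            (F 0 y - taylorPoly s F (gridNode N m) y))| ≤ A * (2 * h) ^ s * r := by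
      refine (Finset.abs_sum_le_sum_abs _ _).trans ?_
      calc _ ≤ ∑ m : Fin d → Fin (N + 1), gridHat N m x * (A * (2 * h) ^ s * r) := by
            refine Finset.sum_le_sum fun m _ => ?_
            rw [abs_mul, abs_of_nonneg (gridHat_nonneg m x)]
            by_cases hm : gridHat N m x = 0
            · simp [hm]
            · refine mul_le_mul_of_nonneg_left ?_ (gridHat_nonneg m x)
              have hmx := norm_sub_gridNode_le hN hm
              have h3 := norm_sub_le_norm_sub_add_norm_sub y x (gridNode N m)
              rw [norm_sub_rev y x] at h3
              refine (hF.abs_remainder_sub_le hB (gridNode_mem_cube hN m)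
                (r := 2 * h) (by positivity) hx hy (by linarith) (by linarith)).trans ?_
              exact mul_le_mul_of_nonneg_left hxy (by positivity)
        _ = _ := by rw [← Finset.sum_mul, sum_gridHat hx, one_mul]
    have h3 : A * 2 ^ (d + s + 3) * h ^ s * r + A * (2 * h) ^ s * r ≤
        A * 2 ^ (d + s + 4) * h ^ s * r := by
      have h4 : (2 : ℝ) ^ s ≤ 2 ^ (d + s + 3) :=
        pow_le_pow_right₀ (by norm_num) (by omega)
      have h5 : 0 ≤ A * h ^ s * r := by positivity
      rw [mul_pow, pow_succ 2 (d + s + 3)]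
      nlinarith [mul_le_mul_of_nonneg_left h4 h5]
    rw [hsplit]
    have h6 := abs_sub (F 0 x - F 0 y - ∑ m : Fin d → Fin (N + 1),
      (gridHat N m x - gridHat N m y) * (F 0 y - taylorPoly s F (gridNode N m) y))
      (∑ m : Fin d → Fin (N + 1), gridHat N m x *
          ((F 0 x - taylorPoly s F (gridNode N m) x) -
            (F 0 y - taylorPoly s F (gridNode N m) y)))
    have h7 := abs_sub (F 0 x - F 0 y) (∑ m : Fin d → Fin (N + 1),
      (gridHat N m x - gridHat N m y) * (F 0 y - taylorPoly s F (gridNode N m) y))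
    linarith
  · have h1 := abs_blend_sub_le hB hF hN hx
    have h2 := abs_blend_sub_le hB hF hN hy
    have h3 : |blend s N F x - blend s N F y| ≤
        |F 0 x - F 0 y| + (A * h ^ (s + 1) + A * h ^ (s + 1)) := by
      rw [show blend s N F x - blend s N F y = (F 0 x - F 0 y) +
        ((blend s N F x - F 0 x) - (blend s N F y - F 0 y)) by ring]
      refine (abs_add_le _ _).trans (add_le_add_right ((abs_sub _ _).trans (add_le_add h1 h2)) _)
    have h4 : A * h ^ (s + 1) ≤ A * h ^ s * r := by
      rw [pow_succ, ← mul_assoc]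
      exact mul_le_mul_of_nonneg_left hrh (by positivity)
    have h5 : (2 : ℝ) ≤ 2 ^ (d + s + 4) := by
      calc (2 : ℝ) = 2 ^ 1 := by norm_num
        _ ≤ _ := pow_le_pow_right₀ (by norm_num) (by omega)
    have h6 : 0 ≤ A * h ^ s * r := by positivity
    nlinarith [mul_le_mul_of_nonneg_left h5 h6]

lemma blend_eq_sum_monomials (x : Fin d → ℝ) :
    blend s N F x = ∑ j : Fin d → Fin (s + 1),
      (∑ m : Fin d → Fin (N + 1), taylorCoeff s F (gridNode N m) j * gridHat N m x) *
        ∏ i, x i ^ (j i : ℕ) := by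
  simp only [blend, taylorPoly_eq_sum_taylorCoeff, Finset.mul_sum, Finset.sum_mul]
  rw [Finset.sum_comm]
  exact Finset.sum_congr rfl fun j _ => Finset.sum_congr rfl fun m _ => by ring

end Blend

/-! ### The network that approximates the regression function -/

section Approximator

variable {d : ℕ}

/-- A network can be taken to have constant width and at least two hidden layers. -/
lemma IsNet.exists_const {ι : Type} [Fintype ι] {F : (ι → ℝ) → ℝ} (hF : IsNet F) :
    ∃ W L P : ℕ, 1 ≤ L ∧ Computes (fun _ => W) L P F := by
  obtain ⟨w, L, P, h⟩ := hF
  refine ⟨∑ ℓ ∈ Finset.range (L + 2), padWidth L w ℓ, L + 1, _, by omega,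
    (h.pad (Nat.le_succ L)).mono (fun ℓ hℓ => ?_) le_rfl⟩
  exact Finset.single_le_sum (f := padWidth L w) (fun _ _ => Nat.zero_le _)
    (Finset.mem_range.2 (by omega))

/-- The polynomial that maps the coordinates and the local Taylor coefficients to the value of
`blend`. -/
def blendPoly (d s : ℕ) (y : Fin d ⊕ (Fin d → Fin (s + 1)) → ℝ) : ℝ :=
  ∑ j : Fin d → Fin (s + 1), y (Sum.inr j) * ∏ i, y (Sum.inl i) ^ (j i : ℕ)

lemma deepApprox_blendPoly (d s : ℕ) (R : ℝ) :
    DeepApprox {y | (∀ i, |y (Sum.inl i)| ≤ 1) ∧ ∀ j, |y (Sum.inr j)| ≤ R} (blendPoly d s) := by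
  refine (DeepApprox.sum (f := fun (j : Fin d → Fin (s + 1))
    (y : Fin d ⊕ (Fin d → Fin (s + 1)) → ℝ) => y (Sum.inr j) * ∏ i, y (Sum.inl i) ^ (j i : ℕ))
    (fun j => ?_) (fun _ => 1)).congr fun y _ => by simp [blendPoly]
  exact (deepApprox_coord _ fun y hy => hy.2 j).mul
    (DeepApprox.prod fun i => (deepApprox_coord _ fun y hy => hy.1 i).pow _)

/-- The coordinates, and the coefficients of the polynomials that `blend` glues, averaged with the
weights of the partition of unity. -/
def blendFeatures (s N : ℕ) (F : (Fin d → ℕ) → (Fin d → ℝ) → ℝ) :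
    Fin d ⊕ (Fin d → Fin (s + 1)) → (Fin d → ℝ) → ℝ
  | Sum.inl i, x => x i
  | Sum.inr j, x => ∑ m : Fin d → Fin (N + 1), taylorCoeff s F (gridNode N m) j * gridHat N m x

lemma blend_eq_blendPoly (s N : ℕ) (F : (Fin d → ℕ) → (Fin d → ℝ) → ℝ) (x : Fin d → ℝ) :
    blend s N F x = blendPoly d s (fun t => blendFeatures s N F t x) :=
  blend_eq_sum_monomials x

lemma blendFeatures_mem {s N : ℕ} {F : (Fin d → ℕ) → (Fin d → ℝ) → ℝ} {B : ℝ} (hN : 0 < N)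
    (hF : ∀ k, ∑ i, k i ≤ s → ∀ x ∈ cube d, |F k x| ≤ B) {x : Fin d → ℝ} (hx : x ∈ cube d) :
    (fun t => blendFeatures s N F t x) ∈ {y : Fin d ⊕ (Fin d → Fin (s + 1)) → ℝ |
      (∀ i, |y (Sum.inl i)| ≤ 1) ∧ ∀ j, |y (Sum.inr j)| ≤ (multiIndices d s).card * B} := by
  refine ⟨fun i => ?_, fun j => ?_⟩
  · have := mem_cube_iff.1 hx i
    simpa [blendFeatures, abs_of_nonneg this.1] using this.2
  · refine (Finset.abs_sum_le_sum_abs _ _).trans ?_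
    calc _ ≤ ∑ m : Fin d → Fin (N + 1), (multiIndices d s).card * B * gridHat N m x := by
          refine Finset.sum_le_sum fun m _ => ?_
          rw [abs_mul, abs_of_nonneg (gridHat_nonneg m x)]
          exact mul_le_mul_of_nonneg_right (abs_taylorCoeff_le (gridNode_mem_cube hN m)
            (fun k hk => hF k hk _ (gridNode_mem_cube hN m)) j) (gridHat_nonneg m x)
      _ = _ := by rw [← Finset.mul_sum, sum_gridHat hx, mul_one]

lemma computes_coord (L : ℕ) (i : Fin d) :
    Computes (fun _ => 2) L (fullCount d (fun _ => 2) L) (fun x : Fin d → ℝ => x i) := by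
  have h := (computes_id L).precomp
    (Matrix.of fun _ : Unit => Pi.single (M := fun _ : Fin d => ℝ) i 1) 0
  rw [Fintype.card_fin] at h
  simpa [Matrix.mulVec] using h

/-- The features are computed by networks with `O((N + 1)^d)` parameters. -/
lemma exists_computes_blendFeatures (d s : ℕ) :
    ∃ W L P : ℕ, 1 ≤ L ∧ ∀ (N : ℕ) (F : (Fin d → ℕ) → (Fin d → ℝ) → ℝ) t,
      Computes (fun _ => W * (N + 1) ^ d) L (P * (N + 1) ^ d) (blendFeatures s N F t) := by
  obtain ⟨W, L, _, hL, hhat⟩ := (isNet_kuhnHat (ι := Fin d)).exists_const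
  refine ⟨W + 2, L, fullCount d (fun _ => W) L + fullCount d (fun _ => 2) L, hL, ?_⟩
  rintro N F (i | j)
  · have hQ : 1 ≤ (N + 1) ^ d := Nat.one_le_pow _ _ (Nat.succ_pos N)
    refine (computes_coord L i).mono (fun _ _ => ?_) ?_
    · nlinarith
    · exact (Nat.le_add_left _ _).trans (Nat.le_mul_of_pos_right _ hQ)
  · have hnode : ∀ m : Fin d → Fin (N + 1),
        Computes (fun _ => W) L (fullCount d (fun _ => W) L) (gridHat N m) := by
      intro m
      have h := hhat.precomp ((N : ℝ) • (1 : Matrix (Fin d) (Fin d) ℝ)) (-gridPoint m)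
      rw [Fintype.card_fin] at h
      convert h using 2 with x
      simp [gridHat, sub_eq_add_neg, Matrix.smul_mulVec]
    refine (Computes.sum hnode fun m => taylorCoeff s F (gridNode N m) j).mono
      (fun _ _ => ?_) ?_
    · simp only [Finset.sum_const, Finset.card_univ, Fintype.card_pi, Finset.prod_const,
        Fintype.card_fin, smul_eq_mul]
      rw [mul_comm]
      exact Nat.mul_le_mul_right _ (by omega)
    · simp only [Finset.sum_const, Finset.card_univ, Fintype.card_pi, Finset.prod_const,
        Fintype.card_fin, smul_eq_mul]
      rw [mul_comm]
      exact Nat.mul_le_mul_right _ (by omega)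

/-- With a grid of mesh size `1 / N` and depth `O(m)`, a network computes `blend` up to an error
`O(2⁻ᵐ)`. -/
lemma exists_computes_blend (d s : ℕ) {B : ℝ} :
    ∃ (K : ℕ) (C : ℝ), 0 < C ∧ ∀ (N m : ℕ) (F : (Fin d → ℕ) → (Fin d → ℝ) → ℝ), 0 < N →
      (∀ k, ∑ i, k i ≤ s → ∀ x ∈ cube d, |F k x| ≤ B) →
      ∃ (L P : ℕ) (g : (Fin d → ℝ) → ℝ), 2 ≤ L ∧ L ≤ K * (m + 1) ∧
        P ≤ K * ((N + 1) ^ d + (m + 1)) ∧ Computes (fun _ => K * (N + 1) ^ d) L P g ∧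
        ∀ x ∈ cube d, |g x - blend s N F x| ≤ C / 2 ^ m := by
  obtain ⟨W₁, L₁, P₁, hL₁, hfeat⟩ := exists_computes_blendFeatures d s
  obtain ⟨W₂, K₂, C, hC, -, hpoly⟩ := deepApprox_blendPoly d s ((multiIndices d s).card * B)
  -- the number of features
  set T := Fintype.card (Fin d ⊕ (Fin d → Fin (s + 1)))
  set k₁ := L₁ + 1 + K₂ with hk₁
  set k₂ := T * W₁ + W₂ with hk₂
  set k₃ := T * P₁ + W₂ * (T * W₁ + 1) with hk₃
  set k₄ := W₂ * (T + W₂ + 1) * (K₂ + 1) with hk₄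
  refine ⟨k₁ + k₂ + k₃ + k₄, C + 1, by positivity, fun N m F hN hF => ?_⟩
  set Q := (N + 1) ^ d with hQ
  have hQ1 : 1 ≤ Q := Nat.one_le_pow _ _ (Nat.succ_pos N)
  obtain ⟨L₂, hL₂, g, P₂, hg, happ⟩ := hpoly m
  have hcomp := Computes.comp (fun t => hfeat N F t) hg.fullCount
  simp only [Finset.sum_const, Finset.card_univ, smul_eq_mul] at hcomp
  refine ⟨L₁ + 1 + L₂, _, _, by omega, ?_, ?_, hcomp.mono (fun ℓ _ => ?_) le_rfl, fun x hx => ?_⟩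
  · calc L₁ + 1 + L₂ ≤ (L₁ + 1) * (m + 1) + K₂ * (m + 1) :=
          Nat.add_le_add (Nat.le_mul_of_pos_right _ (Nat.succ_pos m)) hL₂
      _ = k₁ * (m + 1) := by rw [hk₁]; ring
      _ ≤ _ := Nat.mul_le_mul_right _ (by omega)
  · have h1 : T * (P₁ * Q) + W₂ * (T * (W₁ * Q) + 1) ≤ k₃ * Q := by
      calc _ ≤ T * (P₁ * Q) + W₂ * (T * (W₁ * Q) + 1 * Q) := by gcongr; simpa using hQ1
        _ = k₃ * Q := by rw [hk₃]; ring
    have h2 : fullCount T (fun _ => W₂) L₂ ≤ k₄ * (m + 1) := by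
      refine (fullCount_const_le T W₂ L₂).trans ?_
      rw [hk₄, mul_assoc _ (K₂ + 1)]
      refine Nat.mul_le_mul_left _ ?_
      calc L₂ + 1 ≤ K₂ * (m + 1) + 1 * (m + 1) := Nat.add_le_add hL₂ (by omega)
        _ = (K₂ + 1) * (m + 1) := by ring
    calc _ ≤ k₃ * Q + k₄ * (m + 1) := Nat.add_le_add h1 h2
      _ ≤ (k₁ + k₂ + k₃ + k₄) * Q + (k₁ + k₂ + k₃ + k₄) * (m + 1) := Nat.add_le_add
          (Nat.mul_le_mul_right _ (by omega)) (Nat.mul_le_mul_right _ (by omega))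
      _ = _ := by ring
  · have h1 : k₂ * Q ≤ (k₁ + k₂ + k₃ + k₄) * Q := Nat.mul_le_mul_right _ (by omega)
    have h2 : k₂ * Q = Fintype.card (Fin d ⊕ (Fin d → Fin (s + 1))) * (W₁ * (N + 1) ^ d) +
        W₂ * Q := by rw [hk₂, add_mul, mul_assoc]
    have h3 : W₂ ≤ W₂ * Q := Nat.le_mul_of_pos_right _ hQ1
    refine le_trans ?_ h1
    simp only [glueWidth]
    split_ifs <;> omega
  · rw [blend_eq_blendPoly]
    refine (happ _ (blendFeatures_mem hN hF hx)).trans ?_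
    gcongr
    linarith

lemma one_le_log_one_div {δ : ℝ} (hδ : 0 < δ) (hδ3 : δ < 1 / 3) : 1 ≤ Real.log (1 / δ) := by
  rw [Real.le_log_iff_exp_le (by positivity)]
  refine Real.exp_one_lt_d9.le.trans ?_
  rw [le_div_iff₀ hδ]
  nlinarith

/-- A mesh size `1 / N` of order `δ^{1/(2s)}`, so that remainders of order `N⁻ˢ` are at most
`√δ`. -/
lemma exists_mesh (d : ℕ) {s : ℕ} (hs : 1 ≤ s) {A δ : ℝ} (hA1 : 1 ≤ A) (hδ : 0 < δ)
    (hδ1 : δ ≤ 1) :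
    ∃ N : ℕ, 0 < N ∧ A * (N : ℝ)⁻¹ ^ s ≤ Real.sqrt δ ∧
      ((N : ℝ) + 1) ^ d ≤ (3 * A) ^ d * δ ^ (-(d : ℝ) / (2 * s)) := by
  have hs0 : (0 : ℝ) < s := by exact_mod_cast hs
  set t := δ ^ (-(1 : ℝ) / (2 * s)) with ht
  have ht1 : 1 ≤ t := by
    refine Real.one_le_rpow_of_pos_of_le_one_of_nonpos hδ hδ1 ?_
    exact div_nonpos_of_nonpos_of_nonneg (by norm_num) (by positivity)
  have hN1 : A * t ≤ ⌈A * t⌉₊ := Nat.le_ceil _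
  have hN2 : (⌈A * t⌉₊ : ℝ) + 1 ≤ 3 * A * t := by
    have := (Nat.ceil_lt_add_one (show 0 ≤ A * t by positivity)).le
    nlinarith
  refine ⟨⌈A * t⌉₊, Nat.ceil_pos.2 (by positivity), ?_, ?_⟩
  · have h1 : (⌈A * t⌉₊ : ℝ)⁻¹ ^ s ≤ (A * t)⁻¹ ^ s :=
      pow_le_pow_left₀ (by positivity) (inv_anti₀ (by positivity) hN1) s
    have h2 : (t⁻¹) ^ s = Real.sqrt δ := by
      rw [ht, ← Real.rpow_neg hδ.le, ← Real.rpow_natCast, ← Real.rpow_mul hδ.le,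
        Real.sqrt_eq_rpow]
      congr 1
      field_simp
    have h3 : A⁻¹ ^ s ≤ A⁻¹ := pow_le_of_le_one (by positivity) (inv_le_one_of_one_le₀ hA1)
      (by omega)
    calc A * (⌈A * t⌉₊ : ℝ)⁻¹ ^ s ≤ A * (A⁻¹ * Real.sqrt δ) := by
          refine mul_le_mul_of_nonneg_left (h1.trans ?_) (by positivity)
          rw [mul_inv, mul_pow, h2]
          exact mul_le_mul_of_nonneg_right h3 (Real.sqrt_nonneg δ)
      _ = _ := by rw [← mul_assoc, mul_inv_cancel₀ (by positivity), one_mul]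
  · refine (pow_le_pow_left₀ (by positivity) hN2 d).trans (le_of_eq ?_)
    rw [mul_pow, ht, ← Real.rpow_natCast (δ ^ _), ← Real.rpow_mul hδ.le]
    congr 2
    ring

/-- A number `m = O(log (1 / δ))` of refinements of the square that makes the error `O(2⁻ᵐ)` at most
`δ`. -/
lemma exists_precision {C δ : ℝ} (hC : 0 < C) (hδ : 0 < δ) (hlog : 1 ≤ Real.log (1 / δ)) :
    ∃ m : ℕ, C / 2 ^ m ≤ δ ∧ (m : ℝ) + 1 ≤ (2 * Real.log (C + 1) + 4) * Real.log (1 / δ) := by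
  have hlogC : Real.log ((C + 1) / δ) = Real.log (C + 1) + Real.log (1 / δ) := by
    rw [← Real.log_mul (by positivity) (by positivity), mul_one_div]
  have hlogC0 : 0 ≤ Real.log (C + 1) := Real.log_nonneg (by linarith)
  refine ⟨⌈2 * Real.log ((C + 1) / δ)⌉₊, ?_, ?_⟩
  · have h1 : (C + 1) / δ ≤ 2 ^ ⌈2 * Real.log ((C + 1) / δ)⌉₊ := by
      rw [← Real.log_le_log_iff (by positivity) (by positivity), Real.log_pow]
      have h2 : 2 * Real.log ((C + 1) / δ) ≤ ⌈2 * Real.log ((C + 1) / δ)⌉₊ := Nat.le_ceil _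
      have h3 : (1 / 2 : ℝ) ≤ Real.log 2 := by linarith [Real.log_two_gt_d9]
      nlinarith [Nat.cast_nonneg (α := ℝ) ⌈2 * Real.log ((C + 1) / δ)⌉₊]
    rw [div_le_iff₀ hδ] at h1
    rw [div_le_iff₀ (by positivity)]
    linarith
  · have := (Nat.ceil_lt_add_one (show 0 ≤ 2 * Real.log ((C + 1) / δ) by
      rw [hlogC]; positivity)).le
    nlinarith

/-- The approximating network: it is close to `f` only up to `O(√δ)`, but at distance `δ` its
values differ by `O(δ)`, with a constant that does not depend on the dimension. -/
theorem exists_approximator (d : ℕ) {α : ℕ} (hα : 2 ≤ α) {B : ℝ} (hB : 0 ≤ B) :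
    ∃ K : ℝ, 0 ≤ K ∧ ∀ (δ : ℝ) (f : (Fin d → ℝ) → ℝ), 0 < δ → δ < 1 / 3 → InHolderBall α B f →
      ∃ (L W P : ℕ) (g : (Fin d → ℝ) → ℝ), 2 ≤ L ∧ (L : ℝ) ≤ K * Real.log (1 / δ) ∧
        (W : ℝ) ≤ K * complexity d α δ ∧ (P : ℝ) ≤ K * complexity d α δ ∧
        Computes (fun _ => W) L P g ∧ (∀ x ∈ cube d, |g x - f x| ≤ 2 * Real.sqrt δ) ∧
        ∀ x ∈ cube d, ∀ y ∈ cube d, ‖x - y‖ ≤ δ → |g x - g y| ≤ (B + 3) * δ := by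
  obtain ⟨s, rfl⟩ : ∃ s, α = s + 1 := ⟨α - 1, by omega⟩
  have hs1 : 1 ≤ s := by omega
  obtain ⟨K, C, hC, hnet⟩ := exists_computes_blend d s (B := B)
  obtain ⟨D, hD⟩ : ∃ D, D = B * (d : ℝ) ^ (s + 1) := ⟨_, rfl⟩
  have hD0 : 0 ≤ D := by rw [hD]; positivity
  obtain ⟨T, hT⟩ : ∃ T : ℝ, T = 2 ^ (d + s + 4) := ⟨_, rfl⟩
  have hT1 : 1 ≤ T := by rw [hT]; exact one_le_pow₀ (by norm_num)
  set K₃ : ℝ := 2 * Real.log (C + 1) + 4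
  have hK₃ : 0 ≤ K₃ := by
    have : 0 ≤ Real.log (C + 1) := Real.log_nonneg (by linarith)
    positivity
  set A := D * T + 1
  have hA1 : 1 ≤ A := le_add_of_nonneg_left (by positivity)
  refine ⟨K * ((3 * A) ^ d + K₃), by positivity, fun δ f hδ hδ3 hf => ?_⟩
  have hlog := one_le_log_one_div hδ hδ3
  obtain ⟨N, hN0, hmesh, hgrid⟩ := exists_mesh d hs1 hA1 hδ (by linarith)
  obtain ⟨m, hm2, hm1⟩ := exists_precision hC hδ hlog
  have hα' : 2 * ((s + 1 : ℕ) : ℝ) - 2 = 2 * s := by push_cast; ring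
  have hX1 : 1 ≤ δ ^ (-(d : ℝ) / (2 * s)) :=
    Real.one_le_rpow_of_pos_of_le_one_of_nonpos hδ (by linarith)
      (div_nonpos_of_nonpos_of_nonneg (by simp) (by positivity))
  obtain ⟨X, hX⟩ : ∃ X, X = δ ^ (-(d : ℝ) / (2 * s)) := ⟨_, rfl⟩
  rw [← hX] at hX1 hgrid
  have hcompl : complexity d (s + 1) δ = X * Real.log (1 / δ) := by
    rw [complexity, hα', hX]
  have hjet : IsJet s B (fun k => mixedDeriv k f) := hf.isJet hB
  obtain ⟨L, P, g, hL2, hL, hP, hg, happ⟩ := hnet N m (fun k => mixedDeriv k f) hN0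
    fun k hk x hx => hf.abs_mixedDeriv_le hB (by omega) hx
  have hKQ : ((K * (N + 1) ^ d : ℕ) : ℝ) ≤ K * ((3 * A) ^ d * X) := by
    push_cast
    exact mul_le_mul_of_nonneg_left hgrid (by positivity)
  have hA3 : 0 ≤ (3 * A) ^ d := by positivity
  refine ⟨L, K * (N + 1) ^ d, P, g, hL2, ?_, ?_, ?_, hg, fun x hx => ?_, fun x hx y hy hxy => ?_⟩
  · have h1 : (L : ℝ) ≤ K * (m + 1) := by exact_mod_cast hL
    refine h1.trans ?_
    rw [mul_assoc]
    refine mul_le_mul_of_nonneg_left (hm1.trans ?_) (by positivity)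
    nlinarith
  · refine hKQ.trans ?_
    rw [mul_assoc]
    refine mul_le_mul_of_nonneg_left ?_ (by positivity)
    rw [hcompl]
    calc (3 * A) ^ d * X ≤ ((3 * A) ^ d + K₃) * (X * 1) := by nlinarith
      _ ≤ _ := by gcongr
  · have h1 : (P : ℝ) ≤ K * (((N : ℝ) + 1) ^ d + (m + 1)) := by exact_mod_cast hP
    refine h1.trans ?_
    rw [mul_assoc]
    refine mul_le_mul_of_nonneg_left ?_ (by positivity)
    rw [hcompl]
    have h2 : (3 * A) ^ d * X ≤ (3 * A) ^ d * (X * Real.log (1 / δ)) := by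
      gcongr
      exact le_mul_of_one_le_right (by linarith) hlog
    have h3 : K₃ * Real.log (1 / δ) ≤ K₃ * (X * Real.log (1 / δ)) := by
      gcongr
      exact le_mul_of_one_le_left (by linarith) hX1
    rw [add_mul]
    exact add_le_add (hgrid.trans h2) (hm1.trans h3)
  · have h1 := abs_blend_sub_le hB hjet hN0 hx
    rw [mixedDeriv_zero, ← hD] at h1
    have h2 : D * (N : ℝ)⁻¹ ^ (s + 1) ≤ Real.sqrt δ := by
      refine le_trans (mul_le_mul (show D ≤ A by nlinarith) ?_ (by positivity) (by positivity))
        hmesh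
      exact pow_le_pow_of_le_one (by positivity) (inv_le_one_of_one_le₀ (by exact_mod_cast hN0))
        (Nat.le_succ s)
    have h4 : δ ≤ Real.sqrt δ := Real.le_sqrt_of_sq_le (by nlinarith)
    have h5 := abs_sub_le (g x) (blend s N (fun k => mixedDeriv k f) x) (f x)
    linarith [happ x hx]
  · have h1 := abs_blend_sub_blend_le hB hjet hN0 hx hy hxy
    rw [mixedDeriv_zero, ← hD, ← hT] at h1
    have h2 : D * T * (N : ℝ)⁻¹ ^ s ≤ 1 := by
      have h3 : Real.sqrt δ ≤ 1 := Real.sqrt_le_one.2 (by linarith)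
      exact le_trans (mul_le_mul_of_nonneg_right (le_add_of_nonneg_right zero_le_one)
        (by positivity)) (hmesh.trans h3)
    have h3 : |f x - f y| ≤ B * δ :=
      (hf.abs_sub_le hα hB hx hy).trans (mul_le_mul_of_nonneg_left hxy hB)
    have h4 := mul_le_mul_of_nonneg_right h2 hδ.le
    have h6 := abs_sub_le (g x) (blend s N (fun k => mixedDeriv k f) x) (g y)
    have h7 := abs_sub_le (blend s N (fun k => mixedDeriv k f) x)
      (blend s N (fun k => mixedDeriv k f) y) (g y)
    rw [abs_sub_comm (blend s N (fun k => mixedDeriv k f) y) (g y)] at h7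
    linarith [happ x hx, happ y hy]

end Approximator

/-! ### Interpolating estimators -/

section Estimator

variable {d n : ℕ}

/-- A function that is `1` on the ball of radius `δ` around `c` and `0` outside of the ball of
radius `δ + η`. -/
def bump (δ η : ℝ) (c x : Fin d → ℝ) : ℝ :=
  max (1 - ∑ j, (max ((x j - c j - δ) / η) 0 + max ((c j - x j - δ) / η) 0)) 0

/-- The sum of the bumps around the sample points. -/
def bumpSum (δ η : ℝ) (D : Sample d n) (x : Fin d → ℝ) : ℝ := ∑ i, bump δ η (D i).1 x

/-- The sum of the bumps around the sample points, weighted with the labels. -/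
def labelSum (δ η : ℝ) (D : Sample d n) (x : Fin d → ℝ) : ℝ := ∑ i, (D i).2 * bump δ η (D i).1 x

/-- The estimator: it is the label near a sample point and `g` away from the sample points. If
`|g| ≤ b`, then the terms with `g` cancel where `bumpSum` is `1`, and add up to `g` where `bumpSum`
is `0`. The term with the factor `a` vanishes in both cases; it makes the estimators for different
`a` different. -/
def estimator (δ η b a : ℝ) (g : (Fin d → ℝ) → ℝ) (D : Sample d n) (x : Fin d → ℝ) : ℝ :=
  labelSum δ η D x + (max (g x - b * bumpSum δ η D x) 0 - max (-g x - b * bumpSum δ η D x) 0) +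
    a * (max (bumpSum δ η D x) 0 - 2 * max (bumpSum δ η D x - 1 / 2) 0)

lemma bump_nonneg (δ η : ℝ) (c x : Fin d → ℝ) : 0 ≤ bump δ η c x := le_max_right _ _

lemma bump_le_one {δ η : ℝ} (c x : Fin d → ℝ) : bump δ η c x ≤ 1 :=
  max_le (sub_le_self _ (Finset.sum_nonneg fun _ _ =>
    add_nonneg (le_max_right _ _) (le_max_right _ _))) zero_le_one

lemma bump_eq_one {δ η : ℝ} (hη : 0 < η) {c x : Fin d → ℝ} (h : ‖x - c‖ ≤ δ) :
    bump δ η c x = 1 := by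
  unfold bump
  rw [Finset.sum_eq_zero, sub_zero, max_eq_left zero_le_one]
  intro j _
  obtain ⟨h1, h2⟩ := abs_le.1 ((norm_le_pi_norm (x - c) j).trans h)
  simp only [Pi.sub_apply] at h1 h2
  rw [max_eq_right (div_nonpos_of_nonpos_of_nonneg (by linarith) hη.le),
    max_eq_right (div_nonpos_of_nonpos_of_nonneg (by linarith) hη.le), add_zero]

lemma bump_eq_zero {δ η : ℝ} (hδ : 0 < δ) (hη : 0 < η) {c x : Fin d → ℝ} (h : δ + η ≤ ‖x - c‖) :
    bump δ η c x = 0 := by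
  obtain ⟨j, hj⟩ : ∃ j, δ + η ≤ |x j - c j| := by
    by_contra! hlt
    exact absurd h (not_le.2 ((pi_norm_lt_iff (by positivity)).2 fun j => hlt j))
  refine max_eq_right (sub_nonpos.2 ?_)
  refine le_trans ?_ (Finset.single_le_sum (fun j _ => add_nonneg
    (le_max_right ((x j - c j - δ) / η) 0) (le_max_right ((c j - x j - δ) / η) 0))
    (Finset.mem_univ j))
  rcases le_abs.1 hj with h1 | h1
  · refine le_trans ?_ ((le_max_left _ _).trans (le_add_of_nonneg_right (le_max_right _ _)))
    rw [le_div_iff₀ hη]; linarith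
  · refine le_trans ?_ ((le_max_left _ _).trans (le_add_of_nonneg_left (le_max_right _ _)))
    rw [le_div_iff₀ hη]; linarith

lemma continuous_estimator (δ η b a : ℝ) {g : (Fin d → ℝ) → ℝ} (hg : Continuous g)
    (D : Sample d n) : Continuous (estimator δ η b a g D) := by
  unfold estimator labelSum bumpSum bump
  fun_prop

lemma measurable_estimator (δ η b a : ℝ) (g : (Fin d → ℝ) → ℝ) (x : Fin d → ℝ) :
    Measurable fun D : Sample d n => estimator δ η b a g D x := by
  unfold estimator labelSum bumpSum bump
  fun_prop

/-! ### Values of the estimators -/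

lemma lt_norm_sub_of_lt_sepDist {D : Sample d n} {δ : ℝ} (h : δ < sepDist D / 3) {i j : Fin n}
    (hij : i ≠ j) : 6 * δ < ‖(D i).1 - (D j).1‖ := by
  have hbdd : BddBelow (Set.range fun p : {p : Fin n × Fin n // p.1 ≠ p.2} =>
      ‖(D p.1.1).1 - (D p.1.2).1‖) := ⟨0, by rintro _ ⟨p, rfl⟩; exact norm_nonneg _⟩
  have := ciInf_le hbdd ⟨(i, j), hij⟩
  unfold sepDist at h
  simp only at this
  linarith

variable {δ η b a : ℝ} {g : (Fin d → ℝ) → ℝ} {D : Sample d n}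

/-- The supports of the bumps around different sample points are disjoint. -/
lemma bump_eq_zero_of_ne (hδ : 0 < δ) (hη : 0 < η) (hηδ : η ≤ δ) (hD : δ < sepDist D / 3)
    {i j : Fin n} (hij : j ≠ i) {x : Fin d → ℝ} (hx : ‖x - (D i).1‖ < δ + η) :
    bump δ η (D j).1 x = 0 := by
  refine bump_eq_zero hδ hη ?_
  have h1 := lt_norm_sub_of_lt_sepDist hD hij
  have h2 := norm_sub_le_norm_sub_add_norm_sub (D j).1 x (D i).1
  rw [norm_sub_rev (D j).1 x] at h2
  linarith

lemma bumpSum_eq (hδ : 0 < δ) (hη : 0 < η) (hηδ : η ≤ δ) (hD : δ < sepDist D / 3)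
    {i : Fin n} {x : Fin d → ℝ} (hx : ‖x - (D i).1‖ < δ + η) :
    bumpSum δ η D x = bump δ η (D i).1 x :=
  Finset.sum_eq_single i (fun _ _ hji => bump_eq_zero_of_ne hδ hη hηδ hD hji hx) (by simp)

lemma labelSum_eq (hδ : 0 < δ) (hη : 0 < η) (hηδ : η ≤ δ) (hD : δ < sepDist D / 3)
    {i : Fin n} {x : Fin d → ℝ} (hx : ‖x - (D i).1‖ < δ + η) :
    labelSum δ η D x = (D i).2 * bump δ η (D i).1 x :=
  Finset.sum_eq_single i (fun _ _ hji => by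
    rw [bump_eq_zero_of_ne hδ hη hηδ hD hji hx, mul_zero]) (by simp)

lemma estimator_eq_label (hδ : 0 < δ) (hη : 0 < η) (hηδ : η ≤ δ) (hD : δ < sepDist D / 3)
    {i : Fin n} {x : Fin d → ℝ} (hx : ‖x - (D i).1‖ ≤ δ) (hg : |g x| ≤ b) :
    estimator δ η b a g D x = (D i).2 := by
  have hx' : ‖x - (D i).1‖ < δ + η := by linarith
  obtain ⟨h1, h2⟩ := abs_le.1 hg
  unfold estimator
  rw [labelSum_eq hδ hη hηδ hD hx', bumpSum_eq hδ hη hηδ hD hx', bump_eq_one hη hx,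
    max_eq_right (by linarith : g x - b * 1 ≤ 0), max_eq_right (by linarith : -g x - b * 1 ≤ 0)]
  norm_num

/-- Where all bumps vanish, the two rectified terms combine to `g = σ(g) - σ(-g)`. -/
lemma estimator_eq_of_far (hδ : 0 < δ) (hη : 0 < η) {x : Fin d → ℝ}
    (hx : ∀ i, δ + η ≤ ‖x - (D i).1‖) : estimator δ η b a g D x = g x := by
  have h1 : bumpSum δ η D x = 0 := Finset.sum_eq_zero fun i _ => bump_eq_zero hδ hη (hx i)
  have h2 : labelSum δ η D x = 0 := Finset.sum_eq_zero fun i _ => by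
    rw [bump_eq_zero hδ hη (hx i), mul_zero]
  unfold estimator
  rw [h1, h2]
  rcases le_total (g x) 0 with h | h
  · rw [max_eq_right (by linarith : g x - b * 0 ≤ 0),
      max_eq_left (by linarith : 0 ≤ -g x - b * 0)]
    norm_num
  · rw [max_eq_left (by linarith : 0 ≤ g x - b * 0),
      max_eq_right (by linarith : -g x - b * 0 ≤ 0)]
    norm_num

lemma abs_estimator_le (hδ : 0 < δ) (hη : 0 < η) (hηδ : η ≤ δ) (hD : δ < sepDist D / 3) {M : ℝ}
    (hM : 0 ≤ M) (hDM : ∀ i, |(D i).2| ≤ M) (ha0 : 0 ≤ a) (ha : a ≤ 1) {x : Fin d → ℝ}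
    (hg : |g x| ≤ b) : |estimator δ η b a g D x| ≤ M + b + 1 := by
  by_cases hfar : ∀ i, δ + η ≤ ‖x - (D i).1‖
  · rw [estimator_eq_of_far hδ hη hfar]
    linarith
  push Not at hfar
  obtain ⟨i, hi⟩ := hfar
  unfold estimator
  rw [labelSum_eq hδ hη hηδ hD hi, bumpSum_eq hδ hη hηδ hD hi]
  have h0 := bump_nonneg δ η (D i).1 x
  have h1 := bump_le_one (δ := δ) (η := η) (D i).1 x
  set t := bump δ η (D i).1 x
  have hb : 0 ≤ b * t := mul_nonneg ((abs_nonneg _).trans hg) h0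
  obtain ⟨hg1, hg2⟩ := abs_le.1 hg
  have e1 : |(D i).2 * t| ≤ M := by
    rw [abs_mul, abs_of_nonneg h0]
    exact (mul_le_of_le_one_right (abs_nonneg _) h1).trans (hDM i)
  have e2 : |max (g x - b * t) 0 - max (-g x - b * t) 0| ≤ b := by
    have h2 : max (g x - b * t) 0 ≤ b := max_le (by linarith) (by linarith)
    have h3 : max (-g x - b * t) 0 ≤ b := max_le (by linarith) (by linarith)
    have h4 := le_max_right (g x - b * t) 0
    have h5 := le_max_right (-g x - b * t) 0
    rw [abs_le]; constructor <;> linarith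
  have e3 : |a * (max t 0 - 2 * max (t - 1 / 2) 0)| ≤ 1 := by
    have h2 : |max t 0 - 2 * max (t - 1 / 2) 0| ≤ 1 := by
      rw [max_eq_left h0]
      have h3 : max (t - 1 / 2) 0 ≤ 1 / 2 := max_le (by linarith) (by norm_num)
      have h4 := le_max_right (t - 1 / 2) 0
      rw [abs_le]; constructor <;> linarith
    rw [abs_mul, abs_of_nonneg ha0]
    exact mul_le_one₀ ha (abs_nonneg _) h2
  have := abs_add_le ((D i).2 * t + (max (g x - b * t) 0 - max (-g x - b * t) 0))
    (a * (max t 0 - 2 * max (t - 1 / 2) 0))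
  have := abs_add_le ((D i).2 * t) (max (g x - b * t) 0 - max (-g x - b * t) 0)
  linarith

/-- At a point where the bump around a sample point is `1 / 2`, the estimators for different `a`
differ. -/
lemma exists_estimator_ne (hδ : 0 < δ) (hδ3 : δ < 1 / 3) (hη : 0 < η) (hηδ : η ≤ δ)
    (hD : δ < sepDist D / 3) (hd : 1 ≤ d) (hn : 1 ≤ n) (hDc : ∀ i, (D i).1 ∈ cube d) {a' : ℝ}
    (ha : a ≠ a') :
    ∃ x ∈ cube d, estimator δ η b a g D x ≠ estimator δ η b a' g D x := by
  obtain ⟨i⟩ : Nonempty (Fin n) := ⟨⟨0, hn⟩⟩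
  obtain ⟨k⟩ : Nonempty (Fin d) := ⟨⟨0, hd⟩⟩
  set c := (D i).1
  have hck := mem_cube_iff.1 (hDc i) k
  -- a coordinate is moved towards the center of the cube, in order to stay inside
  obtain ⟨t, ht, htc⟩ : ∃ t : ℝ, |t| = δ + η / 2 ∧ c k + t ∈ Set.Icc (0 : ℝ) 1 := by
    obtain ⟨h0, h1⟩ := hck
    rcases le_total (c k) (1 / 2) with h | h
    · exact ⟨δ + η / 2, abs_of_pos (by positivity), by linarith, by linarith⟩
    · exact ⟨-(δ + η / 2), by rw [abs_neg, abs_of_pos (by positivity)], by linarith, by linarith⟩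
  set x := Function.update c k (c k + t) with hx
  have hxk : ∀ j, j ≠ k → x j - c j = 0 := fun j hj => by simp [hx, hj]
  have hxk' : x k - c k = t := by simp [hx]
  have hnorm : ‖x - c‖ < δ + η := by
    refine (pi_norm_lt_iff (by positivity)).2 fun j => ?_
    by_cases hj : j = k
    · subst hj
      rw [Pi.sub_apply, hxk', Real.norm_eq_abs, ht]; linarith
    · rw [Pi.sub_apply, hxk j hj, norm_zero]; positivity
  have hbump : bump δ η c x = 1 / 2 := by
    unfold bump
    rw [Finset.sum_eq_single k]
    · rw [show c k - x k = -t by linarith, hxk']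
      have hhalf : (δ + η / 2 - δ) / η = 1 / 2 := by field_simp; ring
      rcases abs_cases t with ⟨h1, h2⟩ | ⟨h1, h2⟩
      · rw [h1] at ht
        rw [max_eq_right (div_nonpos_of_nonpos_of_nonneg (by linarith) hη.le : (-t - δ) / η ≤ 0),
          ht, hhalf]
        norm_num
      · rw [h1] at ht
        rw [max_eq_right (div_nonpos_of_nonpos_of_nonneg (by linarith) hη.le : (t - δ) / η ≤ 0),
          ht, hhalf]
        norm_num
    · intro j _ hj
      have h1 := hxk j hj
      have h2 : c j - x j = 0 := by linarith
      rw [h1, h2, zero_sub, max_eq_right (div_nonpos_of_nonpos_of_nonneg (by linarith) hη.le),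
        add_zero]
    · simp
  refine ⟨x, update_mem_cube (hDc i) k htc, fun h => ha ?_⟩
  unfold estimator at h
  rw [bumpSum_eq hδ hη hηδ hD hnorm, hbump] at h
  norm_num at h
  linarith

/-! ### Architecture of the estimators -/

lemma computes_relu_affine {α : Type} [Fintype α] (v : α → ℝ) (c : ℝ) :
    Computes (fun _ => 1) 0 (Fintype.card α + 1) (fun x : α → ℝ => max (∑ i, v i * x i + c) 0) := by
  have h := Computes.layer (Matrix.of fun (_ : Unit) i => v i) (fun _ => c) (fun _ => 1)
  simpa [reluLayer, Matrix.mulVec, dotProduct] using h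

lemma computes_bump (δ η : ℝ) (c : Fin d → ℝ) :
    Computes (fun _ => 2 * d + 1) 1 (fullCount d (fun _ => 2 * d + 1) 1) (bump δ η c) := by
  have h1 : ∀ t : Fin d ⊕ Fin d, Computes (fun _ => 1) 0 (d + 1)
      (Sum.elim (fun j (x : Fin d → ℝ) => max ((x j - c j - δ) / η) 0)
        (fun j (x : Fin d → ℝ) => max ((c j - x j - δ) / η) 0) t) := by
    rintro (j | j)
    · have h := computes_relu_affine (Pi.single j (1 / η)) ((-c j - δ) / η)
      rw [Fintype.card_fin] at h
      convert h using 3 with x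
      simp [Pi.single_apply]
      ring_nf
    · have h := computes_relu_affine (Pi.single j (-1 / η)) ((c j - δ) / η)
      rw [Fintype.card_fin] at h
      convert h using 3 with x
      simp [Pi.single_apply]
      ring_nf
  have h2 := Computes.comp h1 (computes_relu_affine (fun _ : Fin d ⊕ Fin d => (-1 : ℝ)) 1)
  have h3 := (h2.mono (w' := fun _ => 2 * d + 1) (fun ℓ _ => by
    simp only [glueWidth, Finset.sum_const, Finset.card_univ, Fintype.card_sum, Fintype.card_fin]
    split_ifs
    · simp; omega
    · simp) le_rfl).fullCount
  rw [Fintype.card_fin] at h3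
  convert h3 using 3 with x
  simp only [bump, Fintype.sum_sum_type, Sum.elim_inl, Sum.elim_inr, neg_mul, one_mul,
    Finset.sum_neg_distrib, Finset.sum_add_distrib]
  congr 1
  ring

/-- The last layer, applied to the values of `g`, of `labelSum` and of `bumpSum`. -/
lemma computes_outputLayer (b a : ℝ) :
    Computes (fun _ => 6) 0 24 (fun y : Fin 3 → ℝ => y 1 + (max (y 0 - b * y 2) 0 -
      max (-y 0 - b * y 2) 0) + a * (max (y 2) 0 - 2 * max (y 2 - 1 / 2) 0)) := by
  have h := Computes.layer
    (!![0, 1, 0; 0, -1, 0; 1, 0, -b; -1, 0, -b; 0, 0, 1; 0, 0, 1] : Matrix (Fin 6) (Fin 3) ℝ)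
    ![0, 0, 0, 0, 0, -1 / 2] ![1, -1, 1, -1, a, -2 * a]
  simp only [Fintype.card_fin] at h
  convert h using 2 with y
  -- `labelSum` may be negative, so it takes two neurons
  have key : y 1 = max (y 1) 0 - max (-y 1) 0 := by
    rcases le_total (y 1) 0 with h | h
    · rw [max_eq_right h, max_eq_left (by linarith)]; ring
    · rw [max_eq_left h, max_eq_right (by linarith)]; ring
  simp [Fin.sum_univ_succ, reluLayer, Matrix.mulVec, dotProduct]
  ring_nf at key ⊢
  linarith [key]

/-- The widths of the estimators: only the first two layers depend on the sample size. -/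
def estimatorWidth (d n L W : ℕ) (ℓ : ℕ) : ℕ :=
  if ℓ ≤ L then W + 2 * (if ℓ ≤ 1 then n * (2 * d + 1) else 2) else 6

lemma computes_estimator {L W P : ℕ} (hL : 2 ≤ L) (hg : Computes (fun _ => W) L P g) :
    Computes (estimatorWidth d n L W) (L + 1)
      (P + 2 * (n * fullCount d (fun _ => 2 * d + 1) 1 + 2 * (n * (2 * d + 1) + 1) + 6 * L) +
        6 * (W + 5) + 24) (estimator δ η b a g D) := by
  have hsum : ∀ y : Fin n → ℝ, Computes (padWidth 1 (fun _ => n * (2 * d + 1))) L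
      (n * fullCount d (fun _ => 2 * d + 1) 1 + 2 * (n * (2 * d + 1) + 1) + 6 * L)
      (fun x => ∑ i, y i * bump δ η (D i).1 x) := by
    intro y
    have h := (Computes.sum (fun i => computes_bump δ η (D i).1) y).pad (by omega : 1 ≤ L)
    simpa using h
  have hlast := Computes.comp (τ := Fin 3)
    (w := ![fun _ => W, padWidth 1 (fun _ => n * (2 * d + 1)),
      padWidth 1 (fun _ => n * (2 * d + 1))])
    (P := ![P, n * fullCount d (fun _ => 2 * d + 1) 1 + 2 * (n * (2 * d + 1) + 1) + 6 * L,
      n * fullCount d (fun _ => 2 * d + 1) 1 + 2 * (n * (2 * d + 1) + 1) + 6 * L])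
    (F := ![g, labelSum δ η D, bumpSum δ η D]) (fun t => by
      fin_cases t
      · exact hg
      · exact hsum fun i => (D i).2
      · have h := hsum fun _ => 1
        simp only [one_mul] at h
        exact h) (computes_outputLayer b a)
  have hpad : padWidth 1 (fun _ => n * (2 * d + 1)) L = 2 := if_neg (by omega)
  refine hlast.mono (fun ℓ _ => ?_) ?_
  · simp only [glueWidth, estimatorWidth, Fin.sum_univ_three, Matrix.cons_val_zero,
      Matrix.cons_val_one, Matrix.cons_val_two, Matrix.head_cons, Matrix.tail_cons]
    split_ifs with h1 h2
    · simp [padWidth, h2]; omega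
    · simp [padWidth, h2]
    · rfl
  · simp only [Fin.sum_univ_three, Matrix.cons_val_zero,
      Matrix.cons_val_one, Matrix.cons_val_two, Matrix.head_cons, Matrix.tail_cons, hpad]
    omega

end Estimator

/-! ### Measurability of the adversarial risk of the estimators -/

section Measurability

variable {d : ℕ}

/-- The points at distance exactly `δ > 0` from a set form a null set: at each of them, the set
misses balls of comparable size, so that it has no point of density one. -/
lemma volume_infDist_eq (A : Set (Fin d → ℝ)) {δ : ℝ} (hδ : 0 < δ) :
    volume {x | Metric.infDist x A = δ} = 0 := by
  set S := {x | Metric.infDist x A = δ}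
  have hS : MeasurableSet S := (measurableSet_singleton δ).preimage
    (Metric.continuous_infDist_pt A).measurable
  have hae := IsUnifLocDoublingMeasure.ae_tendsto_measure_inter_div (volume : Measure (Fin d → ℝ))
    S 2
  rw [ae_restrict_iff' hS] at hae
  refine measure_mono_null (fun x (hx : Metric.infDist x A = δ) => ?_) hae
  intro hlim
  have hA : (closure A).Nonempty := by
    rw [closure_nonempty_iff]
    by_contra h
    rw [Set.not_nonempty_iff_eq_empty] at h
    rw [h, Metric.infDist_empty] at hx
    exact hδ.ne hx
  obtain ⟨p, hp, hxp⟩ := isClosed_closure.exists_infDist_eq_dist hA x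
  rw [Metric.infDist_closure, hx] at hxp
  -- the ball of radius `r` whose center lies at distance `2 r` from `x` on the segment to the
  -- nearest point `p` consists of points at distance less than `δ` from `p`
  have h1 := hlim hx (ι := ℝ) (l := nhdsWithin 0 (Set.Ioi 0))
    (fun r => x + (2 * r / δ) • (p - x)) id Filter.tendsto_id (by
      filter_upwards [self_mem_nhdsWithin] with r hr
      have hr : 0 < r := hr
      rw [Metric.mem_closedBall, dist_self_add_right, norm_smul, ← dist_eq_norm, dist_comm p x,
        ← hxp, Real.norm_of_nonneg (by positivity)]
      exact le_of_eq (by simp only [id]; field_simp))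
  refine absurd (tendsto_nhds_unique h1 (tendsto_const_nhds.congr' ?_)) one_ne_zero
  filter_upwards [Ioo_mem_nhdsGT (half_pos hδ)] with r hr
  have hempty : S ∩ Metric.closedBall (x + (2 * r / δ) • (p - x)) r = ∅ := by
    refine Set.eq_empty_of_forall_notMem fun z ⟨hz, hzb⟩ => ?_
    have h2 : dist (x + (2 * r / δ) • (p - x)) p = δ - 2 * r := by
      rw [dist_eq_norm, show x + (2 * r / δ) • (p - x) - p = (1 - 2 * r / δ) • (x - p) by module,
        norm_smul, ← dist_eq_norm x p, ← hxp, Real.norm_of_nonneg]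
      · field_simp
      · rw [sub_nonneg, div_le_one hδ]; linarith [hr.2]
    have h3 := Metric.infDist_le_dist_of_mem (x := z) hp
    rw [Metric.infDist_closure, show Metric.infDist z A = δ from hz] at h3
    have h4 := dist_triangle z (x + (2 * r / δ) • (p - x)) p
    have h5 := Metric.mem_closedBall.1 hzb
    linarith [hr.1]
  rw [id, hempty, measure_empty, ENNReal.zero_div]

/-- For almost every `x`, the supremum of a continuous function over the points of a set `𝒳` in
the closed ball around `x` is approached by the points of a dense subset of `𝒳` in the open
ball. -/
lemma ae_exists_lt_of_dense {𝒳 Q : Set (Fin d → ℝ)} (hQ : 𝒳 ⊆ closure Q) {δ : ℝ} (hδ : 0 < δ)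
    {f : (Fin d → ℝ) → ℝ} (hf : Continuous f) :
    ∀ᵐ x : Fin d → ℝ, ∀ x' ∈ advBall 𝒳 δ x, ∀ t < f x', ∃ q ∈ Q, ‖q - x‖ < δ ∧ t < f q := by
  have hnull : ∀ᵐ x : Fin d → ℝ, ∀ s : ℚ,
      Metric.infDist x {x' | x' ∈ 𝒳 ∧ (s : ℝ) < f x'} ≠ δ :=
    ae_all_iff.2 fun s => by
      have := volume_infDist_eq {x' | x' ∈ 𝒳 ∧ (s : ℝ) < f x'} hδ
      rwa [ae_iff, show {a | ¬ Metric.infDist a {x' | x' ∈ 𝒳 ∧ (s : ℝ) < f x'} ≠ δ} =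
        {a | Metric.infDist a {x' | x' ∈ 𝒳 ∧ (s : ℝ) < f x'} = δ} by simp]
  filter_upwards [hnull] with x hx x' hx' t ht
  obtain ⟨s, hts, hs⟩ := exists_rat_btwn ht
  have hmem : x' ∈ {x' | x' ∈ 𝒳 ∧ (s : ℝ) < f x'} := ⟨hx'.1, hs⟩
  have hle : Metric.infDist x {x' | x' ∈ 𝒳 ∧ (s : ℝ) < f x'} ≤ δ :=
    (Metric.infDist_le_dist_of_mem hmem).trans (by
      rw [dist_comm, dist_eq_norm]; exact hx'.2)
  obtain ⟨z, hz, hzd⟩ := (Metric.infDist_lt_iff ⟨x', hmem⟩).1 (lt_of_le_of_ne hle (hx s))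
  have hopen : IsOpen (Metric.ball x δ ∩ f ⁻¹' Set.Ioi t) :=
    Metric.isOpen_ball.inter (isOpen_Ioi.preimage hf)
  obtain ⟨q, ⟨hqb, hqt⟩, hqQ⟩ := mem_closure_iff.1 (hQ hz.1) _ hopen
    ⟨Metric.mem_ball'.2 hzd, hts.trans hz.2⟩
  exact ⟨q, hqQ, by rw [← dist_eq_norm]; exact hqb, hqt⟩

/-- The adversarial loss with the supremum over the points of a set `Q` in the open ball. -/
def openLoss (Q : Set (Fin d → ℝ)) (δ : ℝ) (f : (Fin d → ℝ) → ℝ) (z : (Fin d → ℝ) × ℝ) : ENNReal :=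
  ⨆ q ∈ Q, if ‖q - z.1‖ < δ then ENNReal.ofReal ((f q - z.2) ^ 2) else 0

/-- For fixed `y`, the loss is large where `f` is large or where `-f` is large. -/
lemma ae_advLoss_eq_openLoss {𝒳 Q : Set (Fin d → ℝ)} (hQ𝒳 : Q ⊆ 𝒳) (hQ : 𝒳 ⊆ closure Q) {δ : ℝ}
    (hδ : 0 < δ) {f : (Fin d → ℝ) → ℝ} (hf : Continuous f) :
    ∀ᵐ x : Fin d → ℝ, ∀ y, advLoss 𝒳 δ f (x, y) = openLoss Q δ f (x, y) := by
  filter_upwards [ae_exists_lt_of_dense hQ hδ hf, ae_exists_lt_of_dense hQ hδ hf.neg]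
    with x h1 h2 y
  refine le_antisymm (iSup₂_le fun x' hx' => ?_) (iSup₂_le fun q hq => ?_)
  · refine le_of_forall_lt fun c hc => ?_
    lift c to NNReal using hc.ne_top
    rw [ENNReal.lt_ofReal_iff_toReal_lt ENNReal.coe_ne_top, ENNReal.coe_toReal] at hc
    simp only [Pi.neg_apply] at hc h2
    obtain ⟨q, hq, hqx, hqc⟩ : ∃ q ∈ Q, ‖q - x‖ < δ ∧ (c : ℝ) < (f q - y) ^ 2 := by
      have hc' := Real.sqrt_lt_sqrt c.coe_nonneg hc
      rw [Real.sqrt_sq_eq_abs] at hc'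
      rcases lt_abs.1 hc' with h | h
      · obtain ⟨q, hq, hqx, hqc⟩ := h1 x' hx' (y + √c) (by linarith)
        exact ⟨q, hq, hqx, (Real.sqrt_lt' (by linarith [Real.sqrt_nonneg (c : ℝ)])).1
          (by linarith)⟩
      · obtain ⟨q, hq, hqx, hqc⟩ := h2 x' hx' (√c - y) (by linarith)
        refine ⟨q, hq, hqx, ?_⟩
        rw [← neg_sq]
        exact (Real.sqrt_lt' (by linarith [Real.sqrt_nonneg (c : ℝ)])).1 (by linarith)
    refine lt_of_lt_of_le ?_ (le_iSup₂_of_le q hq le_rfl)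
    rw [if_pos hqx, ENNReal.lt_ofReal_iff_toReal_lt ENNReal.coe_ne_top, ENNReal.coe_toReal]
    exact hqc
  · split_ifs with h
    · exact le_iSup₂_of_le (f := fun x' (_ : x' ∈ advBall 𝒳 δ x) =>
        ENNReal.ofReal ((f x' - y) ^ 2)) q ⟨hQ𝒳 hq, h.le⟩ le_rfl
    · exact zero_le

/-- The adversarial risk of a measurable family of continuous functions is measurable. -/
lemma measurable_advRisk {Ω : Type*} [MeasurableSpace Ω] (𝒳 : Set (Fin d → ℝ)) {δ : ℝ} (hδ : 0 < δ)
    (ρ : Measure ((Fin d → ℝ) × ℝ)) [SFinite ρ] (hρ : ρ.fst ≪ volume)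
    {F : Ω → (Fin d → ℝ) → ℝ} (hF : ∀ ω, Continuous (F ω)) (hFm : ∀ x, Measurable fun ω => F ω x) :
    Measurable fun ω => advRisk 𝒳 δ ρ (F ω) := by
  obtain ⟨Q, hQ𝒳, hQc, hQ⟩ :=
    (TopologicalSpace.IsSeparable.of_separableSpace 𝒳).exists_countable_dense_subset
  have heq : (fun ω => advRisk 𝒳 δ ρ (F ω)) = fun ω => ∫⁻ z, openLoss Q δ (F ω) z ∂ρ := by
    funext ω
    refine lintegral_congr_ae ?_
    filter_upwards [ae_of_ae_map measurable_fst.aemeasurable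
      (hρ.ae_le (ae_advLoss_eq_openLoss hQ𝒳 hQ hδ (hF ω)))] with z hz using hz z.2
  rw [heq]
  refine Measurable.lintegral_prod_right' (f := fun p : Ω × ((Fin d → ℝ) × ℝ) =>
    openLoss Q δ (F p.1) p.2) ?_
  unfold openLoss
  refine Measurable.biSup Q hQc fun q _ => Measurable.ite ?_ ?_ measurable_const
  · exact measurableSet_lt (by fun_prop) measurable_const
  · have : Measurable fun p : Ω × ((Fin d → ℝ) × ℝ) => F p.1 q := (hFm q).comp measurable_fst
    exact ENNReal.measurable_ofReal.comp
      ((this.sub (measurable_snd.comp measurable_snd)).pow_const 2)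

end Measurability

/-! ### The identity `L¹ → L¹` and absolute continuity -/

section Risk

/-- The norm of the identity `L¹(μ) → L¹(ν)` bounds the density of `ν` with respect to `μ`. -/
lemma measure_le_idL1Norm_mul {E : Type*} [MeasurableSpace E] {μ ν : Measure E} [IsFiniteMeasure μ]
    (h : idL1Norm μ ν < ⊤) {s : Set E} (hs : MeasurableSet s) : ν s ≤ idL1Norm μ ν * μ s := by
  have key : ∀ c ∈ {c | ∀ g : E → ℝ, Measurable g → Integrable g μ →
      ∫⁻ x, ‖g x‖ₑ ∂ν ≤ c * ∫⁻ x, ‖g x‖ₑ ∂μ}, ν s ≤ c * μ s := by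
    intro c hc
    have h1 := hc (s.indicator 1) (measurable_one.indicator hs)
      ((integrable_const (1 : ℝ)).indicator hs)
    have h2 : ∀ x, ‖s.indicator (1 : E → ℝ) x‖ₑ = s.indicator 1 x := fun x => by
      by_cases hx : x ∈ s <;> simp [hx]
    simpa only [h2, lintegral_indicator_one hs] using h1
  obtain ⟨c, hc, -⟩ := sInf_lt_iff.1 h
  rcases eq_or_ne (μ s) 0 with h0 | h0
  · have := key c hc
    rw [h0, mul_zero] at this ⊢
    exact this
  · rw [← ENNReal.div_le_iff h0 (measure_ne_top μ s)]
    exact le_sInf fun c hc => (ENNReal.div_le_iff h0 (measure_ne_top μ s)).2 (key c hc)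

variable {d : ℕ} {𝒳 : Set (Fin d → ℝ)} {ρ : Measure ((Fin d → ℝ) × ℝ)}

lemma isFiniteMeasure_restrict_of_subset_cube (h𝒳 : 𝒳 ⊆ cube d) :
    IsFiniteMeasure ((volume : Measure (Fin d → ℝ)).restrict 𝒳) :=
  ⟨by rw [Measure.restrict_apply_univ]
      exact (measure_mono h𝒳).trans_lt isCompact_Icc.measure_lt_top⟩

lemma fst_le_normJ_mul (h𝒳 : 𝒳 ⊆ cube d) (hJ : normJ 𝒳 ρ < ⊤) {s : Set (Fin d → ℝ)}
    (hs : MeasurableSet s) : ρ.fst s ≤ normJ 𝒳 ρ * volume s :=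
  haveI := isFiniteMeasure_restrict_of_subset_cube h𝒳
  (measure_le_idL1Norm_mul hJ hs).trans (mul_le_mul_right (Measure.restrict_apply_le _ _) _)

lemma fst_absolutelyContinuous (h𝒳 : 𝒳 ⊆ cube d) (hJ : normJ 𝒳 ρ < ⊤) : ρ.fst ≪ volume :=
  Measure.AbsolutelyContinuous.mk fun s hs h0 => by
    have := fst_le_normJ_mul h𝒳 hJ hs
    rwa [h0, mul_zero, nonpos_iff_eq_zero] at this

/-! ### Bias and variance -/

/-- The decomposition of the mean square error of a constant into variance and squared bias. -/
lemma lintegral_sq_sub_eq {κ : Measure ℝ} [IsProbabilityMeasure κ] {M : ℝ}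
    (hκ : ∀ᵐ y ∂κ, |y| ≤ M) (c : ℝ) :
    ∫⁻ y, ENNReal.ofReal ((c - y) ^ 2) ∂κ =
      ∫⁻ y, ENNReal.ofReal ((∫ t, t ∂κ - y) ^ 2) ∂κ + ENNReal.ofReal ((c - ∫ t, t ∂κ) ^ 2) := by
  have hid : Integrable (fun y : ℝ => y) κ :=
    Integrable.of_bound measurable_id.aestronglyMeasurable M hκ
  have hsq : Integrable (fun y : ℝ => y ^ 2) κ :=
    Integrable.of_bound (measurable_id.pow_const 2).aestronglyMeasurable (M ^ 2) (by
      filter_upwards [hκ] with y hy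
      rw [norm_pow]
      exact pow_le_pow_left₀ (norm_nonneg y) hy 2)
  have hint : ∀ a : ℝ, Integrable (fun y => (a - y) ^ 2) κ := fun a => by
    have := ((integrable_const (a ^ 2)).sub (hid.const_mul (2 * a))).add hsq
    refine this.congr (.of_forall fun y => ?_)
    simp only [Pi.add_apply, Pi.sub_apply]
    ring
  have hval : ∀ a : ℝ,
      ∫ y, (a - y) ^ 2 ∂κ = a ^ 2 - 2 * a * ∫ t, t ∂κ + ∫ t, t ^ 2 ∂κ := fun a => by
    have h1 : ∀ y : ℝ, (a - y) ^ 2 = (a ^ 2 - 2 * a * y) + y ^ 2 := fun y => by ring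
    simp_rw [h1]
    have h2 : Integrable (fun y : ℝ => 2 * a * y) κ := hid.const_mul _
    have h3 : Integrable (fun y : ℝ => a ^ 2 - 2 * a * y) κ := (integrable_const _).sub h2
    rw [integral_add h3 hsq, integral_sub (integrable_const _) h2, integral_const_mul]
    simp
  have hof : ∀ a : ℝ, ∫⁻ y, ENNReal.ofReal ((a - y) ^ 2) ∂κ =
      ENNReal.ofReal (∫ y, (a - y) ^ 2 ∂κ) := fun a =>
    (ofReal_integral_eq_lintegral_ofReal (hint a) (.of_forall fun y => sq_nonneg _)).symm
  rw [hof, hof, ← ENNReal.ofReal_add (integral_nonneg fun y => sq_nonneg _) (sq_nonneg _),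
    hval, hval]
  congr 1
  ring

variable [IsProbabilityMeasure ρ] {M : ℝ}

lemma measurable_condMean : Measurable (condMean ρ) :=
  (measurable_id.stronglyMeasurable.integral_kernel (κ := ρ.condKernel)).measurable

/-- The irreducible error: the mean conditional variance of the label. -/
def noise (ρ : Measure ((Fin d → ℝ) × ℝ)) [IsFiniteMeasure ρ] : ENNReal :=
  ∫⁻ x, ∫⁻ y, ENNReal.ofReal ((condMean ρ x - y) ^ 2) ∂(ρ.condKernel x) ∂ρ.fst

lemma lintegral_sq_sub_eq_noise_add (hM : ∀ᵐ z ∂ρ, |z.2| ≤ M) {g : (Fin d → ℝ) → ℝ}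
    (hg : Measurable g) :
    ∫⁻ z, ENNReal.ofReal ((g z.1 - z.2) ^ 2) ∂ρ =
      noise ρ + ∫⁻ x, ENNReal.ofReal ((g x - condMean ρ x) ^ 2) ∂ρ.fst := by
  have hκ : ∀ᵐ x ∂ρ.fst, ∀ᵐ y ∂(ρ.condKernel x), |y| ≤ M := by
    rw [← ρ.disintegrate ρ.condKernel] at hM
    exact Measure.ae_ae_of_ae_compProd hM
  rw [← Measure.lintegral_condKernel (ρ := ρ) (f := fun z => ENNReal.ofReal ((g z.1 - z.2) ^ 2))
    (by fun_prop), noise, ← lintegral_add_right _ (by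
      have := measurable_condMean (ρ := ρ)
      fun_prop)]
  refine lintegral_congr_ae ?_
  filter_upwards [hκ] with x hx using lintegral_sq_sub_eq hx (g x)

lemma noise_le_optAdvRisk {δ : ℝ} (hδ : 0 ≤ δ) (hρ : ∀ᵐ z ∂ρ, z.1 ∈ 𝒳 ∧ |z.2| ≤ M) :
    noise ρ ≤ optAdvRisk 𝒳 δ ρ := by
  refine le_iInf₂ fun f hf => ?_
  calc noise ρ ≤ ∫⁻ z, ENNReal.ofReal ((f z.1 - z.2) ^ 2) ∂ρ := by
        rw [lintegral_sq_sub_eq_noise_add (hρ.mono fun z hz => hz.2) hf]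
        exact le_self_add
    _ ≤ advRisk 𝒳 δ ρ f := lintegral_mono_ae (by
        filter_upwards [hρ] with z hz
        exact le_iSup₂_of_le (f := fun x' (_ : x' ∈ advBall 𝒳 δ z.1) =>
          ENNReal.ofReal ((f x' - z.2) ^ 2)) z.1 ⟨hz.1, by simpa using hδ⟩ le_rfl)

/-- The excess risk of a bounded function `F` that agrees with `g` around the points outside of an
exceptional set, where `g` varies by at most `c` over the perturbation balls and is `e`-close to
the conditional mean. -/
lemma excessAdvRisk_le {δ b c e : ℝ} (hδ : 0 ≤ δ) (hρ : ∀ᵐ z ∂ρ, z.1 ∈ 𝒳 ∧ |z.2| ≤ M)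
    {F g : (Fin d → ℝ) → ℝ} (hg : Measurable g) {bad : Set (Fin d → ℝ)} (hbad : MeasurableSet bad)
    (hF : ∀ x ∈ 𝒳, |F x| ≤ M + b + 1)
    (hFg : ∀ x ∈ 𝒳, x ∉ bad → ∀ x' ∈ advBall 𝒳 δ x, F x' = g x')
    (hgb : ∀ x ∈ 𝒳, |g x| ≤ b) (hc : 0 ≤ c)
    (hgc : ∀ x ∈ 𝒳, ∀ x' ∈ advBall 𝒳 δ x, |g x' - g x| ≤ c)
    (hge : ∀ᵐ x ∂ρ.fst, |g x - condMean ρ x| ≤ e) :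
    excessAdvRisk 𝒳 δ ρ F ≤ ENNReal.ofReal ((2 * M + b + 1) ^ 2) * ρ.fst bad +
      ENNReal.ofReal (e ^ 2 + c * (2 * b + 2 * M)) := by
  have hloss : ∀ᵐ z ∂ρ, advLoss 𝒳 δ F z ≤
      ((Prod.fst ⁻¹' bad).indicator (fun _ => ENNReal.ofReal ((2 * M + b + 1) ^ 2)) z +
        ENNReal.ofReal ((g z.1 - z.2) ^ 2)) + ENNReal.ofReal (c * (2 * b + 2 * M)) := by
    filter_upwards [hρ] with z ⟨hz, hzM⟩
    refine iSup₂_le fun x' hx' => ?_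
    by_cases hb : z.1 ∈ bad
    · rw [Set.indicator_of_mem (by exact hb), add_assoc]
      refine le_add_right (ENNReal.ofReal_le_ofReal (sq_le_sq' ?_ ?_))
      all_goals
        have h1 := abs_le.1 (hF x' hx'.1)
        have h2 := abs_le.1 hzM
        linarith [h1.1, h1.2, h2.1, h2.2]
    · rw [Set.indicator_of_notMem (by exact hb), zero_add, hFg z.1 hz hb x' hx']
      rw [← ENNReal.ofReal_add (sq_nonneg _) (mul_nonneg hc (by
        have := (abs_nonneg _).trans (hgb z.1 hz)
        have := (abs_nonneg _).trans hzM
        positivity))]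
      refine ENNReal.ofReal_le_ofReal ?_
      have h1 : (g x' - z.2) ^ 2 = (g z.1 - z.2) ^ 2 +
          (g x' - g z.1) * ((g x' - z.2) + (g z.1 - z.2)) := by ring
      have h2 : |(g x' - z.2) + (g z.1 - z.2)| ≤ 2 * b + 2 * M := by
        have h3 := abs_le.1 (hgb x' hx'.1)
        have h4 := abs_le.1 (hgb z.1 hz)
        have h5 := abs_le.1 hzM
        rw [abs_le]
        constructor <;> linarith [h3.1, h3.2, h4.1, h4.2, h5.1, h5.2]
      rw [h1]
      refine add_le_add_right ((le_abs_self _).trans ?_) _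
      rw [abs_mul]
      exact mul_le_mul (hgc z.1 hz x' hx') h2 (abs_nonneg _) hc
  have hbias : ∫⁻ x, ENNReal.ofReal ((g x - condMean ρ x) ^ 2) ∂ρ.fst ≤ ENNReal.ofReal (e ^ 2) := by
    refine (lintegral_mono_ae (hge.mono fun x hx =>
      ENNReal.ofReal_le_ofReal (sq_le_sq.2 (hx.trans (le_abs_self e))))).trans ?_
    rw [lintegral_const, measure_univ, mul_one]
  have hrisk : advRisk 𝒳 δ ρ F ≤ (ENNReal.ofReal ((2 * M + b + 1) ^ 2) * ρ.fst bad +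
      (noise ρ + ENNReal.ofReal (e ^ 2))) + ENNReal.ofReal (c * (2 * b + 2 * M)) := by
    refine (lintegral_mono_ae hloss).trans ?_
    rw [lintegral_add_right _ measurable_const, lintegral_add_left (by
      exact measurable_const.indicator (measurable_fst hbad)),
      lintegral_indicator_const (measurable_fst hbad), lintegral_const, measure_univ, mul_one,
      lintegral_sq_sub_eq_noise_add (hρ.mono fun z hz => hz.2) hg, Measure.fst_apply hbad]
    gcongr
  have hnn : 0 ≤ c * (2 * b + 2 * M) := by
    obtain ⟨z, hz, hzM⟩ := hρ.exists
    have := (abs_nonneg _).trans (hgb z.1 hz)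
    have := (abs_nonneg _).trans hzM
    positivity
  rw [excessAdvRisk, tsub_le_iff_left]
  refine hrisk.trans ?_
  rw [ENNReal.ofReal_add (sq_nonneg e) hnn]
  calc _ = noise ρ + (ENNReal.ofReal ((2 * M + b + 1) ^ 2) * ρ.fst bad +
      (ENNReal.ofReal (e ^ 2) + ENNReal.ofReal (c * (2 * b + 2 * M)))) := by ring
    _ ≤ _ := add_le_add_left (noise_le_optAdvRisk hδ hρ) _

end Risk

/-! ### The excess risk of the estimators -/

section Excess

variable {d n : ℕ} {𝒳 : Set (Fin d → ℝ)} {ρ : Measure ((Fin d → ℝ) × ℝ)}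

/-- The factor in the bound of the excess risk. -/
def riskFactor (J B M : ℝ) : ℝ :=
  (2 * M + (B + 2) + 1) ^ 2 * J + (4 + (B + 3) * (2 * (B + 2) + 2 * M))

lemma riskFactor_nonneg {J B M : ℝ} (hJ : 0 ≤ J) (hB : 0 ≤ B) (hM : 0 ≤ M) :
    0 ≤ riskFactor J B M := by
  unfold riskFactor; positivity

lemma volume_iUnion_closedBall_le (D : Sample d n) {r : ℝ} (hr : 0 ≤ r) :
    volume (⋃ i, Metric.closedBall (D i).1 r) ≤ ENNReal.ofReal ((2 * r) ^ d * n) := by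
  refine (measure_iUnion_fintype_le _ _).trans (le_of_eq ?_)
  simp_rw [Real.volume_pi_closedBall _ hr, Fintype.card_fin]
  rw [Finset.sum_const, Finset.card_univ, Fintype.card_fin, nsmul_eq_mul, mul_comm,
    ENNReal.ofReal_mul (by positivity), ENNReal.ofReal_natCast]

/-- The exceptional set is the union of the balls of radius `(2 + C₀)δ` around the sample points:
around other points the estimator agrees with `g`. -/
lemma excessAdvRisk_estimator_le [IsProbabilityMeasure ρ] {B M δ C₀ a : ℝ}
    {fρ g : (Fin d → ℝ) → ℝ} {D : Sample d n} (hB : 0 ≤ B) (hM : 0 ≤ M)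
    (h𝒳 : 𝒳 ⊆ cube d) (hρ : ∀ᵐ z ∂ρ, z.1 ∈ 𝒳 ∧ |z.2| ≤ M) (hJ : normJ 𝒳 ρ < ⊤)
    (hmean : ∀ᵐ x ∂ρ.fst, condMean ρ x = fρ x) (hδ : 0 < δ)
    (hC₀ : 0 < C₀) (hC₀1 : C₀ ≤ 1) (ha0 : 0 ≤ a) (ha1 : a ≤ 1) (hg : Continuous g)
    (hgb : ∀ x ∈ cube d, |g x| ≤ B + 2) (hgf : ∀ x ∈ cube d, |g x - fρ x| ≤ 2 * √δ)
    (hgc : ∀ x ∈ cube d, ∀ y ∈ cube d, ‖x - y‖ ≤ δ → |g x - g y| ≤ (B + 3) * δ)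
    (hDM : ∀ i, |(D i).2| ≤ M) (hD : δ < sepDist D / 3) :
    excessAdvRisk 𝒳 δ ρ (estimator δ (C₀ * δ) (B + 2) a g D) ≤
      ENNReal.ofReal (riskFactor (normJ 𝒳 ρ).toReal B M *
        max δ (((4 + 2 * C₀) * δ) ^ d * n)) := by
  have hη : 0 < C₀ * δ := mul_pos hC₀ hδ
  have hηδ : C₀ * δ ≤ δ := mul_le_of_le_one_left hδ.le hC₀1
  set bad : Set (Fin d → ℝ) := ⋃ i, Metric.closedBall (D i).1 ((2 + C₀) * δ) with hbad
  have hbadm : MeasurableSet bad :=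
    MeasurableSet.iUnion fun i => Metric.isClosed_closedBall.measurableSet
  have h𝒳ae : ∀ᵐ x ∂ρ.fst, x ∈ cube d := by
    refine (ae_map_iff measurable_fst.aemeasurable (p := (· ∈ cube d)) measurableSet_Icc).2 ?_
    exact hρ.mono fun z hz => h𝒳 hz.1
  have h1 := excessAdvRisk_le (F := estimator δ (C₀ * δ) (B + 2) a g D) (b := B + 2)
    (c := (B + 3) * δ) (e := 2 * √δ) hδ.le hρ hg.measurable hbadm
    (fun x hx => abs_estimator_le hδ hη hηδ hD hM hDM ha0 ha1 (hgb x (h𝒳 hx)))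
    (fun x hx hxb x' hx' => estimator_eq_of_far hδ hη fun i => by
      have hi : (2 + C₀) * δ < ‖x - (D i).1‖ := by
        have : ¬ x ∈ Metric.closedBall (D i).1 ((2 + C₀) * δ) :=
          fun h => hxb (Set.mem_iUnion.2 ⟨i, h⟩)
        rwa [Metric.mem_closedBall, not_le, dist_eq_norm] at this
      have h2 := norm_sub_le_norm_sub_add_norm_sub x x' (D i).1
      have h3 := hx'.2
      rw [norm_sub_rev] at h3
      linarith)
    (fun x hx => hgb x (h𝒳 hx)) (by positivity)
    (fun x hx x' hx' => hgc x' (h𝒳 hx'.1) x (h𝒳 hx) hx'.2)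
    (by filter_upwards [hmean, h𝒳ae] with x hx hxc
        rw [hx]; exact hgf x hxc)
  refine h1.trans ?_
  set V : ℝ := ((4 + 2 * C₀) * δ) ^ d * n with hV
  have hV0 : 0 ≤ V := by positivity
  have hvol : ρ.fst bad ≤ ENNReal.ofReal ((normJ 𝒳 ρ).toReal * V) := by
    rw [ENNReal.ofReal_mul ENNReal.toReal_nonneg, ENNReal.ofReal_toReal hJ.ne]
    refine (fst_le_normJ_mul h𝒳 hJ hbadm).trans (mul_le_mul_right ?_ _)
    refine (volume_iUnion_closedBall_le D (by positivity)).trans (le_of_eq ?_)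
    rw [hV]
    ring_nf
  refine (add_le_add_left (mul_le_mul_right hvol _) _).trans ?_
  have hJ0 : 0 ≤ (normJ 𝒳 ρ).toReal := ENNReal.toReal_nonneg
  rw [← ENNReal.ofReal_mul (sq_nonneg _), ← ENNReal.ofReal_add (by positivity) (by positivity)]
  refine ENNReal.ofReal_le_ofReal ?_
  rw [mul_pow, Real.sq_sqrt hδ.le, riskFactor, add_mul (_ ^ 2 * _), mul_assoc (_ ^ 2)]
  refine add_le_add (by gcongr; exact le_max_right _ _) ?_
  calc 2 ^ 2 * δ + (B + 3) * δ * (2 * (B + 2) + 2 * M)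
      = (4 + (B + 3) * (2 * (B + 2) + 2 * M)) * δ := by ring
    _ ≤ _ := by gcongr; exact le_max_left _ _

end Excess

/-! ### Samples -/

section Samples

variable {d n : ℕ} {ρ : Measure ((Fin d → ℝ) × ℝ)} [IsProbabilityMeasure ρ]

lemma measurable_sepDist : Measurable (sepDist : Sample d n → ℝ) := by
  unfold sepDist
  refine Measurable.const_mul (Measurable.iInf fun p => ?_) _
  fun_prop

lemma ae_sampleLaw (δ : ℝ) {p : (Fin d → ℝ) × ℝ → Prop} (hp : ∀ᵐ z ∂ρ, p z) :
    ∀ᵐ D ∂(sampleLaw n ρ δ), (∀ i, p (D i)) ∧ δ < sepDist D / 3 := by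
  have h1 : ∀ᵐ D ∂(Measure.pi fun _ : Fin n => ρ), ∀ i, p (D i) :=
    ae_all_iff.2 fun i =>
      (Measure.tendsto_eval_ae_ae (μ := fun _ : Fin n => ρ) (i := i)).eventually hp
  have h2 : MeasurableSet {D : Sample d n | δ < sepDist D / 3} :=
    measurableSet_lt measurable_const (measurable_sepDist.div_const 3)
  have h3 : ∀ᵐ D ∂(sampleLaw n ρ δ), ∀ i, p (D i) :=
    ProbabilityTheory.cond_absolutelyContinuous.ae_le h1
  exact h3.and (ProbabilityTheory.ae_cond_mem h2)

/-- The conditional law is a probability measure or, if the condition has probability zero, the zero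
measure; in both cases its total mass is at most one. -/
lemma lintegral_sampleLaw_le (δ : ℝ) {p : (Fin d → ℝ) × ℝ → Prop} (hp : ∀ᵐ z ∂ρ, p z)
    {F : Sample d n → ENNReal} {c : ENNReal}
    (h : ∀ D, (∀ i, p (D i)) → δ < sepDist D / 3 → F D ≤ c) :
    ∫⁻ D, F D ∂(sampleLaw n ρ δ) ≤ c := by
  refine (lintegral_mono_ae ((ae_sampleLaw δ hp).mono fun D hD => h D hD.1 hD.2)).trans ?_
  rw [lintegral_const]
  refine mul_le_of_le_one_right' ?_
  unfold sampleLaw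
  exact prob_le_one

end Samples

/-! ### The size of the networks -/

lemma log_le_complexity {d α : ℕ} (hα : 2 ≤ α) {δ : ℝ} (hδ : 0 < δ) (hδ3 : δ < 1 / 3) :
    Real.log (1 / δ) ≤ complexity d α δ := by
  have hα' : (2 : ℝ) ≤ α := by exact_mod_cast hα
  refine le_mul_of_one_le_left (zero_le_one.trans (one_le_log_one_div hδ hδ3)) ?_
  refine Real.one_le_rpow_of_pos_of_le_one_of_nonpos hδ (by linarith) ?_
  exact div_nonpos_of_nonpos_of_nonneg (by simp) (by linarith)

/-- The approximator, with the sizes of the estimators built on it. The bumps contribute `O(n)` to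
the first two layers and to the number of parameters, and only constants to the other layers. -/
lemma exists_architecture (d : ℕ) {α : ℕ} (hα : 2 ≤ α) {B : ℝ} (hB : 0 ≤ B) :
    ∃ K : ℝ, ∀ (n : ℕ) (δ : ℝ) (f : (Fin d → ℝ) → ℝ), 0 < δ → δ < 1 / 3 → InHolderBall α B f →
      ∃ (L W P : ℕ) (g : (Fin d → ℝ) → ℝ), 2 ≤ L ∧
        Computes (fun _ => W) L P g ∧
        ((L + 2 : ℕ) : ℝ) ≤ K * Real.log (1 / δ) ∧
        (∀ ℓ < L + 2, ℓ < 2 → (estimatorWidth d n L W ℓ : ℝ) ≤ K * (complexity d α δ + n)) ∧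
        (∀ ℓ < L + 2, 2 ≤ ℓ → (estimatorWidth d n L W ℓ : ℝ) ≤ K * complexity d α δ) ∧
        (((P + 2 * (n * fullCount d (fun _ => 2 * d + 1) 1 + 2 * (n * (2 * d + 1) + 1) + 6 * L) +
          6 * (W + 5) + 24) + estimatorWidth d n L W (L + 1) : ℕ) : ℝ) ≤
            K * (complexity d α δ + n) ∧
        (∀ x ∈ cube d, |g x - f x| ≤ 2 * √δ) ∧
        (∀ x ∈ cube d, ∀ y ∈ cube d, ‖x - y‖ ≤ δ → |g x - g y| ≤ (B + 3) * δ) := by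
  obtain ⟨K, hK, h⟩ := exists_approximator d hα hB
  set c := fullCount d (fun _ => 2 * d + 1) 1
  refine ⟨19 * K + 64 + 2 * c + 8 * d + 4, fun n δ f hδ hδ3 hf => ?_⟩
  obtain ⟨L, W, P, g, hL2, hL, hW, hP, hg, hgf, hgc⟩ := h δ f hδ hδ3 hf
  have hlog := one_le_log_one_div hδ hδ3
  have hS := log_le_complexity (d := d) hα hδ hδ3
  set S := complexity d α δ
  set ℓ₀ := Real.log (1 / δ)
  have hKS : K * ℓ₀ ≤ K * S := mul_le_mul_of_nonneg_left hS hK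
  have hc0 : (0 : ℝ) ≤ c := c.cast_nonneg
  have hd0 : (0 : ℝ) ≤ d := d.cast_nonneg
  have hn0 : (0 : ℝ) ≤ n := n.cast_nonneg
  have hKn := mul_nonneg hK hn0
  have hcS := mul_nonneg hc0 (by linarith : 0 ≤ S)
  have hdS := mul_nonneg hd0 (by linarith : 0 ≤ S)
  have hcl := mul_nonneg hc0 (by linarith : 0 ≤ ℓ₀)
  have hdl := mul_nonneg hd0 (by linarith : 0 ≤ ℓ₀)
  have hKl := mul_nonneg hK (by linarith : 0 ≤ ℓ₀)
  have hcn := mul_nonneg hc0 hn0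
  have hdn := mul_nonneg hd0 hn0
  refine ⟨L, W, P, g, hL2, hg, ?_, fun ℓ _ hℓ => ?_, fun ℓ _ hℓ => ?_, ?_, hgf, hgc⟩
  · push_cast
    nlinarith
  · rw [estimatorWidth, if_pos (by omega), if_pos (by omega)]
    push_cast
    nlinarith
  · rw [estimatorWidth, if_neg (by omega : ¬ ℓ ≤ 1)]
    split_ifs
    · push_cast
      nlinarith
    · push_cast
      nlinarith
  · rw [estimatorWidth, if_neg (by omega : ¬ L + 1 ≤ L)]
    push_cast
    nlinarith

/-! ### Global minima and the two regimes of the bound -/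

lemma empAdvRisk_estimator {d n : ℕ} {𝒳 : Set (Fin d → ℝ)} {δ η b a : ℝ} {g : (Fin d → ℝ) → ℝ}
    {D : Sample d n} (hδ : 0 < δ) (hη : 0 < η) (hηδ : η ≤ δ) (hD : δ < sepDist D / 3)
    (hg : ∀ x ∈ 𝒳, |g x| ≤ b) : empAdvRisk 𝒳 δ D (estimator δ η b a g D) = 0 := by
  rw [empAdvRisk, Finset.sum_eq_zero, mul_zero]
  intro i _
  refine le_antisymm (iSup₂_le fun x' hx' => ?_) zero_le
  rw [estimator_eq_label hδ hη hηδ hD hx'.2 (hg x' hx'.1), sub_self]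
  simp

lemma lt_third_of_lt {d n : ℕ} (hn : 1 ≤ n) {δ : ℝ}
    (h : δ < (1 / 3) * (n : ℝ) ^ (-(1 : ℝ) / (d : ℝ))) : δ < 1 / 3 := by
  have h1 : (n : ℝ) ^ (-(1 : ℝ) / (d : ℝ)) ≤ 1 :=
    Real.rpow_le_one_of_one_le_of_nonpos (by exact_mod_cast hn)
      (div_nonpos_of_nonpos_of_nonneg (by norm_num) d.cast_nonneg)
  linarith

/-- If `n δ^{d-1} ≥ 1`, then the volume term dominates `δ`. -/
lemma le_volume_of_rpow_le {d n : ℕ} (hd : 2 ≤ d) (hn : 1 ≤ n) {δ C₀ : ℝ} (hδ : 0 < δ)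
    (hC₀ : 0 ≤ C₀) (h : (n : ℝ) ^ (-(1 : ℝ) / ((d : ℝ) - 1)) ≤ δ) :
    δ ≤ ((4 + 2 * C₀) * δ) ^ d * n := by
  obtain ⟨k, rfl⟩ : ∃ k, d = k + 1 := ⟨d - 1, by omega⟩
  have hk : (k : ℝ) ≠ 0 := by
    have : k ≠ 0 := by omega
    exact_mod_cast this
  have hn0 : (0 : ℝ) < n := by exact_mod_cast hn
  have h1 : 1 ≤ δ ^ k * n := by
    have h2 := pow_le_pow_left₀ (Real.rpow_nonneg hn0.le _) h k
    rw [← Real.rpow_natCast, ← Real.rpow_mul hn0.le, Nat.cast_succ, add_sub_cancel_right,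
      div_mul_cancel₀ _ hk, Real.rpow_neg_one] at h2
    rwa [← div_le_iff₀ hn0, one_div]
  calc δ = δ * 1 := (mul_one δ).symm
    _ ≤ δ * (δ ^ k * n) := by gcongr
    _ = (1 * δ) ^ (k + 1) * n := by ring
    _ ≤ _ := by gcongr; linarith

end AdvTrain

end

theorem theorem4 :
    ∃ (C₃ : ℝ → ℝ → ℝ → ℝ) (K : ℕ → ℕ → ℝ → ℝ),
      ∀ (d α n : ℕ) (B M δ C₀ : ℝ) (𝒳 : Set (Fin d → ℝ))
        (ρ : MeasureTheory.Measure ((Fin d → ℝ) × ℝ)) [MeasureTheory.IsProbabilityMeasure ρ]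
        (fρ : (Fin d → ℝ) → ℝ),
        1 ≤ d → 2 ≤ α → 2 ≤ n → 0 < B → 0 < M →
        -- the data distribution lives on `𝒳 × [-M, M]` with `𝒳 ⊆ [0,1]^d`
        MeasurableSet 𝒳 → 𝒳 ⊆ AdvTrain.cube d →
        (∀ᵐ z ∂ρ, z.1 ∈ 𝒳 ∧ |z.2| ≤ M) →
        AdvTrain.normJ 𝒳 ρ < ⊤ → AdvTrain.normJbar 𝒳 ρ < ⊤ →
        -- the conditional mean is in the ball of radius `B` of `W^α_∞([0,1]^d)`
        (∀ᵐ x ∂ρ.fst, AdvTrain.condMean ρ x = fρ x) → AdvTrain.InHolderBall α B fρ →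
        0 < δ → δ < (1 / 3) * (n : ℝ) ^ (-(1 : ℝ) / (d : ℝ)) →
        0 < C₀ → C₀ ≤ 1 →
        ∃ (L : ℕ) (w : ℕ → ℕ) (fhat : ℕ → AdvTrain.Sample d n → (Fin d → ℝ) → ℝ),
          -- depth and widths `d_1 = w 0`, `d_2 = w 1`, …, `d_L = w (L - 1)`
          1 ≤ L ∧ (L : ℝ) ≤ K d α B * Real.log (1 / δ) ∧
          (∀ ℓ < L, ℓ < 2 → (w ℓ : ℝ) ≤ K d α B * (AdvTrain.complexity d α δ + n)) ∧
          (∀ ℓ < L, 2 ≤ ℓ → (w ℓ : ℝ) ≤ K d α B * AdvTrain.complexity d α δ) ∧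
          -- for each sample with `δ < q_X / 3`: infinitely many global minima
          (∀ D : AdvTrain.Sample d n, (∀ i, (D i).1 ∈ 𝒳 ∧ |(D i).2| ≤ M) →
            δ < AdvTrain.sepDist D / 3 →
            (∀ j, fhat j D ∈ AdvTrain.advMinima 𝒳 δ D L w) ∧
            (∀ j, ∃ θ : AdvTrain.NetParams d L w, θ.toFun = fhat j D ∧
              (θ.nnz : ℝ) ≤ K d α B * (AdvTrain.complexity d α δ + n)) ∧
            (∀ j k, j ≠ k → ∃ x ∈ AdvTrain.cube d, fhat j D x ≠ fhat k D x)) ∧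
          -- expected excess adversarial generalization error
          ∀ j,
            AEMeasurable (fun D => AdvTrain.excessAdvRisk 𝒳 δ ρ (fhat j D))
              (AdvTrain.sampleLaw n ρ δ) ∧
            ∫⁻ D, AdvTrain.excessAdvRisk 𝒳 δ ρ (fhat j D) ∂(AdvTrain.sampleLaw n ρ δ) ≤
              ENNReal.ofReal (C₃ (AdvTrain.normJ 𝒳 ρ).toReal B M * Real.sqrt d *
                max δ (((4 + 2 * C₀) * δ) ^ d * n)) ∧
            (2 ≤ d → (n : ℝ) ^ (-(1 : ℝ) / ((d : ℝ) - 1)) ≤ δ →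
              ∫⁻ D, AdvTrain.excessAdvRisk 𝒳 δ ρ (fhat j D) ∂(AdvTrain.sampleLaw n ρ δ) ≤
                ENNReal.ofReal (C₃ (AdvTrain.normJ 𝒳 ρ).toReal B M * Real.sqrt d *
                  (((4 + 2 * C₀) * δ) ^ d * n))) := by
  have hK : ∀ (d α : ℕ) (B : ℝ), ∃ K : ℝ, 2 ≤ α → 0 ≤ B → ∀ (n : ℕ) (δ : ℝ)
      (f : (Fin d → ℝ) → ℝ), 0 < δ → δ < 1 / 3 → AdvTrain.InHolderBall α B f → _ := fun d α B => by
    by_cases h : 2 ≤ α ∧ 0 ≤ B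
    · obtain ⟨K, hK⟩ := AdvTrain.exists_architecture d h.1 h.2
      exact ⟨K, fun _ _ => hK⟩
    · exact ⟨0, fun h1 h2 => absurd ⟨h1, h2⟩ h⟩
  choose K hK using hK
  refine ⟨AdvTrain.riskFactor, K, ?_⟩
  intro d α n B M δ C₀ 𝒳 ρ _ fρ hd hα hn hB hM _ h𝒳 hρ hJ _ hmean hf hδ hδn hC₀ hC₀1
  have hn1 : 1 ≤ n := by omega
  have hδ3 := AdvTrain.lt_third_of_lt hn1 hδn
  obtain ⟨L, W, P, g, hL2, hg, hL, hw1, hw2, hP, hgf, hgc⟩ := hK d α B hα hB.le n δ fρ hδ hδ3 hf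
  have hη : 0 < C₀ * δ := mul_pos hC₀ hδ
  have hηδ : C₀ * δ ≤ δ := mul_le_of_le_one_left hδ.le hC₀1
  have hgb : ∀ x ∈ AdvTrain.cube d, |g x| ≤ B + 2 := fun x hx => by
    have h1 : |fρ x| ≤ B := by
      have := hf.abs_mixedDeriv_le hB.le (k := 0) (by simp) hx
      rwa [AdvTrain.mixedDeriv_zero] at this
    have h2 : √δ ≤ 1 := Real.sqrt_le_one.2 (by linarith)
    have h3 := abs_add_le (g x - fρ x) (fρ x)
    rw [sub_add_cancel] at h3
    linarith [hgf x hx]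
  have ha : ∀ j : ℕ, (0 : ℝ) ≤ 1 / ((j : ℝ) + 1) ∧ 1 / ((j : ℝ) + 1) ≤ 1 := fun j =>
    ⟨by positivity, (div_le_one (by positivity)).2 (by simp)⟩
  -- the risk bound without the factor `√d ≥ 1`
  have hrisk : ∀ j : ℕ, ∫⁻ D, AdvTrain.excessAdvRisk 𝒳 δ ρ
      (AdvTrain.estimator δ (C₀ * δ) (B + 2) (1 / ((j : ℝ) + 1)) g D)
        ∂(AdvTrain.sampleLaw n ρ δ) ≤
      ENNReal.ofReal (AdvTrain.riskFactor (AdvTrain.normJ 𝒳 ρ).toReal B M * Real.sqrt d *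
        max δ (((4 + 2 * C₀) * δ) ^ d * n)) := fun j => by
    refine AdvTrain.lintegral_sampleLaw_le δ hρ fun D hD hsep => ?_
    refine (AdvTrain.excessAdvRisk_estimator_le hB.le hM.le h𝒳 hρ hJ hmean hδ hC₀ hC₀1 (ha j).1
      (ha j).2 hg.continuous hgb hgf hgc (fun i => (hD i).2) hsep).trans ?_
    refine ENNReal.ofReal_le_ofReal (mul_le_mul_of_nonneg_right (le_mul_of_one_le_right
      (AdvTrain.riskFactor_nonneg ENNReal.toReal_nonneg hB.le hM.le) ?_)
      (hδ.le.trans (le_max_left _ _)))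
    exact Real.one_le_sqrt.2 (by exact_mod_cast hd)
  have hnet : ∀ (j : ℕ) (D : AdvTrain.Sample d n),
      ∃ θ : AdvTrain.NetParams d (L + 2) (AdvTrain.estimatorWidth d n L W),
        θ.toFun = AdvTrain.estimator δ (C₀ * δ) (B + 2) (1 / ((j : ℝ) + 1)) g D ∧
        (θ.nnz : ℝ) ≤ K d α B * (AdvTrain.complexity d α δ + n) := fun j D => by
    obtain ⟨θ, hθ, hnnz⟩ := (AdvTrain.computes_estimator (δ := δ) (η := C₀ * δ) (b := B + 2)
      (a := 1 / ((j : ℝ) + 1)) (D := D) hL2 hg).exists_netParams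
    exact ⟨θ, hθ, (Nat.cast_le.2 hnnz).trans hP⟩
  refine ⟨L + 2, AdvTrain.estimatorWidth d n L W,
    fun j D => AdvTrain.estimator δ (C₀ * δ) (B + 2) (1 / ((j : ℝ) + 1)) g D,
    by omega, hL, hw1, hw2, fun D hD hsep => ⟨fun j => ?_, fun j => hnet j D, fun j k hjk => ?_⟩,
    fun j => ⟨?_, hrisk j, fun hd2 hnδ => ?_⟩⟩
  · obtain ⟨θ, hθ, -⟩ := hnet j D
    refine ⟨⟨θ, hθ⟩, fun f _ => ?_⟩
    rw [AdvTrain.empAdvRisk_estimator hδ hη hηδ hsep fun x hx => hgb x (h𝒳 hx)]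
    exact zero_le
  · refine AdvTrain.exists_estimator_ne hδ hδ3 hη hηδ hsep hd hn1 (fun i => h𝒳 (hD i).1) fun h => ?_
    rw [one_div, one_div, inv_inj, add_left_inj, Nat.cast_inj] at h
    exact hjk h
  · exact ((AdvTrain.measurable_advRisk 𝒳 hδ ρ (AdvTrain.fst_absolutelyContinuous h𝒳 hJ)
      (fun D => AdvTrain.continuous_estimator _ _ _ _ hg.continuous D)
      (fun x => AdvTrain.measurable_estimator _ _ _ _ g x)).sub_const _).aemeasurable
  · have h := hrisk j
    rwa [max_eq_right (AdvTrain.le_volume_of_rpow_le hd2 hn1 hδ hC₀.le hnδ)] at h
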